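/- Let $R>1$, let $\Omega_R=\{\xi\in\mathbb R^2:1<|\xi|<R\}$, let $B_r$ be the open disk of radius $r$ centered at the origin, and write $\rho=|\xi|$, $\widehat\rho=\xi/\rho$, and $\widehat\theta$ for $\widehat\rho$ rotated by $+\pi/2$. Given $\omega\ge0$ and $f\in L^2(\Omega_R)$ (a vector field), consider the problem $$-\Delta u+(u\cdot\nabla)u+\nabla p=f,\quad \nabla\cdot u=0\ \text{ in }\Omega_R,\qquad u=\omega\,\widehat\theta\ \text{ on }\partial B_R,\quad u=0\ \text{ on }\partial B_1. \tag{TC}$$ A *strong solution* is a pair $(u,p)\in H^2(\Omega_R)\times H^1(\Omega_R)$ satisfying the equations a.e. and the boundary conditions in the trace sense. A *weak solution* is a divergence-free field $u\in H^1(\Omega_R)$ satisfying the boundary conditions in the trace sense and $$\int_{\Omega_R}\nabla u\cdot\nabla\varphi+\int_{\Omega_R}(u\cdot\nabla)u\cdot\varphi=\int_{\Omega_R}f\cdot\varphi\quad\text{for all divergence-free }\varphi\in H^1_0(\Omega_R).$$ A vector field $u$ (a scalar $q$) is *rotationally invariant* if for every rotation $\mathcal R(\phi)$ about the origin $u(\xi)=\mathcal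 R(\phi)^{\top}u(\mathcal R(\phi)\xi)$ (respectively $q(\xi)=q(\mathcal R(\phi)\xi)$) for a.e. $\xi\in\Omega_R$. Assume that $f$ is rotationally invariant. Then $f(\xi)=f^\rho(\rho)\widehat\rho+f^\theta(\rho)\widehat\theta$ a.e. in $\Omega_R$ for some $f^\rho,f^\theta\in L^2(1,R)$. For all such $f^\rho,f^\theta$, set $$A=\frac{R}{R^2-1}\Big(\omega+\frac R2\int_1^R f^\theta(t)\,dt-\frac1{2R}\int_1^R t^2f^\theta(t)\,dt\Big),$$ $$V(\rho)=A\Big(\rho-\frac1\rho\Big)-\frac\rho2\int_1^\rho f^\theta(t)\,dt+\frac1{2\rho}\int_1^\rho t^2f^\theta(t)\,dt,$$ $$v_*(\xi)=V(\rho)\,\widehat\theta,\qquad q_*(\xi)=\int_1^\rho\frac{V(t)^2}{t}\,dt+\int_1^\rho f^\rho(t)\,dt .$$ Then $(v_*,q_*)$ is a rotationally invariant strong solution of (TC), and $v_*$ is a weak solution of (TC). Moreover: 1. (All data.) If $(u,p)$ is a strong solution of (TC) with $u$ and $p$ rotationally invariant, then $u=v_*$ a.e. and $p-q_*$ is a.e.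 constant. If $u$ is a rotationally invariant weak solution, then $u=v_*$ a.e. 2. (Small data.) Let $\lambda(\Omega_R)=\inf\big\{\|\nabla v\|_{L^2}^2/\|v\|_{L^2}^2: 0\ne v\in H^1_0(\Omega_R)\big\}$ be the first Dirichlet eigenvalue. If $$K_R(\omega,f)=\omega+\frac{\sqrt{R-1}}{\sqrt{15}\,R}\sqrt{8R^4-7R^3-7R^2+3R+3}\;\|f^\theta\|_{L^2(\Omega_R)}<\sqrt{\lambda(\Omega_R)},$$ where $\|f^\theta\|_{L^2(\Omega_R)}$ is the norm of $\xi\mapsto f^\theta(|\xi|)$, then every strong solution $(u,p)$ of (TC) satisfies $u=v_*$ a.e. and $p-q_*$ is a.e. constant, and every weak solution $u$ of (TC) satisfies $u=v_*$ a.e. -/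

import Mathlib

open MeasureTheory Filter Topology Set
open scoped ENNReal

noncomputable section

namespace TaylorCouette

/-- The Euclidean plane. -/
abbrev Plane := EuclideanSpace ℝ (Fin 2)

/-- The annulus `B_R` minus the closed unit disk. -/
def annulus (R : ℝ) : Set Plane := Metric.ball 0 R \ Metric.closedBall 0 1

/-- The point `r (cos θ, sin θ)` of the circle of radius `r`. -/
def circlePoint (r θ : ℝ) : Plane := !₂[r * Real.cos θ, r * Real.sin θ]

/-- The radial unit vector field. -/
def rhoHat (x : Plane) : Plane := !₂[x 0 / ‖x‖, x 1 / ‖x‖]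

/-- The angular unit vector field. -/
def thetaHat (x : Plane) : Plane := !₂[-x 1 / ‖x‖, x 0 / ‖x‖]

/-! ### Sobolev spaces on an open set of the plane -/

/-- The classical partial derivative in the `i`-th coordinate direction. -/
def partialDeriv (i : Fin 2) (φ : Plane → ℝ) (x : Plane) : ℝ :=
  fderiv ℝ φ x (EuclideanSpace.single i 1)

/-- `φ ∈ C_c^∞(Ω)`. -/
def IsTestFunction (Ω : Set Plane) (φ : Plane → ℝ) : Prop :=
  ContDiff ℝ (⊤ : ℕ∞) φ ∧ HasCompactSupport φ ∧ tsupport φ ⊆ Ω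

/-- `g` is a weak partial derivative `∂ᵢ u` on `Ω`. -/
def HasWeakPartial (Ω : Set Plane) (i : Fin 2) (u g : Plane → ℝ) : Prop :=
  LocallyIntegrableOn u Ω ∧ LocallyIntegrableOn g Ω ∧
    ∀ φ : Plane → ℝ, IsTestFunction Ω φ →
      ∫ x in Ω, u x * partialDeriv i φ x = -∫ x in Ω, g x * φ x

open Classical in
/-- A representative of the weak partial derivative `∂ᵢ u` on `Ω` (unique up to null sets when it
exists, and `0` by convention otherwise). -/
def weakPartial (Ω : Set Plane) (i : Fin 2) (u : Plane → ℝ) : Plane → ℝ :=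
  if h : ∃ g, HasWeakPartial Ω i u g then h.choose else 0

/-- `u ∈ L²(Ω)`. -/
def MemL2 {F : Type*} [NormedAddCommGroup F] (Ω : Set Plane) (u : Plane → F) : Prop :=
  MemLp u 2 (volume.restrict Ω)

/-- `u ∈ H¹(Ω)`. -/
def MemH1 (Ω : Set Plane) (u : Plane → ℝ) : Prop :=
  MemL2 Ω u ∧ ∀ i, ∃ g, HasWeakPartial Ω i u g ∧ MemL2 Ω g

/-- `u ∈ H²(Ω)`. -/
def MemH2 (Ω : Set Plane) (u : Plane → ℝ) : Prop :=
  MemH1 Ω u ∧ ∀ i, MemH1 Ω (weakPartial Ω i u)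

/-- The `C¹` functions `w n` converge to `u` in the norm of `H¹(Ω)`. -/
def TendstoH1 (Ω : Set Plane) (w : ℕ → Plane → ℝ) (u : Plane → ℝ) : Prop :=
  Tendsto (fun n => eLpNorm (fun x => w n x - u x) 2 (volume.restrict Ω)) atTop (𝓝 0) ∧
  ∀ i, Tendsto (fun n => eLpNorm (fun x => partialDeriv i (w n) x - weakPartial Ω i u x) 2
    (volume.restrict Ω)) atTop (𝓝 0)

/-- `u ∈ H¹₀(Ω)`: the closure of `C_c^∞(Ω)` in `H¹(Ω)`. -/
def MemH10 (Ω : Set Plane) (u : Plane → ℝ) : Prop :=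
  MemH1 Ω u ∧ ∃ w : ℕ → Plane → ℝ, (∀ n, IsTestFunction Ω (w n)) ∧ TendstoH1 Ω w u

/-- For `u ∈ H¹(Ω)`, with `Ω` an annulus and `r` one of its radii: `u = g` on the circle of radius
`r` in the sense of traces. The trace operator is the continuous extension to `H¹(Ω)` of the
restriction map from `C¹` functions on the closure of `Ω` to `L²` of the circle, so `g` is the
trace of `u` when some `C¹` functions converge to `u` in `H¹(Ω)` and to `g` in `L²` of the
circle. -/
def HasTraceOnCircle (Ω : Set Plane) (r : ℝ) (u g : Plane → ℝ) : Prop :=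
  ∃ w : ℕ → Plane → ℝ, (∀ n, ContDiff ℝ 1 (w n)) ∧ TendstoH1 Ω w u ∧
    Tendsto (fun n => eLpNorm (fun θ => w n (circlePoint r θ) - g (circlePoint r θ)) 2
      (volume.restrict (Ioc 0 (2 * Real.pi)))) atTop (𝓝 0)

/-- The first eigenvalue of the Dirichlet Laplacian: the infimum of the Rayleigh quotient
`‖∇v‖² / ‖v‖²` over the nonzero `v ∈ H¹₀(Ω)`. -/
def dirichletEigenvalue (Ω : Set Plane) : ℝ :=
  sInf {c : ℝ | ∃ v : Plane → ℝ, MemH10 Ω v ∧ ¬ (v =ᵐ[volume.restrict Ω] 0) ∧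
    c = (∑ i, ∫ x in Ω, weakPartial Ω i v x ^ 2) / ∫ x in Ω, v x ^ 2}

/-! ### Vector fields -/

/-- The `i`-th component of a vector field. -/
def comp (u : Plane → Plane) (i : Fin 2) : Plane → ℝ := fun x => u x i

/-- The weak divergence. -/
def weakDiv (Ω : Set Plane) (u : Plane → Plane) (x : Plane) : ℝ :=
  ∑ i, weakPartial Ω i (comp u i) x

/-- The `i`-th component of the weak Laplacian of a vector field. -/
def weakLaplacian (Ω : Set Plane) (u : Plane → Plane) (i : Fin 2) (x : Plane) : ℝ :=
  ∑ j, weakPartial Ω j (weakPartial Ω j (comp u i)) x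

/-- The `i`-th component of `(u · ∇) u`. -/
def convection (Ω : Set Plane) (u : Plane → Plane) (i : Fin 2) (x : Plane) : ℝ :=
  ∑ j, u x j * weakPartial Ω j (comp u i) x

/-- Divergence-free fields of class `H¹₀`. -/
def MemH10Sigma (Ω : Set Plane) (φ : Plane → Plane) : Prop :=
  (∀ i, MemH10 Ω (comp φ i)) ∧ ∀ᵐ x ∂volume.restrict Ω, weakDiv Ω φ x = 0

/-- Divergence-free fields of class `H¹` on the annulus that vanish on the inner circle. -/
def MemH1StarSigma (R : ℝ) (u : Plane → Plane) : Prop :=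
  (∀ i, MemH1 (annulus R) (comp u i)) ∧
  (∀ i, HasTraceOnCircle (annulus R) 1 (comp u i) 0) ∧
  ∀ᵐ x ∂volume.restrict (annulus R), weakDiv (annulus R) u x = 0

/-! ### The Taylor–Couette problem -/

/-- `(u, p) ∈ H² × H¹` is a strong solution of
`-Δu + (u·∇)u + ∇p = f`, `∇·u = 0` in the annulus, `u = ω θ̂` on `∂B_R`, `u = 0` on `∂B_1`. -/
structure IsStrongSolution (R ω : ℝ) (f : Plane → Plane) (u : Plane → Plane) (p : Plane → ℝ) :
    Prop where
  velocity_memH2 : ∀ i, MemH2 (annulus R) (comp u i)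
  pressure_memH1 : MemH1 (annulus R) p
  momentum : ∀ᵐ x ∂volume.restrict (annulus R), ∀ i,
    -weakLaplacian (annulus R) u i x + convection (annulus R) u i x
      + weakPartial (annulus R) i p x = f x i
  div_free : ∀ᵐ x ∂volume.restrict (annulus R), weakDiv (annulus R) u x = 0
  outer_boundary : ∀ i,
    HasTraceOnCircle (annulus R) R (comp u i) (comp (fun x => ω • thetaHat x) i)
  inner_boundary : ∀ i, HasTraceOnCircle (annulus R) 1 (comp u i) 0

/-- `u` is a weak solution: a divergence-free `H¹` field with the boundary values above (in the
trace sense), which satisfies the equation against all divergence-free `H¹₀` fields. -/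
structure IsWeakSolution (R ω : ℝ) (f : Plane → Plane) (u : Plane → Plane) : Prop where
  mem : MemH1StarSigma R u
  outer_boundary : ∀ i,
    HasTraceOnCircle (annulus R) R (comp u i) (comp (fun x => ω • thetaHat x) i)
  weak_form : ∀ φ : Plane → Plane, MemH10Sigma (annulus R) φ →
    (∫ x in annulus R, ∑ i, ∑ j,
        weakPartial (annulus R) j (comp u i) x * weakPartial (annulus R) j (comp φ i) x)
      + (∫ x in annulus R, ∑ i, convection (annulus R) u i x * φ x i)
    = ∫ x in annulus R, ∑ i, f x i * φ x i

/-! ### Rotational invariance -/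

/-- The matrix of the rotation by the angle `φ` about the origin. -/
def rotMatrix (φ : ℝ) : Matrix (Fin 2) (Fin 2) ℝ :=
  !![Real.cos φ, -Real.sin φ; Real.sin φ, Real.cos φ]

/-- A matrix acting on vectors of the plane. -/
def act (M : Matrix (Fin 2) (Fin 2) ℝ) (x : Plane) : Plane := WithLp.toLp 2 (M.mulVec x.ofLp)

/-- Rotational invariance of (the a.e. class of) a vector field on `Ω`. -/
def RotInvField (Ω : Set Plane) (u : Plane → Plane) : Prop :=
  ∀ φ : ℝ, ∀ᵐ x ∂volume.restrict Ω, u x = act (rotMatrix φ).transpose (u (act (rotMatrix φ) x))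

/-- Rotational invariance of (the a.e. class of) a scalar function on `Ω`. -/
def RotInvScalar (Ω : Set Plane) (q : Plane → ℝ) : Prop :=
  ∀ φ : ℝ, ∀ᵐ x ∂volume.restrict Ω, q x = q (act (rotMatrix φ) x)

/-- `fρ, fθ ∈ L²(1,R)` are the radial and angular components of `f`:
`f = fρ(ρ) ρ̂ + fθ(ρ) θ̂` a.e. in the annulus. -/
def IsPolarRep (R : ℝ) (f : Plane → Plane) (fρ fθ : ℝ → ℝ) : Prop :=
  MemLp fρ 2 (volume.restrict (Ioo 1 R)) ∧ MemLp fθ 2 (volume.restrict (Ioo 1 R)) ∧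
  ∀ᵐ x ∂volume.restrict (annulus R), f x = fρ ‖x‖ • rhoHat x + fθ ‖x‖ • thetaHat x

/-! ### The generalized Taylor–Couette flow -/

/-- The constant `A_R(ω, f)`. -/
def constA (R ω : ℝ) (fθ : ℝ → ℝ) : ℝ :=
  R / (R ^ 2 - 1) *
    (ω + R / 2 * (∫ t in (1 : ℝ)..R, fθ t) - 1 / (2 * R) * (∫ t in (1 : ℝ)..R, t ^ 2 * fθ t))

/-- The angular velocity profile, as a function of the radius. -/
def vProfile (R ω : ℝ) (fθ : ℝ → ℝ) (ρ : ℝ) : ℝ :=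
  constA R ω fθ * (ρ - 1 / ρ) - ρ / 2 * (∫ t in (1 : ℝ)..ρ, fθ t)
    + 1 / (2 * ρ) * (∫ t in (1 : ℝ)..ρ, t ^ 2 * fθ t)

/-- The velocity `v_*`. -/
def vStar (R ω : ℝ) (fθ : ℝ → ℝ) (x : Plane) : Plane := vProfile R ω fθ ‖x‖ • thetaHat x

/-- The pressure `q_*`. -/
def qStar (R ω : ℝ) (fρ fθ : ℝ → ℝ) (x : Plane) : ℝ :=
  (∫ t in (1 : ℝ)..‖x‖, 1 / t * vProfile R ω fθ t ^ 2) + ∫ t in (1 : ℝ)..‖x‖, fρ t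

/-- The quantity `K_R(ω, f)`; the last factor is the norm of `x ↦ fθ(|x|)` in `L²` of the
annulus. -/
def constK (R ω : ℝ) (fθ : ℝ → ℝ) : ℝ :=
  ω + Real.sqrt (R - 1) / (Real.sqrt 15 * R)
    * Real.sqrt (8 * R ^ 4 - 7 * R ^ 3 - 7 * R ^ 2 + 3 * R + 3)
    * Real.sqrt (∫ x in annulus R, fθ ‖x‖ ^ 2)

end TaylorCouette

end

open TaylorCouette

/-!
# Uniqueness of the generalized Taylor–Couette flow

A rotationally invariant `f` has radial functions as its polar components, because its components
in the frame `ρ̂, θ̂` are invariant scalars and may be averaged over circles (`exists_isPolarRep`).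

*The explicit flow.* On the closed annulus `v_* = (V / ρ) x^⊥`, and the angular speed `V / ρ` is a
primitive of the continuous function `(2 A - ∫₁^ρ t² fθ) / ρ³` (`vProfile_eq`). This shows that `v_*`
is the restriction of a `C¹` field, so that its traces are its boundary values, and that its second
derivatives contain `fθ` only linearly, so that `v_*` is in `H²`. The Laplacian of `v_*` is `-fθ θ̂`,
and `(v_* · ∇) v_* = -(V² / ρ) ρ̂` is the gradient of a radial function that goes into the pressure
(`momentum_vStar`). Functions `∫₁^|x| k` are differentiated weakly for integrable `k`
(`hasWeakPartial_primitive_norm`). Strong solutions are weak ones by integration by parts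
(`IsStrongSolution.isWeakSolution`).

*Uniqueness.* Let `v` be the difference of a weak solution and `v_*`. It has zero traces, and
functions in `H¹` with zero traces belong to `H¹₀` by Hardy's inequality at the boundary
(`memH10_of_hasTraceOnCircle`), so `v` may be used as a test field. Since `H¹₀ ⊆ L⁴` in two
dimensions, the transport term cancels, and `‖∇v‖² = -∫ (v · ∇) v_* · v`
(`IsWeakSolution.energy_identity`).

* If `v` is rotationally invariant, testing `∇ · v = 0` with a radial function shows that `v` has no
  radial component (`MemH10Sigma.radial_ae_eq_zero`), and then the right side vanishes pointwise.
* In general the right side equals `∫ (v · ∇) v · v_*`, whose size is at most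
  `sup |V| ‖v‖ ‖∇v‖`. The supremum is at most `K_R(ω, f)` (`abs_vProfile_le`), and
  `λ ‖v‖² ≤ ‖∇v‖²`. Hence `v = 0` if `K_R(ω, f)² < λ`.

Once `u = v_*`, the momentum equations give equal pressure gradients, and a function with vanishing
weak gradient on the connected annulus is constant (`exists_ae_eq_const`).
-/

open MeasureTheory Filter Topology Set
open scoped ENNReal

noncomputable section

namespace TaylorCouette

section

/-! ### Weak partial derivatives -/

variable {Ω : Set Plane} {i : Fin 2} {u v g h φ z : Plane → ℝ} {R : ℝ}

lemma mem_annulus {x : Plane} : x ∈ annulus R ↔ 1 < ‖x‖ ∧ ‖x‖ < R := by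
  simp [annulus, and_comm]

lemma isOpen_annulus : IsOpen (annulus R) := Metric.isOpen_ball.sdiff Metric.isClosed_closedBall

instance isFiniteMeasure_annulus : IsFiniteMeasure (volume.restrict (annulus R)) :=
  ⟨by
    rw [Measure.restrict_apply_univ]
    exact (measure_mono sdiff_subset).trans_lt measure_ball_lt_top⟩

lemma IsTestFunction.continuous (hφ : IsTestFunction Ω φ) : Continuous φ := hφ.1.continuous

lemma contDiff_partialDeriv {n : ℕ∞} (hu : ContDiff ℝ (n + 1) u) :
    ContDiff ℝ n (partialDeriv i u) :=
  (hu.fderiv_right le_rfl).clm_apply contDiff_const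

lemma continuous_partialDeriv (hu : ContDiff ℝ 1 u) : Continuous (partialDeriv i u) :=
  (hu.continuous_fderiv one_ne_zero).clm_apply continuous_const

lemma tsupport_partialDeriv_subset : tsupport (partialDeriv i u) ⊆ tsupport u := by
  refine closure_minimal (fun x hx => ?_) (isClosed_tsupport u)
  refine support_fderiv_subset ℝ (f := u) fun h0 => hx ?_
  simp [partialDeriv, h0]

lemma IsTestFunction.partialDeriv (hφ : IsTestFunction Ω φ) :
    IsTestFunction Ω (partialDeriv i φ) :=
  ⟨contDiff_partialDeriv (n := ⊤) hφ.1,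
    hφ.2.1.of_isClosed_subset (isClosed_tsupport _) tsupport_partialDeriv_subset,
    tsupport_partialDeriv_subset.trans hφ.2.2⟩

/-- The product of a `C_c^n` function on `Ω` with a `C^n` function on `Ω` is `C^n` on the plane. -/
lemma contDiff_mul_of_tsupport_subset {n : ℕ∞} (hΩ : IsOpen Ω) (hφ : ContDiff ℝ n φ)
    (hs : tsupport φ ⊆ Ω) (hz : ContDiffOn ℝ n z Ω) : ContDiff ℝ n fun x => z x * φ x := by
  rw [contDiff_iff_contDiffAt]
  intro x
  by_cases hx : x ∈ tsupport φ
  · exact (hz.contDiffAt (hΩ.mem_nhds (hs hx))).mul hφ.contDiffAt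
  · refine (contDiffAt_const (c := (0 : ℝ))).congr_of_eventuallyEq ?_
    filter_upwards [(isClosed_tsupport φ).isOpen_compl.mem_nhds hx] with y hy
    simp [image_eq_zero_of_notMem_tsupport hy]

lemma tsupport_mul_subset_right' : tsupport (fun x => z x * φ x) ⊆ tsupport φ :=
  closure_mono fun x hx h0 => hx (by simp [h0])

lemma IsTestFunction.mul_left (hΩ : IsOpen Ω) (hφ : IsTestFunction Ω φ)
    (hz : ContDiffOn ℝ (⊤ : ℕ∞) z Ω) : IsTestFunction Ω fun x => z x * φ x :=
  ⟨contDiff_mul_of_tsupport_subset hΩ hφ.1 hφ.2.2 hz,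
    hφ.2.1.of_isClosed_subset (isClosed_tsupport _) tsupport_mul_subset_right',
    tsupport_mul_subset_right'.trans hφ.2.2⟩

lemma partialDeriv_mul {x : Plane} (hu : DifferentiableAt ℝ u x) (hv : DifferentiableAt ℝ v x) :
    partialDeriv i (fun y => u y * v y) x = partialDeriv i u x * v x + u x * partialDeriv i v x := by
  have := (hu.hasFDerivAt.mul hv.hasFDerivAt).fderiv
  simp only [partialDeriv]
  rw [show (fun y => u y * v y) = u * v from rfl, this]
  simp
  ring

lemma integrable_mul_of_locallyIntegrableOn (hu : LocallyIntegrableOn u Ω) (hφ : Continuous φ)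
    (hc : HasCompactSupport φ) (hs : tsupport φ ⊆ Ω) :
    Integrable (fun x => u x * φ x) := by
  have hK : IntegrableOn (fun x => u x * φ x) (tsupport φ) :=
    (hu.integrableOn_compact_subset hs hc).mul_continuousOn hφ.continuousOn hc
  refine (integrableOn_iff_integrable_of_support_subset fun x hx => ?_).1 hK
  exact subset_tsupport φ fun h0 => hx (by simp [h0])

lemma setIntegral_mul_of_tsupport_subset (hs : tsupport φ ⊆ Ω) :
    ∫ x in Ω, u x * φ x = ∫ x, u x * φ x :=
  setIntegral_eq_integral_of_forall_compl_eq_zero fun x hx => by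
    simp [image_eq_zero_of_notMem_tsupport fun h0 => hx (hs h0)]

lemma IsTestFunction.integrableOn_mul (hφ : IsTestFunction Ω φ) (hu : LocallyIntegrableOn u Ω) :
    IntegrableOn (fun x => u x * φ x) Ω :=
  (integrable_mul_of_locallyIntegrableOn hu hφ.continuous hφ.2.1 hφ.2.2).integrableOn

/-- Weak partial derivatives are unique up to null sets. -/
lemma HasWeakPartial.ae_eq (hΩ : IsOpen Ω) (hg : HasWeakPartial Ω i u g)
    (hh : HasWeakPartial Ω i u h) : g =ᵐ[volume.restrict Ω] h := by
  have := hΩ.ae_eq_zero_of_integral_contDiff_smul_eq_zero (f := fun x => g x - h x) (μ := volume)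
    (hg.2.1.sub hh.2.1) ?_
  · rw [EventuallyEq, ae_restrict_iff' hΩ.measurableSet]
    filter_upwards [this] with x hx hxΩ
    exact sub_eq_zero.1 (hx hxΩ)
  · intro φ h1 h2 h3
    have e1 := hg.2.2 φ ⟨h1, h2, h3⟩
    have e2 := hh.2.2 φ ⟨h1, h2, h3⟩
    have e3 : ∫ x in Ω, g x * φ x = ∫ x in Ω, h x * φ x := by linarith
    rw [setIntegral_mul_of_tsupport_subset h3, setIntegral_mul_of_tsupport_subset h3] at e3
    have : ∀ x, φ x • (g x - h x) = g x * φ x - h x * φ x := fun x => by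
      simp only [smul_eq_mul]; ring
    simp_rw [this]
    rw [integral_sub (integrable_mul_of_locallyIntegrableOn hg.2.1 h1.continuous h2 h3)
      (integrable_mul_of_locallyIntegrableOn hh.2.1 h1.continuous h2 h3), e3, sub_self]

lemma HasWeakPartial.congr_left (hg : HasWeakPartial Ω i u g) (huv : u =ᵐ[volume.restrict Ω] v) :
    HasWeakPartial Ω i v g :=
  ⟨hg.1.congr huv, hg.2.1, fun φ hφ => by
    rw [← hg.2.2 φ hφ]
    refine integral_congr_ae ?_
    filter_upwards [huv] with x hx
    rw [hx]⟩

lemma HasWeakPartial.congr_right (hg : HasWeakPartial Ω i u g) (hgh : g =ᵐ[volume.restrict Ω] h) :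
    HasWeakPartial Ω i u h :=
  ⟨hg.1, hg.2.1.congr hgh, fun φ hφ => by
    rw [hg.2.2 φ hφ]
    congr 1
    refine integral_congr_ae ?_
    filter_upwards [hgh] with x hx
    rw [hx]⟩

lemma hasWeakPartial_weakPartial (hu : ∃ g, HasWeakPartial Ω i u g) :
    HasWeakPartial Ω i u (weakPartial Ω i u) := by
  rw [weakPartial, dif_pos hu]
  exact hu.choose_spec

lemma HasWeakPartial.weakPartial_ae_eq (hΩ : IsOpen Ω) (hg : HasWeakPartial Ω i u g) :
    weakPartial Ω i u =ᵐ[volume.restrict Ω] g :=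
  (hasWeakPartial_weakPartial ⟨g, hg⟩).ae_eq hΩ hg

/-- The representative chosen by `weakPartial` depends on the a.e. class of the function only: the
equality is one of functions, because a.e. equal functions have the same weak derivatives. -/
lemma weakPartial_congr (huv : u =ᵐ[volume.restrict Ω] v) :
    weakPartial Ω i u = weakPartial Ω i v := by
  have : HasWeakPartial Ω i u = HasWeakPartial Ω i v := by
    ext g
    exact ⟨fun hg => hg.congr_left huv, fun hg => hg.congr_left huv.symm⟩
  classical
  have key : ∀ P Q : (Plane → ℝ) → Prop, P = Q →
      (if h : ∃ g, P g then h.choose else 0) = if h : ∃ g, Q g then h.choose else 0 := by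
    rintro P _ rfl
    rfl
  exact key _ _ this

lemma HasWeakPartial.add (hu : HasWeakPartial Ω i u g) (hv : HasWeakPartial Ω i v h) :
    HasWeakPartial Ω i (fun x => u x + v x) (fun x => g x + h x) := by
  refine ⟨hu.1.add hv.1, hu.2.1.add hv.2.1, fun φ hφ => ?_⟩
  simp_rw [add_mul]
  rw [integral_add (hφ.partialDeriv.integrableOn_mul hu.1) (hφ.partialDeriv.integrableOn_mul hv.1),
    integral_add (hφ.integrableOn_mul hu.2.1) (hφ.integrableOn_mul hv.2.1), hu.2.2 φ hφ, hv.2.2 φ hφ]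
  ring

lemma HasWeakPartial.const_mul (c : ℝ) (hu : HasWeakPartial Ω i u g) :
    HasWeakPartial Ω i (fun x => c * u x) (fun x => c * g x) := by
  refine ⟨hu.1.smul c, hu.2.1.smul c, fun φ hφ => ?_⟩
  simp_rw [mul_assoc]
  rw [integral_const_mul, integral_const_mul, hu.2.2 φ hφ]
  ring

lemma HasWeakPartial.sub (hu : HasWeakPartial Ω i u g) (hv : HasWeakPartial Ω i v h) :
    HasWeakPartial Ω i (fun x => u x - v x) (fun x => g x - h x) := by
  simpa [sub_eq_add_neg] using hu.add (hv.const_mul (-1))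

lemma ContDiffOn.continuousOn_partialDeriv (hΩ : IsOpen Ω) (hu : ContDiffOn ℝ 1 u Ω) :
    ContinuousOn (partialDeriv i u) Ω :=
  (hu.continuousOn_fderiv_of_isOpen hΩ le_rfl).clm_apply continuousOn_const

/-- For `C¹` functions on `Ω` the weak derivative is the classical one. -/
lemma hasWeakPartial_of_contDiffOn (hΩ : IsOpen Ω) (hu : ContDiffOn ℝ 1 u Ω) :
    HasWeakPartial Ω i u (partialDeriv i u) := by
  have h1 : LocallyIntegrableOn u Ω := hu.continuousOn.locallyIntegrableOn hΩ.measurableSet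
  have h2 : LocallyIntegrableOn (partialDeriv i u) Ω :=
    (ContDiffOn.continuousOn_partialDeriv hΩ hu).locallyIntegrableOn hΩ.measurableSet
  refine ⟨h1, h2, fun φ hφ => ?_⟩
  have hφ' := hφ.partialDeriv (i := i)
  rw [setIntegral_mul_of_tsupport_subset hφ.2.2, setIntegral_mul_of_tsupport_subset hφ'.2.2]
  refine integral_mul_fderiv_eq_neg_fderiv_mul_of_integrable
    (integrable_mul_of_locallyIntegrableOn h2 hφ.continuous hφ.2.1 hφ.2.2)
    (integrable_mul_of_locallyIntegrableOn h1 hφ'.continuous hφ'.2.1 hφ'.2.2)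
    (integrable_mul_of_locallyIntegrableOn h1 hφ.continuous hφ.2.1 hφ.2.2)
    (fun x hx => ?_) (fun x _ => hφ.1.differentiable (by simp) x)
  exact (hu.contDiffAt (hΩ.mem_nhds (hφ.2.2 hx))).differentiableAt one_ne_zero

/-- Leibniz rule for the product with a smooth function. -/
lemma HasWeakPartial.mul_smooth (hΩ : IsOpen Ω) (hu : HasWeakPartial Ω i u g)
    (hz : ContDiffOn ℝ (⊤ : ℕ∞) z Ω) :
    HasWeakPartial Ω i (fun x => u x * z x) (fun x => g x * z x + u x * partialDeriv i z x) := by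
  have hzc := hz.continuousOn
  have hz1 : ContDiffOn ℝ 1 z Ω := hz.of_le (by exact_mod_cast le_top)
  have hdz := ContDiffOn.continuousOn_partialDeriv (i := i) hΩ hz1
  have M : ∀ {w k : Plane → ℝ}, LocallyIntegrableOn w Ω → ContinuousOn k Ω →
      LocallyIntegrableOn (fun x => w x * k x) Ω := fun hw hk =>
    hw.mul_continuousOn hk hΩ.isLocallyClosed
  have M' := (M hu.2.1 hzc).add (M hu.1 hdz)
  refine ⟨M hu.1 hzc, M', fun φ hφ => ?_⟩
  have hzφ := hφ.mul_left hΩ hz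
  have e := hu.2.2 _ hzφ
  have hφ' := hφ.partialDeriv (i := i)
  have e1 : ∫ x in Ω, u x * partialDeriv i (fun x => z x * φ x) x =
      ∫ x in Ω, ((u x * partialDeriv i z x) * φ x + (u x * z x) * partialDeriv i φ x) := by
    refine setIntegral_congr_fun hΩ.measurableSet fun x hx => ?_
    have := (hz1.contDiffAt (hΩ.mem_nhds hx)).differentiableAt one_ne_zero
    simp only [partialDeriv_mul this (hφ.1.differentiable (by simp) x)]
    ring
  rw [e1, integral_add (hφ.integrableOn_mul (M hu.1 hdz)) (hφ'.integrableOn_mul (M hu.1 hzc))] at e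
  simp_rw [add_mul]
  rw [integral_add (hφ.integrableOn_mul (M hu.2.1 hzc)) (hφ.integrableOn_mul (M hu.1 hdz))]
  simp_rw [← mul_assoc] at e
  linarith

/-! ### Sobolev classes -/

lemma MemH1.memL2_weakPartial (hΩ : IsOpen Ω) (hu : MemH1 Ω u) : MemL2 Ω (weakPartial Ω i u) := by
  obtain ⟨g, hg, hg2⟩ := hu.2 i
  exact (memLp_congr_ae (hg.weakPartial_ae_eq hΩ)).2 hg2

lemma MemH1.hasWeakPartial (hu : MemH1 Ω u) : HasWeakPartial Ω i u (weakPartial Ω i u) :=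
  hasWeakPartial_weakPartial ((hu.2 i).imp fun _ h => h.1)

lemma MemH1.sub (hu : MemH1 Ω u) (hv : MemH1 Ω v) : MemH1 Ω fun x => u x - v x :=
  ⟨MemLp.sub hu.1 hv.1, fun i => by
    obtain ⟨g, hg⟩ := hu.2 i
    obtain ⟨h, hh⟩ := hv.2 i
    exact ⟨_, hg.1.sub hh.1, MemLp.sub hg.2 hh.2⟩⟩

lemma MemH1.weakPartial_sub (hΩ : IsOpen Ω) (hu : MemH1 Ω u) (hv : MemH1 Ω v) :
    weakPartial Ω i (fun x => u x - v x) =ᵐ[volume.restrict Ω]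
      fun x => weakPartial Ω i u x - weakPartial Ω i v x :=
  (hu.hasWeakPartial.sub hv.hasWeakPartial).weakPartial_ae_eq hΩ

end

section

/-! ### Polar coordinates -/

variable {R : ℝ}

@[simp] lemma norm_circlePoint (r θ : ℝ) : ‖circlePoint r θ‖ = |r| := by
  rw [EuclideanSpace.norm_eq, ← Real.sqrt_sq_eq_abs]
  congr 1
  simp [circlePoint, Fin.sum_univ_two]
  nlinarith [Real.sin_sq_add_cos_sq θ]

lemma continuous_circlePoint : Continuous fun p : ℝ × ℝ => circlePoint p.1 p.2 := by
  refine (PiLp.continuous_toLp 2 _).comp (continuous_pi fun i => ?_)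
  fin_cases i <;> simp <;> fun_prop

lemma circlePoint_add_two_pi (r θ : ℝ) :
    circlePoint r (θ + 2 * Real.pi) = circlePoint r θ := by
  simp [circlePoint]

lemma circlePoint_mem_annulus {r θ : ℝ} (hr : r ∈ Ioo 1 R) : circlePoint r θ ∈ annulus R := by
  rw [mem_annulus, norm_circlePoint, abs_of_pos (by linarith [hr.1])]
  exact hr

lemma lintegral_circle_shift (F : Plane → ℝ≥0∞) (r : ℝ) :
    ∫⁻ θ in Ioc (-Real.pi) Real.pi, F (circlePoint r θ) =
      ∫⁻ θ in Ioc 0 (2 * Real.pi), F (circlePoint r θ) := by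
  have h1 := isAddFundamentalDomain_Ioc (T := 2 * Real.pi) Real.two_pi_pos (-Real.pi) (μ := volume)
  have h2 := isAddFundamentalDomain_Ioc (T := 2 * Real.pi) Real.two_pi_pos 0 (μ := volume)
  have := h1.setLIntegral_eq h2 (fun θ => F (circlePoint r θ)) ?_
  · rwa [zero_add, show -Real.pi + 2 * Real.pi = Real.pi by ring] at this
  · rintro ⟨g, hg⟩ x
    obtain ⟨n, rfl⟩ := AddSubgroup.mem_zmultiples_iff.1 hg
    have : (⟨n • (2 * Real.pi), hg⟩ : AddSubgroup.zmultiples (2 * Real.pi)) +ᵥ x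
        = x + n * (2 * Real.pi) := by
      simp [AddSubgroup.vadd_def, add_comm]
    simp only [this, circlePoint, Real.cos_add_int_mul_two_pi, Real.sin_add_int_mul_two_pi]

/-- Integration over the annulus in polar coordinates. -/
lemma lintegral_annulus {F : Plane → ℝ≥0∞} (hF : Measurable F) :
    ∫⁻ x in annulus R, F x =
      ∫⁻ r in Ioo 1 R, ∫⁻ θ in Ioc 0 (2 * Real.pi), ENNReal.ofReal r * F (circlePoint r θ) := by
  have hm : Measurable fun p : ℝ × ℝ => ENNReal.ofReal p.1 * F (circlePoint p.1 p.2) :=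
    (measurable_fst.ennreal_ofReal).mul (hF.comp continuous_circlePoint.measurable)
  have hΩ := (isOpen_annulus (R := R)).measurableSet
  set G : Plane → ℝ≥0∞ := (annulus R).indicator F with hG
  have hGm : Measurable G := hF.indicator hΩ
  set e : ℝ × ℝ → Plane := fun p => WithLp.toLp 2 ((MeasurableEquiv.finTwoArrow).symm p) with he
  have hpres : MeasurePreserving e :=
    (PiLp.volume_preserving_toLp (Fin 2)).comp (volume_preserving_finTwoArrow ℝ).symm
  have hcp : ∀ p, e (polarCoord.symm p) = circlePoint p.1 p.2 := by
    intro p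
    ext i
    fin_cases i <;> simp [he, circlePoint, MeasurableEquiv.finTwoArrow]
  have hGcp : ∀ r θ, 0 < r → ENNReal.ofReal r * G (circlePoint r θ) =
      (Ioo 1 R).indicator (fun r => ENNReal.ofReal r * F (circlePoint r θ)) r := by
    intro r θ hr
    by_cases h : r ∈ Ioo 1 R
    · rw [indicator_of_mem h, hG, indicator_of_mem (circlePoint_mem_annulus h)]
    · rw [indicator_of_notMem h, hG, indicator_of_notMem, mul_zero]
      rwa [mem_annulus, norm_circlePoint, abs_of_pos hr]
  calc ∫⁻ x in annulus R, F x = ∫⁻ x, G x := (lintegral_indicator hΩ F).symm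
    _ = ∫⁻ p, G (e p) := (hpres.lintegral_comp hGm).symm
    _ = ∫⁻ p in Ioi (0 : ℝ) ×ˢ Ioo (-Real.pi) Real.pi,
          ENNReal.ofReal p.1 * G (circlePoint p.1 p.2) := by
        rw [← lintegral_comp_polarCoord_symm]
        simp_rw [hcp, smul_eq_mul]
        rfl
    _ = ∫⁻ r in Ioi (0 : ℝ), ∫⁻ θ in Ioo (-Real.pi) Real.pi,
          ENNReal.ofReal r * G (circlePoint r θ) := by
        rw [Measure.volume_eq_prod, ← Measure.prod_restrict, lintegral_prod]
        exact ((measurable_fst.ennreal_ofReal).mul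
          (hGm.comp continuous_circlePoint.measurable)).aemeasurable
    _ = ∫⁻ r in Ioi (0 : ℝ), (Ioo 1 R).indicator
          (fun r => ∫⁻ θ in Ioc 0 (2 * Real.pi), ENNReal.ofReal r * F (circlePoint r θ)) r := by
        refine setLIntegral_congr_fun measurableSet_Ioi fun r hr => ?_
        have hr0 : (0 : ℝ) < r := hr
        simp_rw [hGcp r _ hr0]
        by_cases h : r ∈ Ioo 1 R
        · simp_rw [indicator_of_mem h]
          rw [setLIntegral_congr Ioo_ae_eq_Ioc]
          exact lintegral_circle_shift (fun x => ENNReal.ofReal r * F x) r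
        · simp [indicator_of_notMem h]
    _ = _ := by
        have hsub : Ioo 1 R ⊆ Ioi 0 := fun r hr => zero_lt_one.trans hr.1
        rw [lintegral_indicator measurableSet_Ioo, Measure.restrict_restrict measurableSet_Ioo,
          inter_eq_left.2 hsub]

lemma lintegral_annulus_radial {G : ℝ → ℝ≥0∞} (hG : Measurable G) :
    ∫⁻ x in annulus R, G ‖x‖ = ∫⁻ r in Ioo 1 R, ENNReal.ofReal (2 * Real.pi * r) * G r := by
  rw [lintegral_annulus (F := fun x => G ‖x‖) (hG.comp measurable_norm)]
  refine setLIntegral_congr_fun measurableSet_Ioo fun r hr => ?_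
  have hr0 : 0 < r := zero_lt_one.trans hr.1
  simp only [norm_circlePoint, abs_of_pos hr0, lintegral_const, Measure.restrict_apply_univ,
    Real.volume_Ioc, sub_zero]
  rw [ENNReal.ofReal_mul Real.two_pi_pos.le]
  ring

lemma map_norm_apply {s : Set ℝ} (hs : MeasurableSet s) :
    (volume.restrict (annulus R)).map norm s =
      ∫⁻ r in Ioo 1 R, ENNReal.ofReal (2 * Real.pi * r) * s.indicator 1 r := by
  rw [Measure.map_apply measurable_norm hs, ← lintegral_annulus_radial (measurable_one.indicator hs),
    ← lintegral_indicator_one (measurable_norm hs)]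
  rfl

/-- The image of the area of the annulus under `x ↦ |x|` is bounded below by the length. -/
lemma restrict_Ioo_le_map_norm :
    volume.restrict (Ioo 1 R) ≤ (volume.restrict (annulus R)).map norm := by
  refine Measure.le_iff.2 fun s hs => ?_
  rw [map_norm_apply hs, ← lintegral_indicator_one hs]
  refine lintegral_mono_ae ((ae_restrict_iff' measurableSet_Ioo).2 (ae_of_all _ fun r hr => ?_))
  have : 1 ≤ ENNReal.ofReal (2 * Real.pi * r) := by
    rw [ENNReal.one_le_ofReal]
    nlinarith [Real.pi_gt_three, hr.1]
  exact le_mul_of_one_le_left (zero_le) this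

/-- The image of the area of the annulus under `x ↦ |x|` is bounded by a multiple of the length. -/
lemma map_norm_le :
    (volume.restrict (annulus R)).map norm ≤
      ENNReal.ofReal (2 * Real.pi * R) • volume.restrict (Ioo 1 R) := by
  refine Measure.le_iff.2 fun s hs => ?_
  rw [map_norm_apply hs, Measure.smul_apply, ← lintegral_indicator_one hs, smul_eq_mul,
    ← lintegral_const_mul _ (measurable_one.indicator hs)]
  refine lintegral_mono_ae ((ae_restrict_iff' measurableSet_Ioo).2 (ae_of_all _ fun r hr => ?_))
  gcongr
  exact hr.2.le

lemma quasiMeasurePreserving_norm :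
    Measure.QuasiMeasurePreserving norm (volume.restrict (annulus R))
      (volume.restrict (Ioo 1 R)) :=
  ⟨measurable_norm, (Measure.absolutelyContinuous_of_le map_norm_le).trans
    (Measure.smul_absolutelyContinuous)⟩

lemma MemLp.comp_norm {k : ℝ → ℝ} {p : ℝ≥0∞} (hk : MemLp k p (volume.restrict (Ioo 1 R))) :
    MemLp (fun x => k ‖x‖) p (volume.restrict (annulus R)) :=
  (hk.of_measure_le_smul ENNReal.ofReal_ne_top map_norm_le).comp_of_map
    measurable_norm.aemeasurable

lemma memLp_of_comp_norm {k : ℝ → ℝ} {p : ℝ≥0∞} (hk : StronglyMeasurable k)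
    (h : MemLp (fun x => k ‖x‖) p (volume.restrict (annulus R))) :
    MemLp k p (volume.restrict (Ioo 1 R)) := by
  refine MemLp.mono_measure restrict_Ioo_le_map_norm ?_
  exact (memLp_map_measure_iff hk.aestronglyMeasurable measurable_norm.aemeasurable).2 h

lemma lintegral_comp_norm_le {G : ℝ → ℝ≥0∞} (hG : AEMeasurable G (volume.restrict (Ioo 1 R))) :
    ∫⁻ x in annulus R, G ‖x‖ ≤ ENNReal.ofReal (2 * Real.pi * R) * ∫⁻ r in Ioo 1 R, G r := by
  rw [← smul_eq_mul, ← lintegral_smul_measure, ← lintegral_map' (f := G) (g := norm) ?_ measurable_norm.aemeasurable]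
  · exact lintegral_mono' map_norm_le le_rfl
  · exact hG.mono_ac quasiMeasurePreserving_norm.absolutelyContinuous

lemma lintegral_Ioo_le_comp_norm {G : ℝ → ℝ≥0∞} (hG : AEMeasurable G (volume.restrict (Ioo 1 R))) :
    ∫⁻ r in Ioo 1 R, G r ≤ ∫⁻ x in annulus R, G ‖x‖ := by
  rw [← lintegral_map' (f := G) (g := norm) ?_ measurable_norm.aemeasurable]
  · exact lintegral_mono' restrict_Ioo_le_map_norm le_rfl
  · exact hG.mono_ac quasiMeasurePreserving_norm.absolutelyContinuous

end

section

/-! ### Rotations and rotationally invariant functions -/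

variable {R : ℝ} {Ω : Set Plane}

lemma act_apply_zero (φ : ℝ) (x : Plane) :
    act (rotMatrix φ) x 0 = Real.cos φ * x 0 - Real.sin φ * x 1 := by
  simp [act, rotMatrix, dotProduct, Fin.sum_univ_two]
  ring

lemma act_apply_one (φ : ℝ) (x : Plane) :
    act (rotMatrix φ) x 1 = Real.sin φ * x 0 + Real.cos φ * x 1 := by
  simp [act, rotMatrix, dotProduct, Fin.sum_univ_two]

lemma act_transpose_apply_zero (φ : ℝ) (x : Plane) :
    act (rotMatrix φ).transpose x 0 = Real.cos φ * x 0 + Real.sin φ * x 1 := by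
  simp [act, rotMatrix]

lemma act_transpose_apply_one (φ : ℝ) (x : Plane) :
    act (rotMatrix φ).transpose x 1 = -Real.sin φ * x 0 + Real.cos φ * x 1 := by
  simp [act, rotMatrix]

lemma plane_ext {x y : Plane} (h0 : x 0 = y 0) (h1 : x 1 = y 1) : x = y := by
  ext i
  fin_cases i
  exacts [h0, h1]

lemma sq_norm_plane (x : Plane) : ‖x‖ ^ 2 = x 0 ^ 2 + x 1 ^ 2 := by
  simp [EuclideanSpace.norm_sq_eq, Fin.sum_univ_two]

@[simp] lemma norm_act (φ : ℝ) (x : Plane) : ‖act (rotMatrix φ) x‖ = ‖x‖ := by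
  rw [← sq_eq_sq₀ (norm_nonneg _) (norm_nonneg _), sq_norm_plane, sq_norm_plane, act_apply_zero,
    act_apply_one]
  linear_combination (x 0 ^ 2 + x 1 ^ 2) * Real.sin_sq_add_cos_sq φ

lemma act_circlePoint (φ r θ : ℝ) :
    act (rotMatrix φ) (circlePoint r θ) = circlePoint r (θ + φ) := by
  refine plane_ext ?_ ?_
  · rw [act_apply_zero]
    simp [circlePoint, Real.cos_add]
    ring
  · rw [act_apply_one]
    simp [circlePoint, Real.sin_add]
    ring

lemma exists_eq_circlePoint (x : Plane) : ∃ θ, x = circlePoint ‖x‖ θ := by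
  set z : ℂ := ⟨x 0, x 1⟩ with hz
  have hn : ‖z‖ = ‖x‖ := by
    rw [← sq_eq_sq₀ (norm_nonneg _) (norm_nonneg _), sq_norm_plane, Complex.sq_norm,
      Complex.normSq_apply, hz]
    ring
  refine ⟨z.arg, plane_ext ?_ ?_⟩
  · simp [circlePoint, ← hn, Complex.norm_mul_cos_arg, hz]
  · simp [circlePoint, ← hn, Complex.norm_mul_sin_arg, hz]

lemma act_mem_annulus {φ : ℝ} {x : Plane} : act (rotMatrix φ) x ∈ annulus R ↔ x ∈ annulus R := by
  simp [mem_annulus]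

lemma continuous_act : Continuous fun p : ℝ × Plane => act (rotMatrix p.1) p.2 := by
  have h : (fun p : ℝ × Plane => act (rotMatrix p.1) p.2) = fun p => WithLp.toLp 2
      ![Real.cos p.1 * p.2 0 - Real.sin p.1 * p.2 1,
        Real.sin p.1 * p.2 0 + Real.cos p.1 * p.2 1] := by
    ext p i
    fin_cases i
    exacts [act_apply_zero _ _, act_apply_one _ _]
  rw [h]
  refine (PiLp.continuous_toLp 2 _).comp (continuous_pi fun i => ?_)
  fin_cases i <;> simp <;> fun_prop

lemma measurePreserving_act (φ : ℝ) :
    MeasurePreserving (act (rotMatrix φ)) (volume.restrict (annulus R))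
      (volume.restrict (annulus R)) := by
  have hlin : MeasurePreserving (act (rotMatrix φ)) (volume : Measure Plane) volume := by
    let l : Plane →ₗᵢ[ℝ] Plane :=
      { toFun := act (rotMatrix φ)
        map_add' := fun x y => by
          refine plane_ext ?_ ?_ <;> simp [act_apply_zero, act_apply_one] <;> ring
        map_smul' := fun c x => by
          refine plane_ext ?_ ?_ <;> simp [act_apply_zero, act_apply_one] <;> ring
        norm_map' := norm_act φ }
    exact (l.toLinearIsometryEquiv rfl).measurePreserving
  have := hlin.restrict_preimage (isOpen_annulus (R := R)).measurableSet
  rwa [show act (rotMatrix φ) ⁻¹' annulus R = annulus R from ext fun x => act_mem_annulus] at this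

/-- A rotationally invariant function on the annulus is a.e. equal to a function of the radius,
namely its mean over circles. -/
lemma RotInvScalar.exists_radial {q : Plane → ℝ} (hq : RotInvScalar (annulus R) q)
    (hm : AEStronglyMeasurable q (volume.restrict (annulus R))) :
    ∃ k : ℝ → ℝ, StronglyMeasurable k ∧ q =ᵐ[volume.restrict (annulus R)] fun x => k ‖x‖ := by
  set q' := hm.mk q
  have hq'm : StronglyMeasurable q' := hm.stronglyMeasurable_mk
  have hqq' : q =ᵐ[volume.restrict (annulus R)] q' := hm.ae_eq_mk
  have hinv : ∀ φ : ℝ, ∀ᵐ x ∂volume.restrict (annulus R), q' x = q' (act (rotMatrix φ) x) := by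
    intro φ
    filter_upwards [hq φ, hqq', (measurePreserving_act φ).quasiMeasurePreserving.ae hqq']
      with x h1 h2 h3
    rw [← h2, h1, h3]
  -- by Fubini, for a.e. point the invariance holds for a.e. angle, so that `q'` may be averaged
  have hswap : ∀ᵐ x ∂volume.restrict (annulus R), ∀ᵐ φ ∂volume.restrict (Ioc 0 (2 * Real.pi)),
      q' x = q' (act (rotMatrix φ) x) := by
    refine (Measure.ae_ae_comm ?_).1 (ae_of_all _ hinv)
    exact measurableSet_eq_fun (hq'm.measurable.comp measurable_snd)
      (hq'm.measurable.comp continuous_act.measurable)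
  refine ⟨fun r => (2 * Real.pi)⁻¹ * ∫ θ in Ioc 0 (2 * Real.pi), q' (circlePoint r θ), ?_, ?_⟩
  · refine StronglyMeasurable.const_mul ?_ _
    exact (hq'm.comp_measurable continuous_circlePoint.measurable).integral_prod_right'
  · filter_upwards [hqq', hswap] with x h1 h2
    rw [h1]
    obtain ⟨α, hα⟩ := exists_eq_circlePoint x
    have e : ∫ θ in Ioc 0 (2 * Real.pi), q' (circlePoint ‖x‖ θ) =
        ∫ φ in Ioc 0 (2 * Real.pi), q' (act (rotMatrix φ) x) := by
      have hact : ∀ φ, act (rotMatrix φ) x = circlePoint ‖x‖ (α + φ) := fun φ => by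
        conv_lhs => rw [hα]
        exact act_circlePoint φ _ α
      simp_rw [hact]
      rw [← intervalIntegral.integral_of_le Real.two_pi_pos.le,
        ← intervalIntegral.integral_of_le Real.two_pi_pos.le,
        intervalIntegral.integral_comp_add_left (fun θ => q' (circlePoint ‖x‖ θ)) α, add_zero]
      have hper : Function.Periodic (fun θ => q' (circlePoint ‖x‖ θ)) (2 * Real.pi) := fun θ => by
        simp only [circlePoint_add_two_pi]
      simpa using hper.intervalIntegral_add_eq 0 α
    have e2 : ∫ φ in Ioc 0 (2 * Real.pi), q' (act (rotMatrix φ) x) =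
        ∫ φ in Ioc 0 (2 * Real.pi), q' x := by
      refine integral_congr_ae ?_
      filter_upwards [h2] with φ hφ using hφ.symm
    simp only [e, e2, integral_const, MeasurableSet.univ, measureReal_restrict_apply, univ_inter,
      Real.volume_real_Ioc, sub_zero, max_eq_left Real.two_pi_pos.le, smul_eq_mul]
    rw [inv_mul_cancel_left₀ Real.two_pi_pos.ne']

/-- The radial component of a vector field. -/
def radialPart (u : Plane → Plane) (x : Plane) : ℝ := u x 0 * rhoHat x 0 + u x 1 * rhoHat x 1

/-- The angular component of a vector field. -/
def angularPart (u : Plane → Plane) (x : Plane) : ℝ := u x 0 * thetaHat x 0 + u x 1 * thetaHat x 1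

@[simp] lemma rhoHat_zero (x : Plane) : rhoHat x 0 = x 0 / ‖x‖ := rfl
@[simp] lemma rhoHat_one (x : Plane) : rhoHat x 1 = x 1 / ‖x‖ := rfl
@[simp] lemma thetaHat_zero (x : Plane) : thetaHat x 0 = -x 1 / ‖x‖ := rfl
@[simp] lemma thetaHat_one (x : Plane) : thetaHat x 1 = x 0 / ‖x‖ := rfl

lemma eq_radialPart_add_angularPart (u : Plane → Plane) {x : Plane} (hx : x ≠ 0) :
    u x = radialPart u x • rhoHat x + angularPart u x • thetaHat x := by
  have h0 : ‖x‖ ≠ 0 := norm_ne_zero_iff.2 hx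
  have h := sq_norm_plane x
  refine plane_ext ?_ ?_ <;> simp [radialPart, angularPart] <;> field_simp <;> rw [h] <;> ring

lemma RotInvField.radialPart {u : Plane → Plane} (hu : RotInvField Ω u) :
    RotInvScalar Ω (radialPart u) := fun φ => by
  filter_upwards [hu φ] with x hx
  simp only [TaylorCouette.radialPart, rhoHat_zero, rhoHat_one, norm_act, act_apply_zero,
    act_apply_one]
  have h0 := congrArg (fun y : Plane => y 0) hx
  have h1 := congrArg (fun y : Plane => y 1) hx
  simp only [act_transpose_apply_zero, act_transpose_apply_one] at h0 h1
  rw [h0, h1]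
  ring

lemma RotInvField.angularPart {u : Plane → Plane} (hu : RotInvField Ω u) :
    RotInvScalar Ω (angularPart u) := fun φ => by
  filter_upwards [hu φ] with x hx
  simp only [TaylorCouette.angularPart, thetaHat_zero, thetaHat_one, norm_act, act_apply_zero,
    act_apply_one]
  have h0 := congrArg (fun y : Plane => y 0) hx
  have h1 := congrArg (fun y : Plane => y 1) hx
  simp only [act_transpose_apply_zero, act_transpose_apply_one] at h0 h1
  rw [h0, h1]
  ring

lemma abs_apply_le_norm (x : Plane) (i : Fin 2) : |x i| ≤ ‖x‖ := by
  simpa using PiLp.norm_apply_le x i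

lemma abs_apply_div_norm_le_one (x : Plane) (i : Fin 2) : |x i / ‖x‖| ≤ 1 := by
  rw [abs_div, abs_norm]
  exact div_le_one_of_le₀ (abs_apply_le_norm x i) (norm_nonneg x)

lemma measurable_apply_div_norm (i : Fin 2) : Measurable fun x : Plane => x i / ‖x‖ := by
  fun_prop

/-- Multiplication by a bounded measurable function preserves `L^p`. -/
lemma MemLp.mul_bdd {α : Type*} [MeasurableSpace α] {μ : Measure α} {p : ℝ≥0∞} {q b : α → ℝ}
    (hq : MemLp q p μ) (hb : AEStronglyMeasurable b μ) {C : ℝ} (hC : ∀ᵐ x ∂μ, |b x| ≤ C) :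
    MemLp (fun x => q x * b x) p μ := by
  refine MemLp.of_le_mul (c := C) hq (hq.1.mul hb) ?_
  filter_upwards [hC] with x hx
  rw [norm_mul, mul_comm]
  exact mul_le_mul_of_nonneg_right hx (norm_nonneg _)

lemma MemL2.comp {u : Plane → Plane} (hu : MemL2 Ω u) (i : Fin 2) : MemL2 Ω (comp u i) := by
  refine MemLp.of_le (g := u) hu ?_ (ae_of_all _ fun x => ?_)
  · exact (EuclideanSpace.proj (𝕜 := ℝ) i).continuous.comp_aestronglyMeasurable hu.1
  · exact PiLp.norm_apply_le (u x) i

lemma memL2_mul_apply_div_norm {q : Plane → ℝ} (hq : MemL2 Ω q) (i : Fin 2) :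
    MemL2 Ω fun x => q x * (x i / ‖x‖) :=
  MemLp.mul_bdd hq (measurable_apply_div_norm i).aestronglyMeasurable
    (ae_of_all _ fun x => abs_apply_div_norm_le_one x i)

lemma memL2_radialPart {u : Plane → Plane} (h : ∀ i, MemL2 Ω (comp u i)) :
    MemL2 Ω (radialPart u) :=
  MemLp.add (memL2_mul_apply_div_norm (h 0) 0) (memL2_mul_apply_div_norm (h 1) 1)

lemma memL2_angularPart {u : Plane → Plane} (h : ∀ i, MemL2 Ω (comp u i)) :
    MemL2 Ω (angularPart u) := by
  have e : angularPart u = fun x => comp u 1 x * (x 0 / ‖x‖) - comp u 0 x * (x 1 / ‖x‖) := by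
    ext x
    simp only [angularPart, comp, thetaHat_zero, thetaHat_one]
    ring
  rw [e]
  exact MemLp.sub (memL2_mul_apply_div_norm (h 1) 0) (memL2_mul_apply_div_norm (h 0) 1)

/-- A rotationally invariant square integrable field has radial profiles as components. -/
lemma exists_isPolarRep {u : Plane → Plane} (hu : ∀ i, MemL2 (annulus R) (comp u i))
    (hrot : RotInvField (annulus R) u) : ∃ uρ uθ : ℝ → ℝ, IsPolarRep R u uρ uθ := by
  have hr := memL2_radialPart hu
  have ha := memL2_angularPart hu
  obtain ⟨k, hk, hku⟩ := hrot.radialPart.exists_radial hr.1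
  obtain ⟨l, hl, hlu⟩ := hrot.angularPart.exists_radial ha.1
  refine ⟨k, l, memLp_of_comp_norm hk ((memLp_congr_ae hku).1 hr),
    memLp_of_comp_norm hl ((memLp_congr_ae hlu).1 ha), ?_⟩
  filter_upwards [hku, hlu, ae_restrict_mem (isOpen_annulus (R := R)).measurableSet]
    with x h1 h2 hx
  rw [← h1, ← h2]
  refine eq_radialPart_add_angularPart u ?_
  rintro rfl
  have := (mem_annulus.1 hx).1
  rw [norm_zero] at this
  linarith

lemma rotInvField_smul_thetaHat (k : ℝ → ℝ) : RotInvField Ω fun x => k ‖x‖ • thetaHat x :=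
  fun φ => ae_of_all _ fun x => by
    have := Real.sin_sq_add_cos_sq φ
    refine plane_ext ?_ ?_
    · simp only [act_transpose_apply_zero, norm_act, PiLp.smul_apply, thetaHat_zero, thetaHat_one,
        act_apply_zero, act_apply_one, smul_eq_mul]
      linear_combination (-(k ‖x‖) * (-x 1 / ‖x‖)) * this
    · simp only [act_transpose_apply_one, norm_act, PiLp.smul_apply, thetaHat_zero, thetaHat_one,
        act_apply_zero, act_apply_one, smul_eq_mul]
      linear_combination (-(k ‖x‖) * (x 0 / ‖x‖)) * this

lemma rotInvScalar_comp_norm (k : ℝ → ℝ) : RotInvScalar Ω fun x => k ‖x‖ :=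
  fun φ => ae_of_all _ fun x => by simp only [norm_act]

end

section

/-! ### Functions of the radius -/

variable {R : ℝ} {i : Fin 2} {k : ℝ → ℝ}

lemma norm_ne_zero_of_mem_annulus {x : Plane} (hx : x ∈ annulus R) : ‖x‖ ≠ 0 :=
  (zero_lt_one.trans (mem_annulus.1 hx).1).ne'

lemma hasFDerivAt_norm_plane {x : Plane} (hx : ‖x‖ ≠ 0) :
    HasFDerivAt (fun y : Plane => ‖y‖) (‖x‖⁻¹ • innerSL ℝ x) x := by
  have h1 : HasFDerivAt (fun y : Plane => ‖y‖ ^ 2) (2 • innerSL ℝ x) x :=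
    (hasStrictFDerivAt_norm_sq x).hasFDerivAt
  have h2 := h1.sqrt (pow_ne_zero 2 hx)
  simp only [Real.sqrt_sq (norm_nonneg _)] at h2
  convert! h2 using 1
  rw [← Nat.cast_smul_eq_nsmul ℝ, smul_smul]
  congr 1
  push_cast
  field_simp

/-- Chain rule for functions of the radius. -/
lemma partialDeriv_comp_norm {H : ℝ → ℝ} {H' : ℝ} {x : Plane} (hx : ‖x‖ ≠ 0)
    (hH : HasDerivAt H H' ‖x‖) :
    partialDeriv i (fun y => H ‖y‖) x = H' * (x i / ‖x‖) := by
  have := (hH.comp_hasFDerivAt x (hasFDerivAt_norm_plane hx)).fderiv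
  simp only [partialDeriv]
  rw [show (fun y : Plane => H ‖y‖) = H ∘ fun y => ‖y‖ from rfl, this]
  simp [EuclideanSpace.inner_single_right, div_eq_inv_mul]

lemma hasDerivAt_primitive (hk : Continuous k) (a ρ : ℝ) :
    HasDerivAt (fun ρ => ∫ t in a..ρ, k t) (k ρ) ρ :=
  intervalIntegral.integral_hasDerivAt_right (hk.intervalIntegrable _ _)
    hk.aestronglyMeasurable.stronglyMeasurableAtFilter hk.continuousAt

lemma contDiff_primitive (hk : Continuous k) (a : ℝ) :
    ContDiff ℝ 1 fun ρ => ∫ t in a..ρ, k t := by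
  rw [contDiff_one_iff_deriv]
  refine ⟨fun ρ => (hasDerivAt_primitive hk a ρ).differentiableAt, ?_⟩
  rwa [show deriv (fun ρ => ∫ t in a..ρ, k t) = k from
    funext fun ρ => (hasDerivAt_primitive hk a ρ).deriv]

lemma contDiffOn_primitive_norm (hk : Continuous k) :
    ContDiffOn ℝ 1 (fun x : Plane => ∫ t in (1 : ℝ)..‖x‖, k t) (annulus R) := fun x hx =>
  ((contDiff_primitive hk 1).contDiffAt.comp x
    (contDiffAt_norm ℝ (norm_ne_zero_iff.1 (norm_ne_zero_of_mem_annulus hx)))).contDiffWithinAt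

/-- A primitive of a continuous function that vanishes near zero is a `C¹` function of the radius on
the whole plane. -/
lemma contDiff_primitive_norm (hk : Continuous k) (h0 : ∀ t ≤ 1 / 2, k t = 0) :
    ContDiff ℝ 1 fun x : Plane => ∫ t in (1 : ℝ)..‖x‖, k t := by
  rw [contDiff_iff_contDiffAt]
  intro x
  by_cases hx : x = 0
  · refine (contDiffAt_const (c := ∫ t in (1 : ℝ)..(1 / 2), k t)).congr_of_eventuallyEq ?_
    have : ∀ᶠ y : Plane in 𝓝 x, ‖y‖ < 1 / 2 :=
      continuous_norm.continuousAt.eventually_lt continuousAt_const (by simp [hx])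
    filter_upwards [this] with y hy
    rw [← sub_eq_zero, intervalIntegral.integral_interval_sub_left
      (hk.intervalIntegrable _ _) (hk.intervalIntegrable _ _)]
    refine intervalIntegral.integral_zero_ae (ae_of_all _ fun t ht => h0 t ?_)
    rw [uIoc_of_ge hy.le] at ht
    exact ht.2
  · exact (contDiff_primitive hk 1).contDiffAt.comp x (contDiffAt_norm ℝ hx)

lemma intervalIntegrable_of_mem {ρ : ℝ} (hk : IntegrableOn k (Ioo 1 R)) (hρ : ρ ∈ Icc 1 R) :
    IntervalIntegrable k volume 1 ρ := by
  rw [intervalIntegrable_iff_integrableOn_Ioo_of_le hρ.1]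
  exact hk.mono_set (Ioo_subset_Ioo_right hρ.2)

lemma abs_primitive_le {ρ : ℝ} (hk : IntegrableOn k (Ioo 1 R)) (hρ : ρ ∈ Icc 1 R) :
    |∫ t in (1 : ℝ)..ρ, k t| ≤ ∫ t in Ioo 1 R, |k t| := by
  rw [intervalIntegral.integral_of_le hρ.1, integral_Ioc_eq_integral_Ioo]
  refine (abs_integral_le_integral_abs).trans ?_
  exact setIntegral_mono_set hk.abs (ae_of_all _ fun _ => abs_nonneg _)
    (Ioo_subset_Ioo_right hρ.2).eventuallyLE

lemma continuousOn_primitive_of_integrableOn (hk : IntegrableOn k (Ioo 1 R)) :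
    ContinuousOn (fun ρ => ∫ t in (1 : ℝ)..ρ, k t) (Icc 1 R) := by
  rcases le_or_gt 1 R with h | h
  · have := intervalIntegral.continuousOn_primitive_interval' (a := 1)
      (intervalIntegrable_of_mem hk ⟨h, le_rfl⟩) (by simp)
    rwa [uIcc_of_le h] at this
  · simp [Icc_eq_empty_of_lt h]

lemma continuousOn_primitive_norm (hk : IntegrableOn k (Ioo 1 R)) :
    ContinuousOn (fun x : Plane => ∫ t in (1 : ℝ)..‖x‖, k t) (annulus R) :=
  (continuousOn_primitive_of_integrableOn hk).comp continuous_norm.continuousOn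
    fun _ hx => ⟨(mem_annulus.1 hx).1.le, (mem_annulus.1 hx).2.le⟩

lemma integrable_comp_norm_mul (hk : IntegrableOn k (Ioo 1 R)) :
    IntegrableOn (fun x : Plane => k ‖x‖ * (x i / ‖x‖)) (annulus R) := by
  have h1 := MemLp.comp_norm (memLp_one_iff_integrable.2 hk)
  exact memLp_one_iff_integrable.1 (MemLp.mul_bdd h1
    (measurable_apply_div_norm i).aestronglyMeasurable
    (ae_of_all _ fun x => abs_apply_div_norm_le_one x i))

lemma integral_abs_comp_norm_le (hk : IntegrableOn k (Ioo 1 R)) :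
    ∫ x in annulus R, |k ‖x‖| ≤ 2 * Real.pi * max R 0 * ∫ t in Ioo 1 R, |k t| := by
  have h1 : IntegrableOn (fun x : Plane => k ‖x‖) (annulus R) :=
    memLp_one_iff_integrable.1 (MemLp.comp_norm (memLp_one_iff_integrable.2 hk))
  simp_rw [← Real.norm_eq_abs]
  rw [integral_norm_eq_lintegral_enorm h1.1, integral_norm_eq_lintegral_enorm hk.1]
  have := lintegral_comp_norm_le (R := R) (G := fun t => ‖k t‖ₑ) hk.1.enorm
  have hfin : ∫⁻ t in Ioo 1 R, ‖k t‖ₑ ≠ ∞ := hk.2.ne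
  refine (ENNReal.toReal_mono (ENNReal.mul_ne_top ENNReal.ofReal_ne_top hfin) this).trans ?_
  rw [ENNReal.toReal_mul, ENNReal.toReal_ofReal']
  refine mul_le_mul_of_nonneg_right ?_ ENNReal.toReal_nonneg
  rw [mul_max_of_nonneg _ _ Real.two_pi_pos.le, mul_zero]

/-- An absolutely continuous function of the radius is weakly differentiable, with the gradient
given by the chain rule. -/
lemma hasWeakPartial_primitive_norm (hk : IntegrableOn k (Ioo 1 R)) :
    HasWeakPartial (annulus R) i (fun x => ∫ t in (1 : ℝ)..‖x‖, k t)
      (fun x => k ‖x‖ * (x i / ‖x‖)) := by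
  have hΩ := isOpen_annulus (R := R)
  refine ⟨(continuousOn_primitive_norm hk).locallyIntegrableOn hΩ.measurableSet,
    (integrable_comp_norm_mul hk).locallyIntegrableOn, fun φ hφ => ?_⟩
  have hφ' := hφ.partialDeriv (i := i)
  obtain ⟨A, hA⟩ := hφ'.2.1.exists_bound_of_continuous hφ'.continuous
  obtain ⟨B, hB⟩ := hφ.2.1.exists_bound_of_continuous hφ.continuous
  have hA0 : 0 ≤ A := (norm_nonneg _).trans (hA 0)
  have hB0 : 0 ≤ B := (norm_nonneg _).trans (hB 0)
  set M := A * (volume.restrict (annulus R)).real univ + 2 * Real.pi * max R 0 * B with hM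
  -- The formula holds for continuous `l`, and both sides are continuous in the `L¹` norm of `k`.
  have key : ∀ ε > 0, |(∫ x in annulus R, (∫ t in (1 : ℝ)..‖x‖, k t) * partialDeriv i φ x) -
      -∫ x in annulus R, k ‖x‖ * (x i / ‖x‖) * φ x| ≤ M * ε := by
    intro ε hε
    obtain ⟨l, -, hl2, hl3, hl4⟩ := Integrable.exists_hasCompactSupport_integral_sub_le hk hε
    have hd : IntegrableOn (fun t => k t - l t) (Ioo 1 R) := Integrable.sub hk hl4
    have hl5 := (hasWeakPartial_of_contDiffOn (i := i) hΩ
      (contDiffOn_primitive_norm (R := R) hl3))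
    have e0 := hl5.2.2 φ hφ
    have e1 : ∫ x in annulus R, partialDeriv i (fun x => ∫ t in (1 : ℝ)..‖x‖, l t) x * φ x =
        ∫ x in annulus R, l ‖x‖ * (x i / ‖x‖) * φ x :=
      setIntegral_congr_fun hΩ.measurableSet fun x hx => by
        simp only [partialDeriv_comp_norm (norm_ne_zero_of_mem_annulus hx)
          (hasDerivAt_primitive hl3 1 _)]
    rw [e1] at e0
    have I1 := hφ'.integrableOn_mul
      ((continuousOn_primitive_norm hk).locallyIntegrableOn hΩ.measurableSet)
    have I2 := hφ'.integrableOn_mul hl5.1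
    have I3 := hφ.integrableOn_mul
      (integrable_comp_norm_mul (i := i) hk).locallyIntegrableOn
    have I4 := hφ.integrableOn_mul
      (integrable_comp_norm_mul (R := R) (i := i) (hl4)).locallyIntegrableOn
    have b1 : |∫ x in annulus R, ((∫ t in (1 : ℝ)..‖x‖, k t) * partialDeriv i φ x -
        (∫ t in (1 : ℝ)..‖x‖, l t) * partialDeriv i φ x)| ≤
        ε * A * (volume.restrict (annulus R)).real univ := by
      rw [← Real.norm_eq_abs]
      refine norm_integral_le_of_norm_le_const ?_
      filter_upwards [ae_restrict_mem hΩ.measurableSet] with x hx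
      have hx' : ‖x‖ ∈ Icc 1 R := ⟨(mem_annulus.1 hx).1.le, (mem_annulus.1 hx).2.le⟩
      rw [← sub_mul, norm_mul, ← intervalIntegral.integral_sub (intervalIntegrable_of_mem hk hx')
        (hl3.intervalIntegrable _ _)]
      gcongr
      · exact (abs_primitive_le hd hx').trans hl2
      · exact hA x
    have b2 : |∫ x in annulus R, (k ‖x‖ * (x i / ‖x‖) * φ x - l ‖x‖ * (x i / ‖x‖) * φ x)| ≤
        2 * Real.pi * max R 0 * ε * B := by
      calc _ ≤ ∫ x in annulus R, |k ‖x‖ - l ‖x‖| * B := by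
            rw [← Real.norm_eq_abs]
            refine norm_integral_le_of_norm_le ?_ (ae_of_all _ fun x => ?_)
            · have h1 := MemLp.comp_norm (memLp_one_iff_integrable.2 hd)
              exact (memLp_one_iff_integrable.1 h1).abs.mul_const B
            · rw [← sub_mul, ← sub_mul, norm_mul, norm_mul, Real.norm_eq_abs, Real.norm_eq_abs]
              refine mul_le_mul ?_ (hB x) (norm_nonneg _) (abs_nonneg _)
              exact mul_le_of_le_one_right (abs_nonneg _) (abs_apply_div_norm_le_one x i)
        _ = (∫ x in annulus R, |k ‖x‖ - l ‖x‖|) * B := integral_mul_const _ _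
        _ ≤ _ := by
            gcongr
            refine (integral_abs_comp_norm_le hd).trans ?_
            gcongr
            exact hl2
    rw [integral_sub I1 I2] at b1
    rw [integral_sub I3 I4] at b2
    calc _ = |((∫ x in annulus R, (∫ t in (1 : ℝ)..‖x‖, k t) * partialDeriv i φ x) -
            ∫ x in annulus R, (∫ t in (1 : ℝ)..‖x‖, l t) * partialDeriv i φ x) +
            ((∫ x in annulus R, k ‖x‖ * (x i / ‖x‖) * φ x) -
            ∫ x in annulus R, l ‖x‖ * (x i / ‖x‖) * φ x)| := by
          rw [e0]
          congr 1
          ring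
      _ ≤ _ := (abs_add_le _ _).trans (by rw [hM]; linarith)
  have hM0 : 0 ≤ M := by positivity
  refine sub_eq_zero.1 (abs_eq_zero.1 (le_antisymm ?_ (abs_nonneg _)))
  refine le_of_forall_pos_le_add fun ε hε => ?_
  have hp : 0 < M + 1 := by linarith
  have := key (ε / (M + 1)) (div_pos hε hp)
  refine this.trans ?_
  rw [zero_add, mul_div_assoc', div_le_iff₀ hp]
  nlinarith

/-- A continuous function on the closed interval gives a bounded function of the radius. -/
lemma memL2_comp_norm_of_continuousOn {H : ℝ → ℝ} (hH : ContinuousOn H (Icc 1 R)) :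
    MemL2 (annulus R) fun x => H ‖x‖ := by
  obtain ⟨C, hC⟩ := isCompact_Icc.exists_bound_of_continuousOn hH
  have hm : ∀ x ∈ annulus R, ‖x‖ ∈ Icc 1 R := fun x hx =>
    ⟨(mem_annulus.1 hx).1.le, (mem_annulus.1 hx).2.le⟩
  refine MemLp.of_bound
    ((hH.comp continuous_norm.continuousOn hm).aestronglyMeasurable
      isOpen_annulus.measurableSet) C ?_
  filter_upwards [ae_restrict_mem isOpen_annulus.measurableSet] with x hx
  exact hC _ (hm x hx)

end

section

/-! ### Mollification -/

variable {R : ℝ} {Ω : Set Plane} {i : Fin 2} {u v w : Plane → ℝ}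

/-- A `C¹` function with compact support in `Ω` is a uniform limit of test functions, together with
its first derivatives. -/
lemma exists_testFunction_uniformly_close (hΩ : IsOpen Ω) (hw : ContDiff ℝ 1 w)
    (hc : HasCompactSupport w) (hs : tsupport w ⊆ Ω) {ε : ℝ} (hε : 0 < ε) :
    ∃ φ, IsTestFunction Ω φ ∧ (∀ x, |φ x - w x| ≤ ε) ∧
      ∀ i x, |partialDeriv i φ x - partialDeriv i w x| ≤ ε := by
  obtain ⟨r, hr0, hr⟩ := hc.isCompact.exists_cthickening_subset_open hΩ hs
  have hcd : ∀ i, HasCompactSupport (partialDeriv i w) := fun i =>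
    hc.of_isClosed_subset (isClosed_tsupport _) tsupport_partialDeriv_subset
  have hcont : ∀ i, Continuous (partialDeriv i w) := fun i => continuous_partialDeriv hw
  obtain ⟨d, hd0, hd⟩ := Metric.uniformContinuous_iff.1
    (hc.uniformContinuous_of_continuous hw.continuous) ε hε
  have hd' : ∀ i, ∃ d > 0, ∀ ⦃a b⦄, dist a b < d →
      dist (partialDeriv i w a) (partialDeriv i w b) < ε := fun i =>
    Metric.uniformContinuous_iff.1 ((hcd i).uniformContinuous_of_continuous (hcont i)) ε hε
  choose d' hd'0 hd' using hd'
  set s := min r (min d (min (d' 0) (d' 1))) with hs_def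
  have hs0 : 0 < s := by
    have := hd'0 0
    have := hd'0 1
    positivity
  have hsr : s ≤ r := min_le_left _ _
  have hsd : s ≤ d := (min_le_right _ _).trans (min_le_left _ _)
  have hsd' : ∀ i, s ≤ d' i := by
    intro i
    have h := (min_le_right r _).trans (min_le_right d (min (d' 0) (d' 1)))
    fin_cases i
    exacts [h.trans (min_le_left _ _), h.trans (min_le_right _ _)]
  let b : ContDiffBump (0 : Plane) := ⟨s / 2, s, by positivity, by linarith⟩
  set L := ContinuousLinearMap.lsmul ℝ ℝ (E := ℝ)
  set φ : Plane → ℝ := convolution (b.normed volume) w L volume with hφ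
  have hbl : LocallyIntegrable (b.normed volume) volume :=
    (b.contDiff_normed (n := 0)).continuous.locallyIntegrable
  have hsmooth : ContDiff ℝ (⊤ : ℕ∞) φ :=
    b.hasCompactSupport_normed.contDiff_convolution_left L (b.contDiff_normed (n := ⊤))
      hw.continuous.locallyIntegrable
  have hts : tsupport φ ⊆ Metric.cthickening r (tsupport w) := by
    refine closure_minimal (fun x hx => ?_) Metric.isClosed_cthickening
    obtain ⟨y, hy, z, hz, rfl⟩ := support_convolution_subset L hx
    rw [b.support_normed_eq, mem_ball_zero_iff] at hy
    refine Metric.mem_cthickening_of_dist_le _ z _ _ (subset_tsupport _ hz) ?_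
    rw [dist_eq_norm, add_sub_cancel_right]
    exact hy.le.trans hsr
  refine ⟨φ, ⟨hsmooth, hc.isCompact.cthickening.of_isClosed_subset (isClosed_tsupport _) hts,
    hts.trans hr⟩, fun x => ?_, fun i x => ?_⟩
  · rw [← Real.dist_eq]
    exact b.dist_normed_convolution_le hw.continuous.aestronglyMeasurable
      fun y hy => (hd (lt_of_lt_of_le hy hsd)).le
  · have e : partialDeriv i φ x = convolution (b.normed volume) (partialDeriv i w) L volume x := by
      rw [partialDeriv, (hc.hasFDerivAt_convolution_right L hbl hw x).fderiv,
        convolution_precompR_apply L hbl (hc.fderiv ℝ) (hw.continuous_fderiv one_ne_zero)]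
      rfl
    rw [e, ← Real.dist_eq]
    exact b.dist_normed_convolution_le (hcont i).aestronglyMeasurable
      fun y hy => (hd' i (lt_of_lt_of_le hy (hsd' i))).le

/-! ### Approximation in the norm of `H¹` -/

/-- The distance in `H¹(Ω)` of the `C¹` function `w` to the function `u` with gradient `g`. -/
def h1Dist (Ω : Set Plane) (w u : Plane → ℝ) (g : Fin 2 → Plane → ℝ) : ℝ≥0∞ :=
  eLpNorm (fun x => w x - u x) 2 (volume.restrict Ω) +
    ∑ i, eLpNorm (fun x => partialDeriv i w x - g i x) 2 (volume.restrict Ω)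

lemma tendstoH1_iff {w : ℕ → Plane → ℝ} :
    TendstoH1 Ω w u ↔
      Tendsto (fun n => h1Dist Ω (w n) u fun i => weakPartial Ω i u) atTop (𝓝 0) := by
  constructor
  · rintro ⟨h1, h2⟩
    simpa [h1Dist] using h1.add (tendsto_finsetSum Finset.univ fun i _ => h2 i)
  · intro h
    refine ⟨tendsto_of_tendsto_of_tendsto_of_le_of_le tendsto_const_nhds h (fun _ => zero_le)
      fun n => le_self_add, fun i => tendsto_of_tendsto_of_tendsto_of_le_of_le tendsto_const_nhds h
      (fun _ => zero_le) fun n => ?_⟩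
    refine le_add_left ?_
    exact Finset.single_le_sum
      (f := fun i => eLpNorm (fun x => partialDeriv i (w n) x - weakPartial Ω i u x) 2
        (volume.restrict Ω)) (fun _ _ => zero_le) (Finset.mem_univ i)

lemma memH10_of_forall_exists (hu : MemH1 Ω u)
    (h : ∀ ε : ℝ≥0∞, ε ≠ 0 → ∃ φ, IsTestFunction Ω φ ∧
      h1Dist Ω φ u (fun i => weakPartial Ω i u) ≤ ε) : MemH10 Ω u := by
  have h' : ∀ n : ℕ, ∃ φ, IsTestFunction Ω φ ∧
      h1Dist Ω φ u (fun i => weakPartial Ω i u) ≤ ((n : ℝ≥0∞) + 1)⁻¹ := fun n => h _ (by simp)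
  choose w hw1 hw2 using h'
  refine ⟨hu, w, hw1, tendstoH1_iff.2 ?_⟩
  refine tendsto_of_tendsto_of_tendsto_of_le_of_le tendsto_const_nhds ?_ (fun _ => zero_le) hw2
  have := (ENNReal.tendsto_inv_nat_nhds_zero).comp (tendsto_add_atTop_nat 1)
  refine this.congr fun n => ?_
  simp

/-- `C¹` functions with compact support in `Ω` are limits of test functions in `H¹(Ω)`. -/
lemma exists_testFunction_h1Dist_le [IsFiniteMeasure (volume.restrict Ω)] (hΩ : IsOpen Ω)
    (hw : ContDiff ℝ 1 w) (hc : HasCompactSupport w) (hs : tsupport w ⊆ Ω)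
    {g : Fin 2 → Plane → ℝ} (hu : AEStronglyMeasurable u (volume.restrict Ω))
    (hg : ∀ i, AEStronglyMeasurable (g i) (volume.restrict Ω)) {ε : ℝ≥0∞} (hε : ε ≠ 0) :
    ∃ φ, IsTestFunction Ω φ ∧ h1Dist Ω φ u g ≤ ε + h1Dist Ω w u g := by
  set m := (volume.restrict Ω univ) ^ (2 : ℝ≥0∞).toReal⁻¹ with hm
  have hmt : m ≠ ∞ := ENNReal.rpow_ne_top_of_nonneg (by positivity) (measure_ne_top _ _)
  obtain ⟨c, hc0, hcε⟩ : ∃ c : ℝ, 0 < c ∧ 3 * (m * ENNReal.ofReal c) ≤ ε := by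
    have ht : Tendsto (fun c : ℝ => 3 * (m * ENNReal.ofReal c)) (𝓝[>] 0) (𝓝 0) := by
      have : Tendsto (fun c : ℝ => 3 * (m * ENNReal.ofReal c)) (𝓝 0)
          (𝓝 (3 * (m * ENNReal.ofReal 0))) :=
        ENNReal.Tendsto.const_mul (ENNReal.Tendsto.const_mul
          (ENNReal.continuous_ofReal.tendsto 0) (.inr hmt)) (.inr (by simp))
      simp only [ENNReal.ofReal_zero, mul_zero] at this
      exact this.mono_left nhdsWithin_le_nhds
    obtain ⟨c, h1, h2⟩ := ((ht.eventually_le_const (pos_iff_ne_zero.2 hε)).and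
      self_mem_nhdsWithin).exists
    exact ⟨c, h2, h1⟩
  obtain ⟨φ, hφ, h0, h1⟩ := exists_testFunction_uniformly_close hΩ hw hc hs hc0
  refine ⟨φ, hφ, le_trans ?_ (add_le_add_left hcε _)⟩
  have hφ1 : ContDiff ℝ 1 φ := hφ.1.of_le (by exact_mod_cast le_top)
  have key : ∀ {a b k : Plane → ℝ}, Continuous a → Continuous b →
      AEStronglyMeasurable k (volume.restrict Ω) → (∀ x, |a x - b x| ≤ c) →
      eLpNorm (fun x => a x - k x) 2 (volume.restrict Ω) ≤
        m * ENNReal.ofReal c + eLpNorm (fun x => b x - k x) 2 (volume.restrict Ω) := by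
    intro a b k ha hb hk hab
    have e : (fun x => a x - k x) = (fun x => a x - b x) + fun x => b x - k x := by
      ext x; simp
    rw [e]
    refine (eLpNorm_add_le (ha.sub hb).aestronglyMeasurable
      (hb.aestronglyMeasurable.sub hk) (by norm_num)).trans ?_
    exact add_le_add (eLpNorm_le_of_ae_bound (ae_of_all _ hab)) le_rfl
  unfold h1Dist
  rw [Fin.sum_univ_two, Fin.sum_univ_two]
  have k0 := key hφ.continuous hw.continuous hu h0
  have k1 := fun i => key (continuous_partialDeriv (i := i) hφ1) (continuous_partialDeriv hw)
    (hg i) (h1 i)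
  refine (add_le_add k0 (add_le_add (k1 0) (k1 1))).trans (le_of_eq ?_)
  ring

end

section

/-! ### A Hardy-type estimate near the boundary circles -/

variable {R : ℝ} {i : Fin 2} {u v w : Plane → ℝ}

lemma ennreal_add_sq_le (a b : ℝ≥0∞) : (a + b) ^ 2 ≤ 2 * a ^ 2 + 2 * b ^ 2 := by
  have := ENNReal.rpow_add_le_mul_rpow_add_rpow a b (p := 2) (by norm_num)
  norm_num at this
  rwa [mul_add] at this

lemma eLpNorm_two_sq {α : Type*} [MeasurableSpace α] {μ : Measure α} (f : α → ℝ) :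
    eLpNorm f 2 μ ^ 2 = ∫⁻ x, ‖f x‖ₑ ^ 2 ∂μ := by
  have := eLpNorm_nnreal_pow_eq_lintegral (f := f) (μ := μ) (p := 2) (by norm_num)
  simpa using this

/-- The Cauchy–Schwarz inequality on a set of finite measure. -/
lemma lintegral_sq_le {s : Set ℝ} {y : ℝ → ℝ} (hy : Continuous y) :
    (∫⁻ t in s, ‖y t‖ₑ) ^ 2 ≤ volume s * ∫⁻ t in s, ‖y t‖ₑ ^ 2 := by
  have h := eLpNorm_le_eLpNorm_mul_rpow_measure_univ (p := 1) (q := 2) (f := y)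
    (μ := volume.restrict s) (by norm_num) hy.aestronglyMeasurable
  rw [eLpNorm_one_eq_lintegral_enorm] at h
  calc _ ≤ (eLpNorm y 2 (volume.restrict s) * volume.restrict s univ ^
        (1 / (1 : ℝ≥0∞).toReal - 1 / (2 : ℝ≥0∞).toReal)) ^ 2 := by gcongr
    _ = _ := by
      rw [mul_pow, eLpNorm_two_sq, mul_comm, Measure.restrict_apply_univ, ← ENNReal.rpow_natCast,
        ← ENNReal.rpow_mul]
      norm_num

lemma enorm_sq_le_of_hasDerivAt {y y' : ℝ → ℝ} (hy : ∀ t, HasDerivAt y (y' t) t)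
    (hy' : Continuous y') (a b : ℝ) :
    ‖y b‖ₑ ^ 2 ≤ 2 * ‖y a‖ₑ ^ 2 +
      2 * (ENNReal.ofReal |b - a| * ∫⁻ t in Ioo (min a b) (max a b), ‖y' t‖ₑ ^ 2) := by
  have h1 : y b = y a + ∫ t in a..b, y' t := by
    rw [intervalIntegral.integral_eq_sub_of_hasDerivAt (fun t _ => hy t)
      (hy'.intervalIntegrable _ _)]
    ring
  have h2 : ‖∫ t in a..b, y' t‖ₑ ≤ ∫⁻ t in Ioo (min a b) (max a b), ‖y' t‖ₑ := by
    have : ‖∫ t in a..b, y' t‖ₑ = ‖∫ t in Ioo (min a b) (max a b), y' t‖ₑ := by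
      rw [← ofReal_norm, ← ofReal_norm, intervalIntegral.norm_integral_eq_norm_integral_uIoc,
        uIoc, integral_Ioc_eq_integral_Ioo]
    rw [this]
    exact enorm_integral_le_lintegral_enorm _
  have hvol : volume (Ioo (min a b) (max a b)) = ENNReal.ofReal |b - a| := by
    rw [Real.volume_Ioo, max_sub_min_eq_abs]
  calc ‖y b‖ₑ ^ 2 ≤ (‖y a‖ₑ + ‖∫ t in a..b, y' t‖ₑ) ^ 2 := by
        rw [h1]
        gcongr
        exact enorm_add_le _ _
    _ ≤ 2 * ‖y a‖ₑ ^ 2 + 2 * ‖∫ t in a..b, y' t‖ₑ ^ 2 := ennreal_add_sq_le _ _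
    _ ≤ 2 * ‖y a‖ₑ ^ 2 + 2 * (∫⁻ t in Ioo (min a b) (max a b), ‖y' t‖ₑ) ^ 2 := by gcongr
    _ ≤ _ := by
        gcongr
        rw [← hvol]
        exact lintegral_sq_le hy'

/-- The radii at distance less than `δ` from `r₀`. -/
def nearRadii (R r₀ δ : ℝ) : Set ℝ := Ioo 1 R ∩ Ioo (r₀ - δ) (r₀ + δ)

/-- The part of the annulus at distance less than `δ` from the circle of radius `r₀`. -/
def shell (R r₀ δ : ℝ) : Set Plane := norm ⁻¹' nearRadii R r₀ δ

lemma measurableSet_nearRadii {r₀ δ : ℝ} : MeasurableSet (nearRadii R r₀ δ) :=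
  measurableSet_Ioo.inter measurableSet_Ioo

lemma measurableSet_shell {r₀ δ : ℝ} : MeasurableSet (shell R r₀ δ) :=
  measurable_norm measurableSet_nearRadii

lemma shell_subset {r₀ δ : ℝ} : shell R r₀ δ ⊆ annulus R :=
  fun _ hx => mem_annulus.2 hx.1

lemma lintegral_shell {F : Plane → ℝ≥0∞} (hF : Measurable F) (r₀ δ : ℝ) :
    ∫⁻ x in shell R r₀ δ, F x = ∫⁻ r in nearRadii R r₀ δ, ∫⁻ θ in Ioc 0 (2 * Real.pi),
      ENNReal.ofReal r * F (circlePoint r θ) := by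
  have h := lintegral_annulus (R := R) (hF.indicator (measurableSet_shell (R := R) (r₀ := r₀) (δ := δ)))
  rw [lintegral_indicator measurableSet_shell, Measure.restrict_restrict measurableSet_shell,
    inter_eq_left.2 shell_subset] at h
  have hI : nearRadii R r₀ δ ∩ Ioo 1 R = nearRadii R r₀ δ := inter_eq_left.2 inter_subset_left
  rw [h]
  conv_rhs => rw [← hI]
  rw [← Measure.restrict_restrict measurableSet_nearRadii,
    ← lintegral_indicator measurableSet_nearRadii]
  refine setLIntegral_congr_fun measurableSet_Ioo fun r hr => ?_
  have hr' : |r| = r := abs_of_pos (zero_lt_one.trans hr.1)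
  by_cases hI : r ∈ nearRadii R r₀ δ
  · have : ∀ θ, circlePoint r θ ∈ shell R r₀ δ := fun θ => by simpa [shell, hr'] using hI
    simp [indicator_of_mem, hI, this]
  · have : ∀ θ, circlePoint r θ ∉ shell R r₀ δ := fun θ => by simpa [shell, hr'] using hI
    simp [indicator_of_notMem, hI, this]

lemma volume_nearRadii_le {r₀ δ : ℝ} : volume (nearRadii R r₀ δ) ≤ ENNReal.ofReal (2 * δ) := by
  refine (measure_mono inter_subset_right).trans ?_
  rw [Real.volume_Ioo]
  exact ENNReal.ofReal_le_ofReal (by linarith)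

lemma volume_shell_le {r₀ δ : ℝ} :
    volume.restrict (annulus R) (shell R r₀ δ) ≤
      ENNReal.ofReal (2 * Real.pi * R) * ENNReal.ofReal (2 * δ) := by
  rw [shell, ← Measure.map_apply measurable_norm measurableSet_nearRadii]
  refine (map_norm_le _).trans ?_
  rw [Measure.smul_apply, smul_eq_mul]
  gcongr
  exact (Measure.restrict_apply_le _ _).trans volume_nearRadii_le

lemma hasDerivAt_circlePoint (t θ : ℝ) :
    HasDerivAt (fun t => circlePoint t θ) (circlePoint 1 θ) t := by
  have : (fun t => circlePoint t θ) = fun t => t • circlePoint 1 θ := by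
    ext t i
    fin_cases i <;> simp [circlePoint]
  rw [this]
  simpa using (hasDerivAt_id t).smul_const (circlePoint 1 θ)

lemma circlePoint_one_eq (θ : ℝ) :
    circlePoint 1 θ = Real.cos θ • EuclideanSpace.single (0 : Fin 2) (1 : ℝ) +
      Real.sin θ • EuclideanSpace.single (1 : Fin 2) (1 : ℝ) := by
  ext i
  fin_cases i <;> simp [circlePoint]

lemma hasDerivAt_comp_circlePoint (hw : ContDiff ℝ 1 w) (t θ : ℝ) :
    HasDerivAt (fun t => w (circlePoint t θ)) (Real.cos θ * partialDeriv 0 w (circlePoint t θ) +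
      Real.sin θ * partialDeriv 1 w (circlePoint t θ)) t := by
  have := ((hw.differentiable one_ne_zero) (circlePoint t θ)).hasFDerivAt.comp_hasDerivAt t
    (hasDerivAt_circlePoint t θ)
  convert! this using 1
  simp [circlePoint_one_eq, partialDeriv]

lemma enorm_radialDeriv_sq_le (a b θ : ℝ) :
    ‖Real.cos θ * a + Real.sin θ * b‖ₑ ^ 2 ≤ ‖a‖ₑ ^ 2 + ‖b‖ₑ ^ 2 := by
  simp only [← ofReal_norm, ← ENNReal.ofReal_pow (norm_nonneg _)]
  rw [← ENNReal.ofReal_add (by positivity) (by positivity)]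
  refine ENNReal.ofReal_le_ofReal ?_
  simp only [Real.norm_eq_abs, sq_abs]
  nlinarith [sq_nonneg (Real.sin θ * a - Real.cos θ * b), Real.sin_sq_add_cos_sq θ]

/-- The mass of a `C¹` function near a boundary circle is controlled by its values on the circle and
its gradient. -/
lemma lintegral_shell_sq_le (hw : ContDiff ℝ 1 w) {r₀ δ : ℝ} (hr₀ : r₀ ∈ Icc 1 R) :
    ∫⁻ x in shell R r₀ δ, ‖w x‖ₑ ^ 2 ≤ ENNReal.ofReal (2 * δ) * (ENNReal.ofReal R *
      (2 * (∫⁻ θ in Ioc 0 (2 * Real.pi), ‖w (circlePoint r₀ θ)‖ₑ ^ 2) +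
        2 * (ENNReal.ofReal δ * ∫⁻ x in shell R r₀ δ,
          (‖partialDeriv 0 w x‖ₑ ^ 2 + ‖partialDeriv 1 w x‖ₑ ^ 2)))) := by
  set D : Plane → ℝ≥0∞ := fun x => ‖partialDeriv 0 w x‖ₑ ^ 2 + ‖partialDeriv 1 w x‖ₑ ^ 2 with hD
  have hDc : ∀ i, Continuous (partialDeriv i w) := fun i => continuous_partialDeriv hw
  have hDm : Measurable D :=
    (((hDc 0).measurable.enorm).pow_const 2).add (((hDc 1).measurable.enorm).pow_const 2)
  set T := ∫⁻ θ in Ioc 0 (2 * Real.pi), ‖w (circlePoint r₀ θ)‖ₑ ^ 2 with hT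
  have hDcp : Measurable fun p : ℝ × ℝ => D (circlePoint p.1 p.2) :=
    hDm.comp continuous_circlePoint.measurable
  have hwm : ∀ r, Measurable fun θ => ‖w (circlePoint r θ)‖ₑ ^ 2 := fun r =>
    ((hw.continuous.comp (continuous_circlePoint.comp
      (Continuous.prodMk_right r))).measurable.enorm).pow_const 2
  -- along each ray, `w` is its boundary value plus the integral of its radial derivative
  have hray : ∀ r ∈ nearRadii R r₀ δ, ∀ θ, ‖w (circlePoint r θ)‖ₑ ^ 2 ≤
      2 * ‖w (circlePoint r₀ θ)‖ₑ ^ 2 +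
        2 * (ENNReal.ofReal δ * ∫⁻ t in nearRadii R r₀ δ, D (circlePoint t θ)) := by
    intro r hr θ
    have hcont : Continuous fun t => Real.cos θ * partialDeriv 0 w (circlePoint t θ) +
        Real.sin θ * partialDeriv 1 w (circlePoint t θ) := by
      have : Continuous fun t => circlePoint t θ :=
        continuous_circlePoint.comp (Continuous.prodMk_left θ)
      have := (hDc 0).comp this
      have := (hDc 1).comp (continuous_circlePoint.comp (Continuous.prodMk_left θ))
      fun_prop
    refine (enorm_sq_le_of_hasDerivAt (fun t => hasDerivAt_comp_circlePoint hw t θ) hcont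
      r₀ r).trans ?_
    gcongr 2 * _ + 2 * (ENNReal.ofReal ?_ * ?_)
    · exact (abs_lt.2 ⟨by linarith [hr.2.1], by linarith [hr.2.2]⟩).le
    · refine (lintegral_mono fun t => enorm_radialDeriv_sq_le _ _ θ).trans ?_
      refine lintegral_mono_set fun t ht => ?_
      obtain ⟨⟨h1, h2⟩, h3, h4⟩ := hr
      obtain ⟨h5, h6⟩ := hr₀
      obtain ⟨h7, h8⟩ := ht
      refine ⟨⟨lt_of_le_of_lt (le_min h5 h1.le) h7, lt_of_lt_of_le h8 (max_le h6 h2.le)⟩, ?_, ?_⟩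
      · exact lt_of_le_of_lt (le_min (by linarith) h3.le) h7
      · exact lt_of_lt_of_le h8 (max_le (by linarith) h4.le)
  -- the Jacobian `t` of polar coordinates is at least one in the annulus
  have hswap : ∫⁻ θ in Ioc 0 (2 * Real.pi), ∫⁻ t in nearRadii R r₀ δ, D (circlePoint t θ) ≤
      ∫⁻ x in shell R r₀ δ, D x := by
    rw [lintegral_shell hDm, lintegral_lintegral_swap]
    · refine lintegral_mono_ae ((ae_restrict_iff' measurableSet_nearRadii).2
        (ae_of_all _ fun t ht => lintegral_mono fun θ => ?_))
      exact le_mul_of_one_le_left zero_le (ENNReal.one_le_ofReal.2 ht.1.1.le)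
    · exact (hDcp.comp measurable_swap).aemeasurable
  have hcirc : ∀ r ∈ nearRadii R r₀ δ, ∫⁻ θ in Ioc 0 (2 * Real.pi),
      ENNReal.ofReal r * ‖w (circlePoint r θ)‖ₑ ^ 2 ≤
      ENNReal.ofReal R * (2 * T + 2 * (ENNReal.ofReal δ * ∫⁻ x in shell R r₀ δ, D x)) := by
    intro r hr
    rw [lintegral_const_mul _ (hwm r)]
    gcongr
    · exact hr.1.2.le
    · refine (lintegral_mono (hray r hr)).trans ?_
      have hm1 : Measurable fun θ => ∫⁻ t in nearRadii R r₀ δ, D (circlePoint t θ) :=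
        hDcp.lintegral_prod_left'
      rw [lintegral_add_left ((hwm r₀).const_mul 2), lintegral_const_mul _ (hwm r₀),
        lintegral_const_mul _ (hm1.const_mul _), lintegral_const_mul _ hm1]
      gcongr
  calc ∫⁻ x in shell R r₀ δ, ‖w x‖ₑ ^ 2
      = ∫⁻ r in nearRadii R r₀ δ, ∫⁻ θ in Ioc 0 (2 * Real.pi),
          ENNReal.ofReal r * ‖w (circlePoint r θ)‖ₑ ^ 2 :=
        lintegral_shell ((hw.continuous.measurable.enorm).pow_const 2) r₀ δ
    _ ≤ ∫⁻ r in nearRadii R r₀ δ,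
          ENNReal.ofReal R * (2 * T + 2 * (ENNReal.ofReal δ * ∫⁻ x in shell R r₀ δ, D x)) :=
        lintegral_mono_ae ((ae_restrict_iff' measurableSet_nearRadii).2 (ae_of_all _ hcirc))
    _ ≤ _ := by
        rw [lintegral_const, Measure.restrict_apply_univ, mul_comm]
        gcongr
        exact volume_nearRadii_le

end

section

/-! ### Vanishing traces and the space `H¹₀` -/

variable {R : ℝ} {i : Fin 2} {u v w : Plane → ℝ}

lemma eLpNorm_le_add_eLpNorm_sub {α : Type*} [MeasurableSpace α] {μ : Measure α} {p : ℝ≥0∞}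
    (hp : 1 ≤ p) {a b : α → ℝ} (ha : AEStronglyMeasurable a μ) (hb : AEStronglyMeasurable b μ) :
    eLpNorm a p μ ≤ eLpNorm b p μ + eLpNorm (fun x => a x - b x) p μ := by
  have e : a = b + fun x => a x - b x := by
    ext x; simp
  conv_lhs => rw [e]
  exact eLpNorm_add_le hb (ha.sub hb) hp

lemma tendsto_eLpNorm_of_tendsto_sub {α : Type*} [MeasurableSpace α] {μ : Measure α} {p : ℝ≥0∞}
    (hp : 1 ≤ p) {a : ℕ → α → ℝ} {b : α → ℝ} (ha : ∀ n, AEStronglyMeasurable (a n) μ)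
    (hb : AEStronglyMeasurable b μ)
    (h : Tendsto (fun n => eLpNorm (fun x => a n x - b x) p μ) atTop (𝓝 0)) :
    Tendsto (fun n => eLpNorm (a n) p μ) atTop (𝓝 (eLpNorm b p μ)) := by
  have h1 : Tendsto (fun n => eLpNorm b p μ + eLpNorm (fun x => a n x - b x) p μ) atTop
      (𝓝 (eLpNorm b p μ)) := by
    simpa using (tendsto_const_nhds (x := eLpNorm b p μ)).add h
  have h2 : Tendsto (fun n => eLpNorm b p μ - eLpNorm (fun x => a n x - b x) p μ) atTop
      (𝓝 (eLpNorm b p μ)) := by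
    simpa using ENNReal.Tendsto.sub (tendsto_const_nhds (x := eLpNorm b p μ)) h (.inr (by simp))
  refine tendsto_of_tendsto_of_tendsto_of_le_of_le h2 h1 (fun n => ?_)
    fun n => eLpNorm_le_add_eLpNorm_sub hp (ha n) hb
  rw [tsub_le_iff_right]
  refine (eLpNorm_le_add_eLpNorm_sub hp hb (ha n)).trans (le_of_eq ?_)
  congr 1
  rw [← eLpNorm_neg]
  congr 1
  ext x
  simp

lemma volume_restrict_shell_le {r₀ δ : ℝ} :
    volume.restrict (shell R r₀ δ) ≤ volume.restrict (annulus R) :=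
  Measure.restrict_mono shell_subset le_rfl

lemma lintegral_sq_add {α : Type*} [MeasurableSpace α] {μ : Measure α} {a b : α → ℝ}
    (ha : AEStronglyMeasurable a μ) :
    ∫⁻ x, (‖a x‖ₑ ^ 2 + ‖b x‖ₑ ^ 2) ∂μ = eLpNorm a 2 μ ^ 2 + eLpNorm b 2 μ ^ 2 := by
  rw [lintegral_add_left' (ha.enorm.pow_const 2), eLpNorm_two_sq, eLpNorm_two_sq]

/-- Hardy's inequality: near a circle on which `u` has zero trace, the mass of `u` is small compared
with its gradient. -/
lemma HasTraceOnCircle.eLpNorm_shell_le (hu : MemH1 (annulus R) u) {r₀ : ℝ} (hr₀ : r₀ ∈ Icc 1 R)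
    (htr : HasTraceOnCircle (annulus R) r₀ u 0) {δ : ℝ} (hδ : 0 ≤ δ) :
    eLpNorm u 2 (volume.restrict (shell R r₀ δ)) ≤ ENNReal.ofReal (2 * R * δ) *
      (eLpNorm (weakPartial (annulus R) 0 u) 2 (volume.restrict (shell R r₀ δ)) +
        eLpNorm (weakPartial (annulus R) 1 u) 2 (volume.restrict (shell R r₀ δ))) := by
  obtain ⟨w, hw, ⟨hw0, hw1⟩, htr⟩ := htr
  set S := shell R r₀ δ with hS
  have hR : 1 ≤ R := hr₀.1.trans hr₀.2
  have hle : volume.restrict S ≤ volume.restrict (annulus R) := volume_restrict_shell_le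
  have hgm : ∀ i, AEStronglyMeasurable (weakPartial (annulus R) i u) (volume.restrict S) := fun i =>
    (hu.memL2_weakPartial isOpen_annulus).1.mono_measure hle
  have hum : AEStronglyMeasurable u (volume.restrict S) := hu.1.1.mono_measure hle
  have hdc : ∀ n i, Continuous (partialDeriv i (w n)) := fun n i => continuous_partialDeriv (hw n)
  have hmono : ∀ a : ℕ → Plane → ℝ,
      Tendsto (fun n => eLpNorm (a n) 2 (volume.restrict (annulus R))) atTop (𝓝 0) →
      Tendsto (fun n => eLpNorm (a n) 2 (volume.restrict S)) atTop (𝓝 0) := fun a ha =>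
    tendsto_of_tendsto_of_tendsto_of_le_of_le tendsto_const_nhds ha (fun _ => zero_le)
      fun n => eLpNorm_mono_measure _ hle
  have t0 := tendsto_eLpNorm_of_tendsto_sub (by norm_num)
    (fun n => (hw n).continuous.aestronglyMeasurable) hum (hmono _ hw0)
  have t1 := fun i => tendsto_eLpNorm_of_tendsto_sub (by norm_num)
    (fun n => (hdc n i).aestronglyMeasurable) (hgm i) (hmono _ (hw1 i))
  have p0 := ENNReal.Tendsto.pow (n := 2) t0
  have p1 := fun i => ENNReal.Tendsto.pow (n := 2) (t1 i)
  have pT := ENNReal.Tendsto.pow (n := 2) htr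
  have hineq : ∀ n, eLpNorm (w n) 2 (volume.restrict S) ^ 2 ≤
      ENNReal.ofReal (2 * δ) * (ENNReal.ofReal R * (2 * eLpNorm (fun θ => w n (circlePoint r₀ θ) -
        (0 : Plane → ℝ) (circlePoint r₀ θ)) 2 (volume.restrict (Ioc 0 (2 * Real.pi))) ^ 2 +
        2 * (ENNReal.ofReal δ * (eLpNorm (partialDeriv 0 (w n)) 2 (volume.restrict S) ^ 2 +
          eLpNorm (partialDeriv 1 (w n)) 2 (volume.restrict S) ^ 2)))) := by
    intro n
    rw [← lintegral_sq_add (hdc n 0).aestronglyMeasurable, eLpNorm_two_sq, eLpNorm_two_sq]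
    simp only [Pi.zero_apply, sub_zero]
    exact lintegral_shell_sq_le (hw n) hr₀
  have hlim := ENNReal.Tendsto.const_mul (a := ENNReal.ofReal (2 * δ))
    (ENNReal.Tendsto.const_mul (a := ENNReal.ofReal R)
      ((ENNReal.Tendsto.const_mul (a := 2) pT (.inr (by simp))).add
        (ENNReal.Tendsto.const_mul (a := 2) (ENNReal.Tendsto.const_mul (a := ENNReal.ofReal δ)
          ((p1 0).add (p1 1)) (.inr (by simp))) (.inr (by simp)))) (.inr (by simp)))
    (.inr ENNReal.ofReal_ne_top)
  have hfin := le_of_tendsto_of_tendsto' p0 hlim hineq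
  rw [← ENNReal.pow_le_pow_left_iff two_ne_zero]
  refine hfin.trans ?_
  set a := eLpNorm (weakPartial (annulus R) 0 u) 2 (volume.restrict S)
  set b := eLpNorm (weakPartial (annulus R) 1 u) 2 (volume.restrict S)
  have hc : ENNReal.ofReal (2 * δ) * (ENNReal.ofReal R * (2 * ENNReal.ofReal δ)) ≤
      ENNReal.ofReal (2 * R * δ) ^ 2 := by
    have h2 : (2 : ℝ≥0∞) = ENNReal.ofReal 2 := by simp
    rw [h2, ← ENNReal.ofReal_mul (by norm_num), ← ENNReal.ofReal_mul (by positivity),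
      ← ENNReal.ofReal_mul (by positivity), ← ENNReal.ofReal_pow (by positivity)]
    refine ENNReal.ofReal_le_ofReal ?_
    nlinarith [mul_nonneg (mul_nonneg hδ hδ) (sub_nonneg.2 hR), sq_nonneg δ]
  calc _ = ENNReal.ofReal (2 * δ) * (ENNReal.ofReal R * (2 * ENNReal.ofReal δ)) *
        (a ^ 2 + b ^ 2) := by
        simp only [ne_eq, OfNat.ofNat_ne_zero, not_false_eq_true, zero_pow, mul_zero, zero_add]
        ring
    _ ≤ ENNReal.ofReal (2 * R * δ) ^ 2 * (a + b) ^ 2 := by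
        gcongr
        calc a ^ 2 + b ^ 2 ≤ a ^ 2 + b ^ 2 + 2 * a * b := le_self_add
          _ = (a + b) ^ 2 := by ring
    _ = _ := by rw [mul_pow]

lemma exists_bound_deriv_smoothTransition : ∃ L, ∀ t, |deriv Real.smoothTransition t| ≤ L := by
  have hs : tsupport (deriv Real.smoothTransition) ⊆ Icc 0 1 := by
    refine closure_minimal (fun t ht => ?_) isClosed_Icc
    by_contra hn
    refine ht ?_
    rw [mem_Icc, not_and_or, not_le, not_le] at hn
    rcases hn with h | h
    · have : Real.smoothTransition =ᶠ[𝓝 t] fun _ => 0 := by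
        filter_upwards [Iio_mem_nhds h] with s hs
        exact Real.smoothTransition.zero_of_nonpos (le_of_lt hs)
      rw [this.deriv_eq, deriv_const]
    · have : Real.smoothTransition =ᶠ[𝓝 t] fun _ => 1 := by
        filter_upwards [Ioi_mem_nhds h] with s hs
        exact Real.smoothTransition.one_of_one_le (le_of_lt hs)
      rw [this.deriv_eq, deriv_const]
  have hc : Continuous (deriv Real.smoothTransition) :=
    (Real.smoothTransition.contDiff (n := 1)).continuous_deriv le_rfl
  exact HasCompactSupport.exists_bound_of_continuous
    (isCompact_Icc.of_isClosed_subset (isClosed_tsupport _) hs) hc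

/-- Cutoff functions that vanish near the boundary of the annulus, are equal to one at distance `δ`
from it, and have gradient of size `1 / δ`. -/
lemma exists_cutoff (R : ℝ) : ∃ L : ℝ, 0 ≤ L ∧ ∀ δ > 0, ∃ χ : Plane → ℝ, ContDiff ℝ 1 χ ∧
    HasCompactSupport χ ∧ tsupport χ ⊆ annulus R ∧ (∀ x, 0 ≤ χ x ∧ χ x ≤ 1) ∧
    (∀ x ∈ annulus R, x ∉ shell R 1 δ → x ∉ shell R R δ → χ x = 1 ∧ ∀ i, partialDeriv i χ x = 0) ∧
    ∀ x ∈ annulus R, ∀ i, |partialDeriv i χ x| ≤ L / δ := by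
  obtain ⟨L, hL⟩ := exists_bound_deriv_smoothTransition
  have hL0 : 0 ≤ L := (abs_nonneg _).trans (hL 0)
  refine ⟨4 * L, by positivity, fun δ hδ => ?_⟩
  set η : ℝ → ℝ := fun t => Real.smoothTransition (2 * t - 1) with hη
  have hη0 : ∀ t, t ≤ 1 / 2 → η t = 0 := fun t ht =>
    Real.smoothTransition.zero_of_nonpos (by linarith)
  have hη1 : ∀ t, 1 ≤ t → η t = 1 := fun t ht =>
    Real.smoothTransition.one_of_one_le (by linarith)
  have hηn : ∀ t, 0 ≤ η t := fun t => Real.smoothTransition.nonneg _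
  have hηl : ∀ t, η t ≤ 1 := fun t => Real.smoothTransition.le_one _
  have hηd : ∀ t, HasDerivAt η (deriv Real.smoothTransition (2 * t - 1) * 2) t := fun t => by
    have h1 : HasDerivAt (fun t : ℝ => 2 * t - 1) 2 t := by
      simpa using ((hasDerivAt_id t).const_mul 2).sub_const 1
    exact (((Real.smoothTransition.contDiff (n := 1)).differentiable one_ne_zero
      _).hasDerivAt).comp t h1
  have hηc : ContDiff ℝ 1 η := Real.smoothTransition.contDiff.comp (by fun_prop)
  -- the two factors cut off near the inner and the outer circle
  set H : ℝ → ℝ := fun t => η ((t - 1) / δ) * η ((R - t) / δ) with hH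
  have hHc : ContDiff ℝ 1 H := (hηc.comp (by fun_prop)).mul (hηc.comp (by fun_prop))
  have hH0 : ∀ t, H t ≠ 0 → t ∈ Icc (1 + δ / 2) (R - δ / 2) := by
    intro t ht
    constructor
    · by_contra hlt
      refine ht ?_
      rw [hH]
      simp only
      rw [hη0 ((t - 1) / δ), zero_mul]
      rw [div_le_iff₀ hδ]
      linarith
    · by_contra hlt
      refine ht ?_
      rw [hH]
      simp only
      rw [hη0 ((R - t) / δ), mul_zero]
      rw [div_le_iff₀ hδ]
      linarith
  have hHn : ∀ t, 0 ≤ H t := fun t => mul_nonneg (hηn _) (hηn _)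
  have hHl : ∀ t, H t ≤ 1 := fun t => mul_le_one₀ (hηl _) (hηn _) (hηl _)
  have hsupp : tsupport (fun x : Plane => H ‖x‖) ⊆
      {x : Plane | ‖x‖ ∈ Icc (1 + δ / 2) (R - δ / 2)} :=
    closure_minimal (fun x hx => hH0 _ hx) (isClosed_Icc.preimage continuous_norm)
  refine ⟨fun x => H ‖x‖, ?_, ?_, ?_, fun x => ⟨hHn _, hHl _⟩, fun x hx h1 h2 => ?_,
    fun x hx i => ?_⟩
  · rw [contDiff_iff_contDiffAt]
    intro x
    by_cases hx : x = 0
    · refine (contDiffAt_const (c := (0 : ℝ))).congr_of_eventuallyEq ?_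
      have : ∀ᶠ y : Plane in 𝓝 x, ‖y‖ < 1 :=
        continuous_norm.continuousAt.eventually_lt continuousAt_const (by simp [hx])
      filter_upwards [this] with y hy
      by_contra hne
      linarith [(hH0 _ hne).1]
    · exact hHc.contDiffAt.comp x (contDiffAt_norm ℝ hx)
  · refine (isCompact_closedBall (0 : Plane) R).of_isClosed_subset (isClosed_tsupport _)
      (hsupp.trans fun x hx => ?_)
    rw [mem_closedBall_zero_iff]
    linarith [hx.2]
  · intro x hx
    have := hsupp hx
    exact mem_annulus.2 ⟨by linarith [this.1], by linarith [this.2]⟩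
  · obtain ⟨h3, h4⟩ := mem_annulus.1 hx
    have e : H ‖x‖ = 1 := by
      have ha : 1 + δ ≤ ‖x‖ := by
        by_contra hlt
        exact h1 ⟨⟨h3, h4⟩, by linarith, by linarith⟩
      have hb : ‖x‖ ≤ R - δ := by
        by_contra hlt
        exact h2 ⟨⟨h3, h4⟩, by linarith, by linarith⟩
      rw [hH]
      simp only
      rw [hη1, hη1, one_mul]
      · rw [le_div_iff₀ hδ]; linarith
      · rw [le_div_iff₀ hδ]; linarith
    refine ⟨e, fun i => ?_⟩
    -- the gradient vanishes where `χ` attains its maximum `1`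
    have hmax : IsLocalMax (fun x : Plane => H ‖x‖) x :=
      Eventually.of_forall fun y => by simp only [e]; exact hHl _
    rw [partialDeriv, hmax.fderiv_eq_zero]
    simp
  · have d1 : HasDerivAt (fun t : ℝ => (t - 1) / δ) (1 / δ) ‖x‖ :=
      ((hasDerivAt_id _).sub_const 1).div_const δ
    have d2 : HasDerivAt (fun t : ℝ => (R - t) / δ) (-1 / δ) ‖x‖ :=
      ((hasDerivAt_id _).const_sub R).div_const δ
    have d := ((hηd _).comp ‖x‖ d1).mul ((hηd _).comp ‖x‖ d2)
    have e := partialDeriv_comp_norm (i := i) (norm_ne_zero_of_mem_annulus hx) d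
    have e' : partialDeriv i (fun x : Plane => H ‖x‖) x = _ := e
    rw [e', abs_mul]
    refine (mul_le_of_le_one_right (abs_nonneg _) (abs_apply_div_norm_le_one x i)).trans ?_
    set a := deriv Real.smoothTransition (2 * ((‖x‖ - 1) / δ) - 1) with ha
    set b := deriv Real.smoothTransition (2 * ((R - ‖x‖) / δ) - 1) with hb
    refine (abs_add_le _ _).trans ?_
    simp only [Function.comp_apply, abs_mul, abs_div, abs_neg, abs_one, abs_two, abs_of_pos hδ,
      abs_of_nonneg (hηn _)]
    have ha' : |a| ≤ L := hL _
    have hb' : |b| ≤ L := hL _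
    calc |a| * 2 * (1 / δ) * η ((R - ‖x‖) / δ) + η ((‖x‖ - 1) / δ) * (|b| * 2 * (1 / δ))
        ≤ L * 2 * (1 / δ) * 1 + 1 * (L * 2 * (1 / δ)) := by
          gcongr
          all_goals first | exact hηl _ | exact hηn _
      _ = 4 * L / δ := by ring

end

section

variable {R : ℝ} {i : Fin 2} {u v w : Plane → ℝ}

lemma exists_mul_ofReal_le {C ε : ℝ≥0∞} (hC : C ≠ ∞) (hε : ε ≠ 0) :
    ∃ c : ℝ, 0 < c ∧ C * ENNReal.ofReal c ≤ ε := by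
  have ht : Tendsto (fun c : ℝ => C * ENNReal.ofReal c) (𝓝[>] 0) (𝓝 0) := by
    have : Tendsto (fun c : ℝ => C * ENNReal.ofReal c) (𝓝 0) (𝓝 (C * ENNReal.ofReal 0)) :=
      ENNReal.Tendsto.const_mul (ENNReal.continuous_ofReal.tendsto 0) (.inr hC)
    simp only [ENNReal.ofReal_zero, mul_zero] at this
    exact this.mono_left nhdsWithin_le_nhds
  obtain ⟨c, h1, h2⟩ := ((ht.eventually_le_const (pos_iff_ne_zero.2 hε)).and
    self_mem_nhdsWithin).exists
  exact ⟨c, h2, h1⟩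

/-- The boundary layer of width `δ` of the annulus. -/
def boundaryLayer (R δ : ℝ) : Set Plane := shell R 1 δ ∪ shell R R δ

lemma measurableSet_boundaryLayer {δ : ℝ} : MeasurableSet (boundaryLayer R δ) :=
  measurableSet_shell.union measurableSet_shell

lemma boundaryLayer_subset {δ : ℝ} : boundaryLayer R δ ⊆ annulus R :=
  union_subset shell_subset shell_subset

lemma eLpNorm_indicator_boundaryLayer {δ : ℝ} :
    eLpNorm ((boundaryLayer R δ).indicator u) 2 (volume.restrict (annulus R)) =
      eLpNorm u 2 (volume.restrict (boundaryLayer R δ)) := by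
  rw [eLpNorm_indicator_eq_eLpNorm_restrict measurableSet_boundaryLayer,
    Measure.restrict_restrict measurableSet_boundaryLayer, inter_eq_left.2 boundaryLayer_subset]

lemma eLpNorm_union_le {S T : Set Plane} (hS : MeasurableSet S) (hT : MeasurableSet T)
    (hu : AEStronglyMeasurable u (volume.restrict (S ∪ T))) :
    eLpNorm u 2 (volume.restrict (S ∪ T)) ≤
      eLpNorm u 2 (volume.restrict S) + eLpNorm u 2 (volume.restrict T) := by
  have hTS := hT.diff hS
  have e : ∀ U ⊆ S ∪ T, MeasurableSet U →
      eLpNorm (U.indicator u) 2 (volume.restrict (S ∪ T)) = eLpNorm u 2 (volume.restrict U) :=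
    fun U hU hUm => by
      rw [eLpNorm_indicator_eq_eLpNorm_restrict hUm, Measure.restrict_restrict hUm,
        inter_eq_left.2 hU]
  have h2 : T \ S ⊆ S ∪ T := sdiff_subset.trans subset_union_right
  have hsum : S.indicator u + (T \ S).indicator u = (S ∪ T).indicator u := by
    rw [← union_sdiff_self, indicator_union_of_disjoint disjoint_sdiff_right]
    rfl
  calc eLpNorm u 2 (volume.restrict (S ∪ T))
      = eLpNorm (S.indicator u + (T \ S).indicator u) 2 (volume.restrict (S ∪ T)) := by
        rw [hsum, e _ subset_rfl (hS.union hT)]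
    _ ≤ _ := eLpNorm_add_le (hu.indicator hS) (hu.indicator hTS) (by norm_num)
    _ ≤ _ := by
        rw [e _ subset_union_left hS, e _ h2 hTS]
        exact add_le_add le_rfl (eLpNorm_mono_measure _ (Measure.restrict_mono sdiff_subset le_rfl))

lemma exists_eLpNorm_boundaryLayer_le (hu : MemL2 (annulus R) u) {ε : ℝ} (hε : 0 < ε) :
    ∃ d > 0, ∀ δ ≤ d, eLpNorm u 2 (volume.restrict (boundaryLayer R δ)) ≤ ENNReal.ofReal ε := by
  obtain ⟨d, hd, h⟩ := MemLp.eLpNorm_indicator_le (by norm_num) (by norm_num) hu hε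
  obtain ⟨c, hc, hcd⟩ := exists_mul_ofReal_le
    (C := 2 * (ENNReal.ofReal (2 * Real.pi * R) * 2)) (ε := ENNReal.ofReal d)
    (ENNReal.mul_ne_top (by simp) (ENNReal.mul_ne_top ENNReal.ofReal_ne_top (by simp)))
    (by simpa using hd)
  refine ⟨c, hc, fun δ hδ => ?_⟩
  rw [← eLpNorm_indicator_boundaryLayer]
  refine h _ measurableSet_boundaryLayer ((measure_union_le _ _).trans ?_)
  refine (add_le_add volume_shell_le volume_shell_le).trans (le_trans ?_ hcd)
  have e : ENNReal.ofReal (2 * δ) ≤ 2 * ENNReal.ofReal c := by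
    rw [ENNReal.ofReal_mul zero_le_two, ENNReal.ofReal_ofNat]
    gcongr
  calc _ ≤ ENNReal.ofReal (2 * Real.pi * R) * (2 * ENNReal.ofReal c) +
        ENNReal.ofReal (2 * Real.pi * R) * (2 * ENNReal.ofReal c) := by gcongr
    _ = _ := by ring

/-- Functions of class `H¹` with zero trace on both boundary circles belong to `H¹₀`: after
multiplication with a cutoff `χ` of the layer of width `δ`, the error contains the term `u ∇χ`, of
size `‖u‖ / δ` in the layer, and Hardy's inequality bounds it by the gradient of `u` in the layer,
which tends to zero with `δ`. -/
lemma memH10_of_hasTraceOnCircle (hR : 1 < R) (hu : MemH1 (annulus R) u)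
    (h1 : HasTraceOnCircle (annulus R) 1 u 0) (h2 : HasTraceOnCircle (annulus R) R u 0) :
    MemH10 (annulus R) u := by
  refine memH10_of_forall_exists hu fun ε hε => ?_
  set g : Fin 2 → Plane → ℝ := fun i => weakPartial (annulus R) i u with hg
  have hg2 : ∀ i, MemL2 (annulus R) (g i) := fun i => hu.memL2_weakPartial isOpen_annulus
  obtain ⟨L, hL0, hcut⟩ := exists_cutoff R
  have hε3 : ε / 3 ≠ 0 := by simp [hε]
  set C : ℝ≥0∞ := 1 + ENNReal.ofReal (8 * R * L + 1) * 2 with hC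
  have hCt : C ≠ ∞ := by simp [hC, ENNReal.mul_eq_top]
  obtain ⟨e, he0, he⟩ := exists_mul_ofReal_le hCt hε3
  obtain ⟨du, hdu, hu'⟩ := exists_eLpNorm_boundaryLayer_le hu.1 he0
  have hgd : ∀ i, ∃ d > 0, ∀ δ ≤ d,
      eLpNorm (g i) 2 (volume.restrict (boundaryLayer R δ)) ≤ ENNReal.ofReal e := fun i =>
    exists_eLpNorm_boundaryLayer_le (hg2 i) he0
  choose dg hdg hg' using hgd
  obtain ⟨δ, hδ0, hδu, hδg⟩ : ∃ δ > 0, δ ≤ du ∧ ∀ i, δ ≤ dg i := by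
    refine ⟨min du (min (dg 0) (dg 1)), ?_, min_le_left _ _, fun i => ?_⟩
    · have := hdg 0
      have := hdg 1
      positivity
    · have h := min_le_right du (min (dg 0) (dg 1))
      fin_cases i
      exacts [h.trans (min_le_left _ _), h.trans (min_le_right _ _)]
  replace hu' := hu' δ hδu
  replace hg' := fun i => hg' i δ (hδg i)
  set S := boundaryLayer R δ with hS
  -- Hardy's inequality in the layer
  have hhardy : eLpNorm u 2 (volume.restrict S) ≤ ENNReal.ofReal (4 * R * δ) *
      (eLpNorm (g 0) 2 (volume.restrict S) + eLpNorm (g 1) 2 (volume.restrict S)) := by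
    have a1 := h1.eLpNorm_shell_le hu ⟨le_rfl, hR.le⟩ hδ0.le
    have a2 := h2.eLpNorm_shell_le hu ⟨hR.le, le_rfl⟩ hδ0.le
    have m1 : ∀ a : Plane → ℝ, eLpNorm a 2 (volume.restrict (shell R 1 δ)) ≤
        eLpNorm a 2 (volume.restrict S) := fun a =>
      eLpNorm_mono_measure _ (Measure.restrict_mono subset_union_left le_rfl)
    have m2 : ∀ a : Plane → ℝ, eLpNorm a 2 (volume.restrict (shell R R δ)) ≤
        eLpNorm a 2 (volume.restrict S) := fun a =>
      eLpNorm_mono_measure _ (Measure.restrict_mono subset_union_right le_rfl)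
    refine (eLpNorm_union_le measurableSet_shell measurableSet_shell
      (hu.1.1.mono_measure (Measure.restrict_mono boundaryLayer_subset le_rfl))).trans ?_
    refine (add_le_add (a1.trans (mul_le_mul_right (add_le_add (m1 _) (m1 _)) _))
      (a2.trans (mul_le_mul_right (add_le_add (m2 _) (m2 _)) _))).trans (le_of_eq ?_)
    rw [← two_mul, ← mul_assoc]
    congr 1
    rw [← ENNReal.ofReal_ofNat 2, ← ENNReal.ofReal_mul (by norm_num)]
    congr 1
    ring
  obtain ⟨χ, hχ1, hχc, hχs, hχb, hχin, hχd⟩ := hcut δ hδ0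
  -- with `χ` fixed, replace `u` by a `C¹` function so close that the large factor `1 / δ` is harmless
  obtain ⟨w, hw, hwt, -⟩ := h1
  have hwt' := tendstoH1_iff.1 hwt
  set K : ℝ≥0∞ := 1 + 2 * ENNReal.ofReal (L / δ) with hK
  have hKt : K ≠ ∞ := by simp [hK, ENNReal.mul_eq_top]
  obtain ⟨n, hn⟩ : ∃ n, K * h1Dist (annulus R) (w n) u g ≤ ε / 3 := by
    have := ENNReal.Tendsto.const_mul (a := K) hwt' (.inr hKt)
    rw [mul_zero] at this
    exact (this.eventually_le_const (pos_iff_ne_zero.2 hε3)).exists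
  have hψ : ContDiff ℝ 1 fun x => w n x * χ x := (hw n).mul hχ1
  have hψs : tsupport (fun x => w n x * χ x) ⊆ tsupport χ := tsupport_mul_subset_right'
  obtain ⟨φ, hφ, hφd⟩ := exists_testFunction_h1Dist_le (u := u) (g := g) isOpen_annulus hψ
    (hχc.of_isClosed_subset (isClosed_tsupport _) hψs) (hψs.trans hχs) hu.1.1
    (fun i => (hg2 i).1) hε3
  refine ⟨φ, hφ, hφd.trans ?_⟩
  have hΩ := (isOpen_annulus (R := R)).measurableSet
  set μ := volume.restrict (annulus R) with hμ
  have hS' : ∀ x ∈ annulus R, x ∉ S → χ x = 1 ∧ ∀ i, partialDeriv i χ x = 0 := fun x hx hxS =>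
    hχin x hx (fun h => hxS (.inl h)) fun h => hxS (.inr h)
  have hχm : Continuous χ := hχ1.continuous
  have hdχ : ∀ i, Continuous (partialDeriv i χ) := fun i => continuous_partialDeriv hχ1
  have hdw : ∀ i, Continuous (partialDeriv i (w n)) := fun i => continuous_partialDeriv (hw n)
  have mwu : AEStronglyMeasurable (fun x => w n x - u x) μ :=
    (hw n).continuous.aestronglyMeasurable.sub hu.1.1
  have mwg : ∀ i, AEStronglyMeasurable (fun x => partialDeriv i (w n) x - g i x) μ := fun i =>
    (hdw i).aestronglyMeasurable.sub (hg2 i).1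
  -- the multiplication by `χ - 1` only sees the layer
  have cut : ∀ a : Plane → ℝ, eLpNorm (fun x => (χ x - 1) * a x) 2 μ ≤
      eLpNorm a 2 (volume.restrict S) := by
    intro a
    rw [← eLpNorm_indicator_boundaryLayer]
    refine eLpNorm_mono_ae ?_
    filter_upwards [ae_restrict_mem hΩ] with x hx
    by_cases hxS : x ∈ S
    · rw [indicator_of_mem hxS, norm_mul]
      refine mul_le_of_le_one_left (norm_nonneg _) ?_
      rw [Real.norm_eq_abs, abs_le]
      constructor <;> linarith [(hχb x).1, (hχb x).2]
    · simp [(hS' x hx hxS).1]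
  have cutd : ∀ i, eLpNorm (fun x => partialDeriv i χ x * u x) 2 μ ≤
      ENNReal.ofReal (L / δ) * eLpNorm u 2 (volume.restrict S) := by
    intro i
    rw [← eLpNorm_indicator_boundaryLayer]
    refine eLpNorm_le_mul_eLpNorm_of_ae_le_mul ?_ 2
    filter_upwards [ae_restrict_mem hΩ] with x hx
    by_cases hxS : x ∈ S
    · rw [indicator_of_mem hxS, norm_mul]
      exact mul_le_mul_of_nonneg_right (hχd x hx i) (norm_nonneg _)
    · rw [(hS' x hx hxS).2 i, zero_mul, norm_zero]
      positivity
  have main0 : eLpNorm (fun x => w n x * χ x - u x) 2 μ ≤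
      eLpNorm (fun x => w n x - u x) 2 μ + eLpNorm u 2 (volume.restrict S) := by
    have e1 : (fun x => w n x * χ x - u x) =
        (fun x => χ x * (w n x - u x)) + fun x => (χ x - 1) * u x := by
      ext x
      simp only [Pi.add_apply]
      ring
    rw [e1]
    refine (eLpNorm_add_le (hχm.aestronglyMeasurable.mul mwu)
      ((hχm.sub continuous_const).aestronglyMeasurable.mul hu.1.1) (by norm_num)).trans
      (add_le_add (eLpNorm_mono fun x => ?_) (cut u))
    change ‖χ x * (w n x - u x)‖ ≤ ‖w n x - u x‖
    rw [norm_mul, Real.norm_eq_abs, abs_of_nonneg (hχb x).1]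
    exact mul_le_of_le_one_left (norm_nonneg _) (hχb x).2
  have main1 : ∀ i, eLpNorm (fun x => partialDeriv i (fun x => w n x * χ x) x - g i x) 2 μ ≤
      (ENNReal.ofReal (L / δ) * eLpNorm (fun x => w n x - u x) 2 μ +
        eLpNorm (fun x => partialDeriv i (w n) x - g i x) 2 μ) +
      (ENNReal.ofReal (L / δ) * eLpNorm u 2 (volume.restrict S) +
        eLpNorm (g i) 2 (volume.restrict S)) := by
    intro i
    have e1 : (fun x => partialDeriv i (fun x => w n x * χ x) x - g i x) =
        ((fun x => partialDeriv i χ x * (w n x - u x)) +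
          fun x => χ x * (partialDeriv i (w n) x - g i x)) +
        ((fun x => partialDeriv i χ x * u x) + fun x => (χ x - 1) * g i x) := by
      ext x
      simp only [Pi.add_apply]
      rw [partialDeriv_mul ((hw n).differentiable one_ne_zero x) (hχ1.differentiable one_ne_zero x)]
      ring
    rw [e1]
    have n1 := (hdχ i).aestronglyMeasurable.mul mwu
    have n2 := hχm.aestronglyMeasurable.mul (mwg i)
    have n3 := (hdχ i).aestronglyMeasurable.mul hu.1.1
    have n4 := ((hχm.sub (continuous_const (y := (1 : ℝ)))).aestronglyMeasurable (μ := μ)).mul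
      (hg2 i).1
    refine (eLpNorm_add_le (n1.add n2) (n3.add n4) (by norm_num)).trans (add_le_add
      ((eLpNorm_add_le n1 n2 (by norm_num)).trans (add_le_add ?_ ?_))
      ((eLpNorm_add_le n3 n4 (by norm_num)).trans (add_le_add (cutd i) (cut (g i)))))
    · refine eLpNorm_le_mul_eLpNorm_of_ae_le_mul ?_ 2
      filter_upwards [ae_restrict_mem hΩ] with x hx
      change ‖partialDeriv i χ x * (w n x - u x)‖ ≤ _
      rw [norm_mul]
      exact mul_le_mul_of_nonneg_right (hχd x hx i) (norm_nonneg _)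
    · refine eLpNorm_mono fun x => ?_
      change ‖χ x * (partialDeriv i (w n) x - g i x)‖ ≤ ‖partialDeriv i (w n) x - g i x‖
      rw [norm_mul, Real.norm_eq_abs, abs_of_nonneg (hχb x).1]
      exact mul_le_of_le_one_left (norm_nonneg _) (hχb x).2
  have hchi : h1Dist (annulus R) (fun x => w n x * χ x) u g ≤ ε / 3 + ε / 3 := by
    rw [h1Dist, Fin.sum_univ_two] at hn ⊢
    set A := eLpNorm (fun x => w n x - u x) 2 μ
    set B0 := eLpNorm (fun x => partialDeriv 0 (w n) x - g 0 x) 2 μ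
    set B1 := eLpNorm (fun x => partialDeriv 1 (w n) x - g 1 x) 2 μ
    set U := eLpNorm u 2 (volume.restrict S)
    set G0 := eLpNorm (g 0) 2 (volume.restrict S)
    set G1 := eLpNorm (g 1) 2 (volume.restrict S)
    set l := ENNReal.ofReal (L / δ) with hl
    have hlU : 2 * l * U ≤ ENNReal.ofReal (8 * R * L) * (G0 + G1) := by
      calc 2 * l * U ≤ 2 * l * (ENNReal.ofReal (4 * R * δ) * (G0 + G1)) := by gcongr
        _ = _ := by
          rw [← mul_assoc, ← ENNReal.ofReal_ofNat 2, hl, ← ENNReal.ofReal_mul (by norm_num),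
            ← ENNReal.ofReal_mul (by positivity)]
          congr 2
          field_simp
          ring
    calc _ ≤ (A + U) + (((l * A + B0) + (l * U + G0)) + ((l * A + B1) + (l * U + G1))) :=
          add_le_add main0 (add_le_add (main1 0) (main1 1))
      _ = ((1 + 2 * l) * A + 1 * (B0 + B1)) + (U + (2 * l * U + 1 * (G0 + G1))) := by ring
      _ ≤ (K * A + K * (B0 + B1)) +
          (ENNReal.ofReal e + (ENNReal.ofReal (8 * R * L) * (G0 + G1) + 1 * (G0 + G1))) := by
          gcongr
          exact le_self_add
      _ = K * (A + (B0 + B1)) +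
          (ENNReal.ofReal e + ENNReal.ofReal (8 * R * L + 1) * (G0 + G1)) := by
          rw [ENNReal.ofReal_add (by positivity) zero_le_one, ENNReal.ofReal_one]
          ring
      _ ≤ ε / 3 + (ENNReal.ofReal e + ENNReal.ofReal (8 * R * L + 1) *
            (ENNReal.ofReal e + ENNReal.ofReal e)) := by
          gcongr
          exacts [hg' 0, hg' 1]
      _ = ε / 3 + C * ENNReal.ofReal e := by rw [hC]; ring
      _ ≤ _ := by gcongr
  calc ε / 3 + h1Dist (annulus R) (fun x => w n x * χ x) u g ≤ ε / 3 + (ε / 3 + ε / 3) := by gcongr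
    _ = ε := by rw [← add_assoc, ENNReal.add_thirds]

end

section

/-! ### Limits of products and the Sobolev inequality -/

variable {R : ℝ} {Ω : Set Plane} {i : Fin 2} {u v w p φ : Plane → ℝ}

instance holderTriple_four_four_two : ENNReal.HolderTriple 4 4 2 :=
  ⟨by
    have : (4 : ℝ≥0∞) = 2 * 2 := by norm_num
    rw [← two_mul, this, ENNReal.mul_inv (by simp) (by simp), ← mul_assoc,
      ENNReal.mul_inv_cancel (by simp) (by simp), one_mul]⟩

lemma eLpNorm_mul_le {α : Type*} [MeasurableSpace α] {μ : Measure α} {p q r : ℝ≥0∞}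
    [ENNReal.HolderTriple p q r] {a b : α → ℝ} (ha : AEStronglyMeasurable a μ)
    (hb : AEStronglyMeasurable b μ) :
    eLpNorm (fun x => a x * b x) r μ ≤ eLpNorm a p μ * eLpNorm b q μ :=
  eLpNorm_smul_le_mul_eLpNorm (φ := a) (f := b) hb ha

lemma memLp_mul {α : Type*} [MeasurableSpace α] {μ : Measure α} {p q r : ℝ≥0∞}
    [ENNReal.HolderTriple p q r] {a b : α → ℝ} (ha : MemLp a p μ) (hb : MemLp b q μ) :
    MemLp (fun x => a x * b x) r μ :=
  ⟨ha.1.mul hb.1, (eLpNorm_mul_le ha.1 hb.1).trans_lt (ENNReal.mul_lt_top ha.2 hb.2)⟩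

/-- The product is continuous from `L^p × L^q` to `L^r`. -/
lemma tendsto_eLpNorm_mul_sub {α : Type*} [MeasurableSpace α] {μ : Measure α} {p q r : ℝ≥0∞}
    [ENNReal.HolderTriple p q r] (hr : 1 ≤ r) (hq : 1 ≤ q) {a : ℕ → α → ℝ} {b : ℕ → α → ℝ}
    {a' b' : α → ℝ} (ha : ∀ n, AEStronglyMeasurable (a n) μ) (hb : ∀ n, AEStronglyMeasurable (b n) μ)
    (ha' : MemLp a' p μ) (hb' : MemLp b' q μ)
    (hta : Tendsto (fun n => eLpNorm (fun x => a n x - a' x) p μ) atTop (𝓝 0))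
    (htb : Tendsto (fun n => eLpNorm (fun x => b n x - b' x) q μ) atTop (𝓝 0)) :
    Tendsto (fun n => eLpNorm (fun x => a n x * b n x - a' x * b' x) r μ) atTop (𝓝 0) := by
  have h1 := tendsto_eLpNorm_of_tendsto_sub hq hb hb'.1 htb
  have h2 := (ENNReal.Tendsto.mul hta (.inr hb'.2.ne) h1 (.inr (by simp))).add
    (ENNReal.Tendsto.const_mul htb (.inr ha'.2.ne))
  simp only [zero_mul, mul_zero, add_zero] at h2
  refine tendsto_of_tendsto_of_tendsto_of_le_of_le tendsto_const_nhds h2 (fun _ => zero_le)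
    fun n => ?_
  have e : (fun x => a n x * b n x - a' x * b' x) =
      (fun x => (a n x - a' x) * b n x) + fun x => a' x * (b n x - b' x) := by
    ext x
    simp only [Pi.add_apply]
    ring
  rw [e]
  refine (eLpNorm_add_le (((ha n).sub ha'.1).mul (hb n)) (ha'.1.mul ((hb n).sub hb'.1)) hr).trans ?_
  exact add_le_add (eLpNorm_mul_le ((ha n).sub ha'.1) (hb n))
    (eLpNorm_mul_le ha'.1 ((hb n).sub hb'.1))

lemma tendsto_integral_of_eLpNorm_one {α : Type*} [MeasurableSpace α] {μ : Measure α}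
    {a : ℕ → α → ℝ} {a' : α → ℝ} (ha : ∀ n, Integrable (a n) μ) (ha' : Integrable a' μ)
    (h : Tendsto (fun n => eLpNorm (fun x => a n x - a' x) 1 μ) atTop (𝓝 0)) :
    Tendsto (fun n => ∫ x, a n x ∂μ) atTop (𝓝 (∫ x, a' x ∂μ)) :=
  tendsto_integral_of_L1' a' ha'.1 (Eventually.of_forall ha) h

lemma tendsto_integral_mul {α : Type*} [MeasurableSpace α] {μ : Measure α} {a : α → ℝ}
    {b : ℕ → α → ℝ} {b' : α → ℝ} (ha : MemLp a 2 μ) (hb : ∀ n, MemLp (b n) 2 μ)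
    (hb' : MemLp b' 2 μ) (h : Tendsto (fun n => eLpNorm (fun x => b n x - b' x) 2 μ) atTop (𝓝 0)) :
    Tendsto (fun n => ∫ x, a x * b n x ∂μ) atTop (𝓝 (∫ x, a x * b' x ∂μ)) :=
  tendsto_integral_of_eLpNorm_one (fun n => ha.integrable_mul (hb n)) (ha.integrable_mul hb')
    (tendsto_eLpNorm_mul_sub (p := 2) (q := 2) le_rfl (by norm_num) (fun _ => ha.1)
      (fun n => (hb n).1) ha hb' (by simp) h)

lemma IsTestFunction.contDiff_one (hφ : IsTestFunction Ω φ) : ContDiff ℝ 1 φ :=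
  hφ.1.of_le (by exact_mod_cast le_top)

lemma IsTestFunction.memLp [IsFiniteMeasure (volume.restrict Ω)] (hφ : IsTestFunction Ω φ)
    (q : ℝ≥0∞) : MemLp φ q (volume.restrict Ω) := by
  obtain ⟨C, hC⟩ := hφ.2.1.exists_bound_of_continuous hφ.continuous
  exact MemLp.of_bound hφ.continuous.aestronglyMeasurable C (ae_of_all _ hC)

lemma IsTestFunction.sub (hφ : IsTestFunction Ω φ) {ψ : Plane → ℝ} (hψ : IsTestFunction Ω ψ) :
    IsTestFunction Ω fun x => φ x - ψ x := by
  refine ⟨hφ.1.sub hψ.1, hφ.2.1.sub hψ.2.1, ?_⟩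
  refine (tsupport_sub φ ψ).trans (union_subset hφ.2.2 hψ.2.2)

lemma IsTestFunction.mul (hφ : IsTestFunction Ω φ) {ψ : Plane → ℝ} (hψ : IsTestFunction Ω ψ) :
    IsTestFunction Ω fun x => φ x * ψ x :=
  ⟨hφ.1.mul hψ.1, hψ.2.1.of_isClosed_subset (isClosed_tsupport _) tsupport_mul_subset_right',
    tsupport_mul_subset_right'.trans hψ.2.2⟩

/-- The defining identity of the weak derivative extends to all `φ ∈ H¹₀` when `p` and its derivative
are square integrable. -/
lemma integral_mul_weakPartial [IsFiniteMeasure (volume.restrict Ω)] (hΩ : IsOpen Ω)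
    {g : Plane → ℝ} (hp : MemL2 Ω p) (hpg : HasWeakPartial Ω i p g) (hg : MemL2 Ω g)
    (hφ : MemH10 Ω φ) :
    ∫ x in Ω, p x * weakPartial Ω i φ x = -∫ x in Ω, g x * φ x := by
  obtain ⟨w, hw, h0, h1⟩ := hφ.2
  have t1 := tendsto_integral_mul hp (fun n => (hw n).partialDeriv.memLp 2)
    (hφ.1.memL2_weakPartial hΩ) (h1 i)
  have t2 := (tendsto_integral_mul hg (fun n => (hw n).memLp 2) hφ.1.1 h0).neg
  refine tendsto_nhds_unique t1 (t2.congr fun n => ?_)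
  exact (hpg.2.2 _ (hw n)).symm

lemma norm_fderiv_le (x : Plane) :
    ‖fderiv ℝ φ x‖ ≤ |partialDeriv 0 φ x| + |partialDeriv 1 φ x| := by
  refine ContinuousLinearMap.opNorm_le_bound _ (by positivity) fun y => ?_
  have e : y = y 0 • EuclideanSpace.single (0 : Fin 2) (1 : ℝ) +
      y 1 • EuclideanSpace.single (1 : Fin 2) (1 : ℝ) := by
    ext i
    fin_cases i <;> simp
  have e2 : fderiv ℝ φ x y = y 0 * partialDeriv 0 φ x + y 1 * partialDeriv 1 φ x := by
    conv_lhs => rw [e]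
    simp [partialDeriv]
  rw [e2, Real.norm_eq_abs, add_mul]
  refine (abs_add_le _ _).trans (add_le_add ?_ ?_) <;>
  · rw [abs_mul, mul_comm]
    exact mul_le_mul_of_nonneg_left (abs_apply_le_norm y _) (abs_nonneg _)

/-- The Sobolev inequality for test functions, from the embedding of `W^{1,4/3}` into `L⁴` in two
dimensions and Hölder's inequality on the bounded annulus. -/
lemma exists_eLpNorm_four_le_testFunction (R : ℝ) : ∃ C : ℝ≥0∞, C ≠ ∞ ∧
    ∀ φ, IsTestFunction (annulus R) φ → eLpNorm φ 4 (volume.restrict (annulus R)) ≤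
      C * ∑ i, eLpNorm (partialDeriv i φ) 2 (volume.restrict (annulus R)) := by
  set C₀ := eLpNormLESNormFDerivOfLeConst ℝ (volume : Measure Plane) (annulus R) (4 / 3) 4
  set m := (volume.restrict (annulus R) univ) ^
    (1 / ((4 / 3 : NNReal) : ℝ≥0∞).toReal - 1 / (2 : ℝ≥0∞).toReal)
  have h43 : ((4 / 3 : NNReal) : ℝ≥0∞).toReal = 4 / 3 := by simp
  have hm : m ≠ ∞ := by
    refine ENNReal.rpow_ne_top_of_nonneg ?_ (measure_ne_top _ _)
    rw [h43]
    norm_num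
  refine ⟨C₀ * m, ENNReal.mul_ne_top ENNReal.coe_ne_top hm, fun φ hφ => ?_⟩
  have hb : Bornology.IsBounded (annulus R) := Metric.isBounded_ball.subset sdiff_subset
  have hs : Function.support φ ⊆ annulus R := (subset_tsupport φ).trans hφ.2.2
  have h1 := eLpNorm_le_eLpNorm_fderiv_of_le (volume : Measure Plane) (p := 4 / 3) (q := 4)
    hφ.contDiff_one hs (by rw [← NNReal.coe_le_coe]; norm_num)
    (by rw [← NNReal.coe_lt_coe]; simp; norm_num) (by simp; norm_num) hb
  have hp := fun i => continuous_partialDeriv (i := i) hφ.contDiff_one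
  set N : Plane → ℝ := fun x => |partialDeriv 0 φ x| + |partialDeriv 1 φ x| with hN
  have hNc : Continuous N := (hp 0).abs.add (hp 1).abs
  have hNs : Function.support N ⊆ annulus R := by
    intro x hx
    by_contra hn
    have hz : ∀ i, partialDeriv i φ x = 0 := fun i =>
      image_eq_zero_of_notMem_tsupport fun h => hn (hφ.partialDeriv.2.2 h)
    exact hx (by simp [hN, hz])
  have hNle : eLpNorm N 2 (volume.restrict (annulus R)) ≤
      eLpNorm (partialDeriv 0 φ) 2 (volume.restrict (annulus R)) +
        eLpNorm (partialDeriv 1 φ) 2 (volume.restrict (annulus R)) := by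
    have h := eLpNorm_add_le (p := 2) (μ := volume.restrict (annulus R))
      (f := fun x => ‖partialDeriv 0 φ x‖) (g := fun x => ‖partialDeriv 1 φ x‖)
      (hp 0).norm.aestronglyMeasurable (hp 1).norm.aestronglyMeasurable (by norm_num)
    rwa [eLpNorm_norm, eLpNorm_norm] at h
  calc eLpNorm φ 4 (volume.restrict (annulus R)) ≤ eLpNorm φ 4 volume :=
        eLpNorm_mono_measure _ Measure.restrict_le_self
    _ ≤ C₀ * eLpNorm (fderiv ℝ φ) (4 / 3 : NNReal) volume := by exact_mod_cast h1
    _ ≤ C₀ * eLpNorm N (4 / 3 : NNReal) volume := by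
        gcongr
        exact eLpNorm_mono_real norm_fderiv_le
    _ = C₀ * eLpNorm N (4 / 3 : NNReal) (volume.restrict (annulus R)) := by
        rw [eLpNorm_restrict_eq_of_support_subset hNs]
    _ ≤ C₀ * (eLpNorm N 2 (volume.restrict (annulus R)) * m) := by
        gcongr
        refine eLpNorm_le_eLpNorm_mul_rpow_measure_univ ?_ hNc.aestronglyMeasurable
        rw [show (2 : ℝ≥0∞) = ((2 : NNReal) : ℝ≥0∞) by simp, ENNReal.coe_le_coe,
          ← NNReal.coe_le_coe]
        norm_num
    _ ≤ C₀ * ((eLpNorm (partialDeriv 0 φ) 2 (volume.restrict (annulus R)) +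
          eLpNorm (partialDeriv 1 φ) 2 (volume.restrict (annulus R))) * m) := by gcongr
    _ = _ := by
        rw [Fin.sum_univ_two]
        ring

lemma eLpNorm_four_le_of_tendsto {C : ℝ≥0∞} (hC : C ≠ ∞)
    (hS : ∀ φ, IsTestFunction (annulus R) φ → eLpNorm φ 4 (volume.restrict (annulus R)) ≤
      C * ∑ i, eLpNorm (partialDeriv i φ) 2 (volume.restrict (annulus R)))
    {w : ℕ → Plane → ℝ} (hw : ∀ n, IsTestFunction (annulus R) (w n)) {g : Fin 2 → Plane → ℝ}
    (hu : MemL2 (annulus R) u) (hg : ∀ i, MemL2 (annulus R) (g i))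
    (h0 : Tendsto (fun n => eLpNorm (fun x => w n x - u x) 2 (volume.restrict (annulus R)))
      atTop (𝓝 0))
    (h1 : ∀ i, Tendsto (fun n => eLpNorm (fun x => partialDeriv i (w n) x - g i x) 2
      (volume.restrict (annulus R))) atTop (𝓝 0)) :
    eLpNorm u 4 (volume.restrict (annulus R)) ≤
      C * ∑ i, eLpNorm (g i) 2 (volume.restrict (annulus R)) := by
  have hm : TendstoInMeasure (volume.restrict (annulus R)) w atTop u :=
    tendstoInMeasure_of_tendsto_eLpNorm (p := 2) (by norm_num)
      (fun n => (hw n).continuous.aestronglyMeasurable) hu.1 h0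
  obtain ⟨ns, hns, hae⟩ := hm.exists_seq_tendsto_ae
  have t1 := fun i => tendsto_eLpNorm_of_tendsto_sub (by norm_num)
    (fun n => (hw n).partialDeriv.continuous.aestronglyMeasurable) (hg i).1 (h1 i)
  have t2 := (ENNReal.Tendsto.const_mul (a := C) (tendsto_finsetSum Finset.univ fun i _ => t1 i)
    (.inr hC)).comp hns.tendsto_atTop
  refine (Lp.eLpNorm_lim_le_liminf_eLpNorm
    (fun n => (hw (ns n)).continuous.aestronglyMeasurable) u hae).trans ?_
  rw [← t2.liminf_eq]
  exact liminf_le_liminf (Eventually.of_forall fun n => hS _ (hw (ns n)))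

/-- The Sobolev inequality on `H¹₀`. -/
lemma exists_eLpNorm_four_le (R : ℝ) : ∃ C : ℝ≥0∞, C ≠ ∞ ∧
    ∀ v, MemH10 (annulus R) v → eLpNorm v 4 (volume.restrict (annulus R)) ≤
      C * ∑ i, eLpNorm (weakPartial (annulus R) i v) 2 (volume.restrict (annulus R)) := by
  obtain ⟨C, hC, hS⟩ := exists_eLpNorm_four_le_testFunction R
  refine ⟨C, hC, fun v hv => ?_⟩
  obtain ⟨w, hw, h0, h1⟩ := hv.2
  exact eLpNorm_four_le_of_tendsto hC hS hw hv.1.1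
    (fun i => hv.1.memL2_weakPartial isOpen_annulus) h0 h1

lemma MemH10.memLp_four (hv : MemH10 (annulus R) v) :
    MemLp v 4 (volume.restrict (annulus R)) := by
  obtain ⟨C, hC, hS⟩ := exists_eLpNorm_four_le R
  refine ⟨hv.1.1.1, (hS v hv).trans_lt (ENNReal.mul_lt_top hC.lt_top ?_)⟩
  exact ENNReal.sum_lt_top.2 fun i _ => (hv.1.memL2_weakPartial isOpen_annulus).2

/-- A function of class `H¹₀` is approximated by test functions in `H¹` and in `L⁴`. -/
lemma MemH10.exists_seq (hv : MemH10 (annulus R) v) :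
    ∃ w : ℕ → Plane → ℝ, (∀ n, IsTestFunction (annulus R) (w n)) ∧ TendstoH1 (annulus R) w v ∧
      Tendsto (fun n => eLpNorm (fun x => w n x - v x) 4 (volume.restrict (annulus R))) atTop
        (𝓝 0) := by
  obtain ⟨C, hC, hS⟩ := exists_eLpNorm_four_le_testFunction R
  obtain ⟨w, hw, h0, h1⟩ := hv.2
  refine ⟨w, hw, ⟨h0, h1⟩, ?_⟩
  have hsum := ENNReal.Tendsto.const_mul (a := C)
    (tendsto_finsetSum Finset.univ fun i _ => h1 i) (.inr hC)
  simp only [Finset.sum_const_zero, mul_zero] at hsum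
  have hg := fun i => hv.1.memL2_weakPartial (i := i) isOpen_annulus
  refine tendsto_of_tendsto_of_tendsto_of_le_of_le tendsto_const_nhds hsum (fun _ => zero_le)
    fun n => ?_
  have hd : ∀ m i, partialDeriv i (fun x => w n x - w m x) =
      fun x => partialDeriv i (w n) x - partialDeriv i (w m) x := by
    intro m i
    ext x
    simp only [partialDeriv]
    rw [fderiv_fun_sub ((hw n).contDiff_one.differentiable one_ne_zero x)
      ((hw m).contDiff_one.differentiable one_ne_zero x)]
    rfl
  refine eLpNorm_four_le_of_tendsto hC hS (w := fun m x => w n x - w m x)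
    (fun m => (hw n).sub (hw m)) (MemLp.sub ((hw n).memLp 2) hv.1.1)
    (fun i => MemLp.sub ((hw n).partialDeriv.memLp 2) (hg i)) (h0.congr fun m => ?_)
    fun i => (h1 i).congr fun m => ?_
  · rw [← eLpNorm_neg]
    congr 1
    ext x
    simp
  · rw [← eLpNorm_neg, hd]
    congr 1
    ext x
    simp

/-- A function of class `H¹₀` with vanishing gradient is zero. -/
lemma MemH10.ae_eq_zero (hv : MemH10 (annulus R) v)
    (h : ∀ i, weakPartial (annulus R) i v =ᵐ[volume.restrict (annulus R)] 0) :
    v =ᵐ[volume.restrict (annulus R)] 0 := by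
  obtain ⟨C, hC, hS⟩ := exists_eLpNorm_four_le R
  have := hS v hv
  simp only [eLpNorm_congr_ae (h _), eLpNorm_zero, Finset.sum_const_zero, mul_zero,
    nonpos_iff_eq_zero] at this
  exact (eLpNorm_eq_zero_iff hv.1.1.1 (by norm_num)).1 this

end

section

/-! ### Functions with vanishing weak gradient -/

variable {R : ℝ} {Ω : Set Plane} {i : Fin 2} {u v w p q φ : Plane → ℝ}

/-- The mollifications of a function with vanishing weak gradient have vanishing gradient. -/
lemma hasFDerivAt_convolution_eq_zero (hΩ : IsOpen Ω) (hq : IntegrableOn q Ω)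
    (h : ∀ i, HasWeakPartial Ω i q 0) (b : ContDiffBump (0 : Plane)) {x : Plane}
    (hx : Metric.closedBall x b.rOut ⊆ Ω) :
    HasFDerivAt (convolution (b.normed volume) (Ω.indicator q)
      (ContinuousLinearMap.lsmul ℝ ℝ (E := ℝ)) volume) (0 : Plane →L[ℝ] ℝ) x := by
  set L := (ContinuousLinearMap.lsmul ℝ ℝ (E := ℝ)).flip with hL
  have hql : LocallyIntegrable (Ω.indicator q) :=
    ((integrable_indicator_iff hΩ.measurableSet).2 hq).locallyIntegrable
  have hφ1 : ContDiff ℝ (⊤ : ℕ∞) (b.normed volume) := b.contDiff_normed (n := ⊤)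
  have hφ11 : ContDiff ℝ 1 (b.normed volume) := hφ1.of_le (by exact_mod_cast le_top)
  have hφc : HasCompactSupport (b.normed volume) := b.hasCompactSupport_normed
  have key := hφc.hasFDerivAt_convolution_right L hql hφ11 x
  rw [← convolution_flip, ← hL]
  convert! key using 1
  symm
  have hpart : ∀ i, (convolution (Ω.indicator q) (fderiv ℝ (b.normed volume)) (L.precompR Plane)
      volume x) (EuclideanSpace.single i 1) = 0 := by
    intro i
    rw [convolution_precompR_apply L hql (hφc.fderiv ℝ) (hφ11.continuous_fderiv one_ne_zero)]
    set ψ : Plane → ℝ := fun t => b.normed volume (x - t) with hψ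
    have hψs : tsupport ψ ⊆ Metric.closedBall x b.rOut := by
      refine closure_minimal (fun t ht => ?_) Metric.isClosed_closedBall
      have : x - t ∈ Function.support (b.normed volume) := ht
      rw [b.support_normed_eq, mem_ball_zero_iff] at this
      rw [Metric.mem_closedBall, dist_comm, dist_eq_norm]
      exact this.le
    have hψt : IsTestFunction Ω ψ :=
      ⟨hφ1.comp (contDiff_const.sub contDiff_id),
        (isCompact_closedBall x b.rOut).of_isClosed_subset (isClosed_tsupport _) hψs,
        hψs.trans hx⟩
    have hd : ∀ t, partialDeriv i ψ t = -fderiv ℝ (b.normed volume) (x - t)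
        (EuclideanSpace.single i 1) := by
      intro t
      have h1 : HasFDerivAt (fun t : Plane => x - t) (-ContinuousLinearMap.id ℝ Plane) t :=
        (hasFDerivAt_id t).const_sub x
      have h2 := ((hφ11.differentiable one_ne_zero (x - t)).hasFDerivAt.comp t h1).fderiv
      rw [partialDeriv, hψ]
      rw [show (fun t => b.normed volume (x - t)) = b.normed volume ∘ fun t => x - t from rfl, h2]
      simp
    have e := (h i).2.2 ψ hψt
    simp only [Pi.zero_apply, zero_mul, integral_zero, neg_zero] at e
    rw [convolution_def, ← neg_eq_zero, ← integral_neg, ← e, ← integral_indicator hΩ.measurableSet]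
    refine integral_congr_ae (ae_of_all _ fun t => ?_)
    by_cases ht : t ∈ Ω
    · simp [L, ht, hd, mul_comm]
    · simp [L, ht]
  ext y
  have e : y = y 0 • EuclideanSpace.single (0 : Fin 2) (1 : ℝ) +
      y 1 • EuclideanSpace.single (1 : Fin 2) (1 : ℝ) := by
    ext i
    fin_cases i <;> simp
  rw [e, map_add, map_smul, map_smul, hpart, hpart]
  simp

/-- Near `x` all mollifications of small radius are constant, and they converge a.e. to `q`. -/
lemma exists_ae_eq_const_near (hΩ : IsOpen Ω) (hq : IntegrableOn q Ω)
    (h : ∀ i, HasWeakPartial Ω i q 0) {x : Plane} (hx : x ∈ Ω) :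
    ∃ c : ℝ, ∃ r > 0, ∀ᵐ y, y ∈ Metric.ball x r → q y = c := by
  obtain ⟨s, hs, hsΩ⟩ := Metric.isOpen_iff.1 hΩ x hx
  set r := s / 3 with hr
  have hr0 : 0 < r := by positivity
  have hql : LocallyIntegrable (Ω.indicator q) :=
    ((integrable_indicator_iff hΩ.measurableSet).2 hq).locallyIntegrable
  let b : ℕ → ContDiffBump (0 : Plane) := fun n =>
    ⟨r / (n + 1) / 2, r / (n + 1), by positivity, by
      have : 0 < r / ((n : ℝ) + 1) := by positivity
      linarith⟩
  have hb : Tendsto (fun n => (b n).rOut) atTop (𝓝 0) :=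
    tendsto_const_div_atTop_nhds_zero_nat r |>.comp (tendsto_add_atTop_nat 1) |>.congr fun n => by
      simp [b]
  have hbr : ∀ n, (b n).rOut ≤ r := fun n => div_le_self hr0.le (by simp)
  have hconv := ContDiffBump.ae_convolution_tendsto_right_of_locallyIntegrable (μ := volume)
    (K := 2) hb (Eventually.of_forall fun n => by
      change r / (n + 1) ≤ 2 * (r / (n + 1) / 2)
      linarith) hql
  have hconst : ∀ n, ∀ y ∈ Metric.ball x r, ∀ z ∈ Metric.ball x r,
      convolution ((b n).normed volume) (Ω.indicator q)
        (ContinuousLinearMap.lsmul ℝ ℝ (E := ℝ)) volume y =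
      convolution ((b n).normed volume) (Ω.indicator q)
        (ContinuousLinearMap.lsmul ℝ ℝ (E := ℝ)) volume z := by
    intro n y hy z hz
    have hd : ∀ t ∈ Metric.ball x r, HasFDerivAt (convolution ((b n).normed volume)
        (Ω.indicator q) (ContinuousLinearMap.lsmul ℝ ℝ (E := ℝ)) volume)
        (0 : Plane →L[ℝ] ℝ) t := by
      intro t ht
      refine hasFDerivAt_convolution_eq_zero hΩ hq h (b n) fun a ha => hsΩ ?_
      rw [Metric.mem_ball] at ht ⊢
      rw [Metric.mem_closedBall] at ha
      have := dist_triangle a t x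
      have := hbr n
      linarith
    refine (convex_ball x r).is_const_of_fderivWithin_eq_zero (𝕜 := ℝ)
      (fun t ht => (hd t ht).differentiableAt.differentiableWithinAt) (fun t ht => ?_) hy hz
    rw [fderivWithin_of_isOpen Metric.isOpen_ball ht, (hd t ht).fderiv]
  obtain ⟨z, hz, hzt⟩ : ∃ z ∈ Metric.ball x r, Tendsto (fun n =>
      convolution ((b n).normed volume) (Ω.indicator q)
        (ContinuousLinearMap.lsmul ℝ ℝ (E := ℝ)) volume z) atTop (𝓝 (Ω.indicator q z)) := by
    by_contra hn
    push Not at hn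
    have h0 : volume (Metric.ball x r) = 0 := measure_mono_null (fun z hz => hn z hz) hconv
    exact (Metric.measure_ball_pos volume x hr0).ne' h0
  refine ⟨Ω.indicator q z, r, hr0, ?_⟩
  filter_upwards [hconv] with y hy hyb
  have hyΩ : y ∈ Ω := hsΩ (Metric.ball_subset_ball (by linarith) hyb)
  have := tendsto_nhds_unique (hy.congr fun n => hconst n y hyb z hz) hzt
  rwa [indicator_of_mem hyΩ] at this

/-- On a connected open set a function with vanishing weak gradient is a.e. constant. -/
lemma exists_ae_eq_const (hΩ : IsOpen Ω) (hc : IsPreconnected Ω) (hq : IntegrableOn q Ω)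
    (h : ∀ i, HasWeakPartial Ω i q 0) : ∃ c : ℝ, ∀ᵐ x ∂volume.restrict Ω, q x = c := by
  rcases Ω.eq_empty_or_nonempty with rfl | ⟨x₀, hx₀⟩
  · simp
  have hloc : ∀ x, ∃ c : ℝ, x ∈ Ω → ∃ r > 0, ∀ᵐ y, y ∈ Metric.ball x r → q y = c := by
    intro x
    by_cases hx : x ∈ Ω
    · obtain ⟨c, hcx⟩ := exists_ae_eq_const_near hΩ hq h hx
      exact ⟨c, fun _ => hcx⟩
    · exact ⟨0, fun h => (hx h).elim⟩
  choose c hcr using hloc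
  -- overlapping balls carry the same constant
  have hcc : ∀ x ∈ Ω, c x = c x₀ := by
    intro x hx
    refine hc.induction₂ (fun x y => c x = c y) (fun x hx => ?_) (fun _ _ _ _ _ _ => Eq.trans)
      (fun _ _ _ _ => Eq.symm) hx hx₀
    obtain ⟨r, hr, hxr⟩ := hcr x hx
    filter_upwards [mem_nhdsWithin_of_mem_nhds (Metric.ball_mem_nhds x hr), self_mem_nhdsWithin]
      with y hy hyΩ
    obtain ⟨s, hs, hys⟩ := hcr y hyΩ
    by_contra hne
    have h0 : volume (Metric.ball x r ∩ Metric.ball y s) = 0 := by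
      refine measure_mono_null (fun z hz => ?_) (hxr.and hys)
      exact fun hh => hne ((hh.1 hz.1).symm.trans (hh.2 hz.2))
    exact ((Metric.isOpen_ball.inter Metric.isOpen_ball).measure_pos volume
      ⟨y, hy, Metric.mem_ball_self hs⟩).ne' h0
  refine ⟨c x₀, ?_⟩
  rw [ae_restrict_iff' hΩ.measurableSet]
  have hnull : volume {x | x ∈ Ω ∧ q x ≠ c x₀} = 0 := by
    refine measure_null_of_locally_null _ fun x hx => ?_
    obtain ⟨r, hr, hxr⟩ := hcr x hx.1
    refine ⟨Metric.ball x r ∩ {x | x ∈ Ω ∧ q x ≠ c x₀},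
      inter_mem (mem_nhdsWithin_of_mem_nhds (Metric.ball_mem_nhds x hr)) self_mem_nhdsWithin, ?_⟩
    refine measure_mono_null (fun z hz => ?_) hxr
    change ¬(z ∈ Metric.ball x r → q z = c x)
    exact fun hh => hz.2.2 ((hh hz.1).trans (hcc x hx.1))
  refine measure_mono_null (fun x hx => ?_) hnull
  simpa using hx

lemma isPreconnected_annulus : IsPreconnected (annulus R) := by
  have e : annulus R = (fun p : ℝ × ℝ => circlePoint p.1 p.2) '' (Ioo 1 R ×ˢ univ) := by
    ext x
    constructor
    · intro hx
      obtain ⟨θ, hθ⟩ := exists_eq_circlePoint x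
      exact ⟨(‖x‖, θ), ⟨mem_annulus.1 hx, mem_univ _⟩, hθ.symm⟩
    · rintro ⟨p, hp, rfl⟩
      exact circlePoint_mem_annulus hp.1
  rw [e]
  exact (isPreconnected_Ioo.prod isPreconnected_univ).image _ continuous_circlePoint.continuousOn

lemma MemH1.exists_ae_eq_add_const (hp : MemH1 (annulus R) p) (hq : MemH1 (annulus R) q)
    (h : ∀ i, weakPartial (annulus R) i p =ᵐ[volume.restrict (annulus R)]
      weakPartial (annulus R) i q) :
    ∃ c : ℝ, p =ᵐ[volume.restrict (annulus R)] fun x => q x + c := by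
  obtain ⟨c, hc⟩ := exists_ae_eq_const (q := fun x => p x - q x) isOpen_annulus
    isPreconnected_annulus ((MemLp.sub hp.1 hq.1).integrable (by norm_num)) fun i => by
      refine (hp.hasWeakPartial.sub hq.hasWeakPartial).congr_right ?_
      filter_upwards [h i] with x hx
      simp [hx]
  refine ⟨c, ?_⟩
  filter_upwards [hc] with x hx
  linarith

/-! ### Strong solutions are weak solutions -/

lemma integral_fin_two {f : Fin 2 → Plane → ℝ} (h : ∀ i, IntegrableOn (f i) Ω) :
    ∫ x in Ω, ∑ i, f i x = ∑ i, ∫ x in Ω, f i x :=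
  integral_finsetSum _ fun i _ => h i

lemma IsStrongSolution.isWeakSolution {ω : ℝ} {f u : Plane → Plane} {p : Plane → ℝ}
    (hf : MemL2 (annulus R) f) (h : IsStrongSolution R ω f u p) : IsWeakSolution R ω f u := by
  have hΩ := isOpen_annulus (R := R)
  refine ⟨⟨fun i => (h.velocity_memH2 i).1, h.inner_boundary, h.div_free⟩, h.outer_boundary,
    fun φ hφ => ?_⟩
  set Ω := annulus R
  have hu1 : ∀ i j, MemH1 Ω (weakPartial Ω j (comp u i)) := fun i j => (h.velocity_memH2 i).2 j
  have hu2 : ∀ i j, MemL2 Ω (weakPartial Ω j (weakPartial Ω j (comp u i))) := fun i j =>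
    (hu1 i j).memL2_weakPartial hΩ
  have hφ0 : ∀ i, MemL2 Ω (comp φ i) := fun i => (hφ.1 i).1.1
  have hφ1 : ∀ i j, MemL2 Ω (weakPartial Ω j (comp φ i)) := fun i j =>
    (hφ.1 i).1.memL2_weakPartial hΩ
  have hp1 : ∀ i, MemL2 Ω (weakPartial Ω i p) := fun i => h.pressure_memH1.memL2_weakPartial hΩ
  have hf' : ∀ i, MemL2 Ω (comp f i) := fun i => MemL2.comp hf i
  have I1 : ∀ i j, IntegrableOn (fun x => weakPartial Ω j (comp u i) x *
      weakPartial Ω j (comp φ i) x) Ω := fun i j => MemLp.integrable_mul (hu1 i j).1 (hφ1 i j)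
  have I2 : ∀ i j, IntegrableOn (fun x => weakPartial Ω j (weakPartial Ω j (comp u i)) x *
      comp φ i x) Ω := fun i j => MemLp.integrable_mul (hu2 i j) (hφ0 i)
  have I3 : ∀ i, IntegrableOn (fun x => weakPartial Ω i p x * comp φ i x) Ω := fun i =>
    MemLp.integrable_mul (hp1 i) (hφ0 i)
  have I4 : ∀ i, IntegrableOn (fun x => comp f i x * comp φ i x) Ω := fun i =>
    MemLp.integrable_mul (hf' i) (hφ0 i)
  have I5 : ∀ i, IntegrableOn (fun x => p x * weakPartial Ω i (comp φ i) x) Ω := fun i =>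
    MemLp.integrable_mul h.pressure_memH1.1 (hφ1 i i)
  have e1 : ∀ i j, ∫ x in Ω, weakPartial Ω j (comp u i) x * weakPartial Ω j (comp φ i) x =
      -∫ x in Ω, weakPartial Ω j (weakPartial Ω j (comp u i)) x * comp φ i x := fun i j =>
    integral_mul_weakPartial hΩ (hu1 i j).1 (hu1 i j).hasWeakPartial (hu2 i j) (hφ.1 i)
  have e2 : ∀ i, ∫ x in Ω, p x * weakPartial Ω i (comp φ i) x =
      -∫ x in Ω, weakPartial Ω i p x * comp φ i x := fun i =>
    integral_mul_weakPartial hΩ h.pressure_memH1.1 h.pressure_memH1.hasWeakPartial (hp1 i)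
      (hφ.1 i)
  have e3 : ∑ i, ∫ x in Ω, p x * weakPartial Ω i (comp φ i) x = 0 := by
    rw [← integral_fin_two I5]
    refine integral_eq_zero_of_ae ?_
    filter_upwards [hφ.2] with x hx
    simp only [weakDiv] at hx
    rw [← Finset.mul_sum, hx, mul_zero]
    rfl
  have e4 : ∫ x in Ω, ∑ i, convection Ω u i x * φ x i =
      ∫ x in Ω, ∑ i, (comp f i x * comp φ i x +
        ∑ j, weakPartial Ω j (weakPartial Ω j (comp u i)) x * comp φ i x -
          weakPartial Ω i p x * comp φ i x) := by
    refine integral_congr_ae ?_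
    filter_upwards [h.momentum] with x hx
    refine Finset.sum_congr rfl fun i _ => ?_
    rw [show convection Ω u i x = f x i + weakLaplacian Ω u i x - weakPartial Ω i p x by
      linarith [hx i], weakLaplacian, ← Finset.sum_mul]
    simp only [comp]
    ring
  have I6 : ∀ i, IntegrableOn
      (fun x => ∑ j, weakPartial Ω j (weakPartial Ω j (comp u i)) x * comp φ i x) Ω := fun i =>
    integrable_finsetSum _ fun j _ => I2 i j
  have I7 : ∀ i, IntegrableOn (fun x => ∑ j, weakPartial Ω j (comp u i) x *
      weakPartial Ω j (comp φ i) x) Ω := fun i => integrable_finsetSum _ fun j _ => I1 i j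
  have I8 : ∀ i, IntegrableOn (fun x => comp f i x * comp φ i x +
      ∑ j, weakPartial Ω j (weakPartial Ω j (comp u i)) x * comp φ i x) Ω := fun i =>
    (I4 i).add (I6 i)
  have I9 : ∀ i, IntegrableOn (fun x => comp f i x * comp φ i x +
      ∑ j, weakPartial Ω j (weakPartial Ω j (comp u i)) x * comp φ i x -
        weakPartial Ω i p x * comp φ i x) Ω := fun i => (I8 i).sub (I3 i)
  have e5 : ∀ i, ∫ x in Ω, (comp f i x * comp φ i x +
        ∑ j, weakPartial Ω j (weakPartial Ω j (comp u i)) x * comp φ i x -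
          weakPartial Ω i p x * comp φ i x) = (∫ x in Ω, comp f i x * comp φ i x) +
        (∑ j, ∫ x in Ω, weakPartial Ω j (weakPartial Ω j (comp u i)) x * comp φ i x) -
          ∫ x in Ω, weakPartial Ω i p x * comp φ i x := fun i => by
    rw [integral_sub (I8 i) (I3 i), integral_add (I4 i) (I6 i),
      integral_fin_two (I2 i)]
  have e6 : ∫ x in Ω, ∑ i, f x i * φ x i = ∑ i, ∫ x in Ω, comp f i x * comp φ i x :=
    integral_fin_two I4
  rw [e4, integral_fin_two I9, e6, integral_fin_two I7]
  have e7 : ∀ i, ∫ x in Ω, ∑ j, weakPartial Ω j (comp u i) x * weakPartial Ω j (comp φ i) x =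
      ∑ j, -∫ x in Ω, weakPartial Ω j (weakPartial Ω j (comp u i)) x * comp φ i x := fun i => by
    rw [integral_fin_two (I1 i)]
    exact Finset.sum_congr rfl fun j _ => e1 i j
  simp only [e5, e7]
  simp only [e2] at e3
  simp only [Fin.sum_univ_two] at e3 ⊢
  linarith

end

section

/-! ### The angular velocity profile -/

variable {R ω : ℝ} {i j : Fin 2} {fρ fθ : ℝ → ℝ}

lemma MemLp.mul_continuousOn_Icc {k b : ℝ → ℝ} {p : ℝ≥0∞} (hk : MemLp k p (volume.restrict (Ioo 1 R)))
    (hb : ContinuousOn b (Icc 1 R)) : MemLp (fun t => k t * b t) p (volume.restrict (Ioo 1 R)) := by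
  obtain ⟨C, hC⟩ := isCompact_Icc.exists_bound_of_continuousOn hb
  refine MemLp.mul_bdd hk ((hb.mono Ioo_subset_Icc_self).aestronglyMeasurable measurableSet_Ioo)
    (C := C) ?_
  filter_upwards [ae_restrict_mem measurableSet_Ioo] with t ht
  exact hC t (Ioo_subset_Icc_self ht)

lemma integrableOn_of_memLp_two {k : ℝ → ℝ} (hk : MemLp k 2 (volume.restrict (Ioo 1 R))) :
    IntegrableOn k (Ioo 1 R) := hk.integrable (by norm_num)

lemma memLp_of_continuousOn_Icc {b : ℝ → ℝ} {p : ℝ≥0∞} (hb : ContinuousOn b (Icc 1 R)) :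
    MemLp b p (volume.restrict (Ioo 1 R)) := by
  obtain ⟨C, hC⟩ := isCompact_Icc.exists_bound_of_continuousOn hb
  refine MemLp.of_bound
    ((hb.mono Ioo_subset_Icc_self).aestronglyMeasurable measurableSet_Ioo) C ?_
  filter_upwards [ae_restrict_mem measurableSet_Ioo] with t ht
  exact hC t (Ioo_subset_Icc_self ht)

/-- The moment `∫₁^ρ t² fθ(t) dt`. -/
def secondMoment (fθ : ℝ → ℝ) (ρ : ℝ) : ℝ := ∫ t in (1 : ℝ)..ρ, t ^ 2 * fθ t

lemma memLp_sq_mul (hf : MemLp fθ 2 (volume.restrict (Ioo 1 R))) :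
    MemLp (fun t => t ^ 2 * fθ t) 2 (volume.restrict (Ioo 1 R)) := by
  have := MemLp.mul_continuousOn_Icc (b := fun t => t ^ 2) hf (by fun_prop)
  simpa [mul_comm] using this

lemma continuousOn_secondMoment (hf : MemLp fθ 2 (volume.restrict (Ioo 1 R))) :
    ContinuousOn (secondMoment fθ) (Icc 1 R) :=
  continuousOn_primitive_of_integrableOn (integrableOn_of_memLp_two (memLp_sq_mul hf))

/-- The derivative of the angular speed `V(ρ) / ρ`. It is continuous, since `fθ` enters only through
its second moment. -/
def speedDeriv (R ω : ℝ) (fθ : ℝ → ℝ) (t : ℝ) : ℝ :=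
  (2 * constA R ω fθ - secondMoment fθ t) / t ^ 3

/-- The angular speed `V(ρ) / ρ`, written as a primitive. -/
def speed (R ω : ℝ) (fθ : ℝ → ℝ) (ρ : ℝ) : ℝ := ∫ t in (1 : ℝ)..ρ, speedDeriv R ω fθ t

lemma continuousOn_speedDeriv (hf : MemLp fθ 2 (volume.restrict (Ioo 1 R))) :
    ContinuousOn (speedDeriv R ω fθ) (Icc 1 R) := by
  refine ContinuousOn.div (continuousOn_const.sub (continuousOn_secondMoment hf)) (by fun_prop) ?_
  intro t ht
  exact pow_ne_zero _ (by linarith [ht.1])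

lemma hasDerivAt_neg_half_inv_sq {t : ℝ} (ht : t ≠ 0) :
    HasDerivAt (fun t : ℝ => -(1 / 2) * (t ^ 2)⁻¹) (1 / t ^ 3) t := by
  have := ((hasDerivAt_pow 2 t).inv (pow_ne_zero 2 ht)).const_mul (-(1 / 2))
  convert! this using 1
  field_simp
  norm_num
  ring

/-- Integration by parts with the moment `∫₁^ρ t² fθ(t) dt`. -/
lemma integral_secondMoment_div (hf : MemLp fθ 2 (volume.restrict (Ioo 1 R))) {ρ : ℝ}
    (hρ : ρ ∈ Icc 1 R) :
    ∫ t in (1 : ℝ)..ρ, secondMoment fθ t / t ^ 3 =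
      -(1 / (2 * ρ ^ 2)) * secondMoment fθ ρ + 1 / 2 * ∫ t in (1 : ℝ)..ρ, fθ t := by
  have hpos : ∀ t ∈ uIcc 1 ρ, t ≠ 0 := fun t ht => by
    rw [uIcc_of_le hρ.1] at ht
    linarith [ht.1]
  have hI : IntervalIntegrable (fun t => t ^ 2 * fθ t) volume 1 ρ :=
    intervalIntegrable_of_mem (integrableOn_of_memLp_two (memLp_sq_mul hf)) hρ
  have hI0 : IntervalIntegrable fθ volume 1 ρ :=
    intervalIntegrable_of_mem (integrableOn_of_memLp_two hf) hρ
  have hinv : ContinuousOn (fun t : ℝ => 1 / t ^ 3) (uIcc 1 ρ) :=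
    ContinuousOn.div continuousOn_const (by fun_prop) fun t ht => pow_ne_zero 3 (hpos t ht)
  have hJ : IntervalIntegrable (fun t : ℝ => 1 / t ^ 3) volume 1 ρ := hinv.intervalIntegrable
  have ac1 : AbsolutelyContinuousOnInterval (secondMoment fθ) 1 ρ :=
    hI.absolutelyContinuousOnInterval_intervalIntegral (c := 1) (by simp)
  have ac2 : AbsolutelyContinuousOnInterval (fun x => ∫ t in (1 : ℝ)..x, 1 / t ^ 3) 1 ρ :=
    hJ.absolutelyContinuousOnInterval_intervalIntegral (c := 1) (by simp)
  have hprim : ∀ x ∈ uIcc 1 ρ, ∫ t in (1 : ℝ)..x, 1 / t ^ 3 =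
      -(1 / 2) * (x ^ 2)⁻¹ + 1 / 2 := by
    intro x hx
    rw [intervalIntegral.integral_eq_sub_of_hasDerivAt
      (fun t ht => hasDerivAt_neg_half_inv_sq (hpos t (uIcc_subset_uIcc_left hx ht)))
      (hJ.mono_set (uIcc_subset_uIcc_left hx))]
    norm_num
  have key := ac1.integral_deriv_mul_eq_sub ac2
  have e : ∫ x in (1 : ℝ)..ρ, (deriv (secondMoment fθ) x * (∫ t in (1 : ℝ)..x, 1 / t ^ 3) +
      secondMoment fθ x * deriv (fun x => ∫ t in (1 : ℝ)..x, 1 / t ^ 3) x) =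
      ∫ x in (1 : ℝ)..ρ, ((1 / 2 * (x ^ 2 * fθ x) - 1 / 2 * fθ x) +
        secondMoment fθ x / x ^ 3) := by
    refine intervalIntegral.integral_congr_ae ?_
    filter_upwards [hI.ae_hasDerivAt_integral, hJ.ae_hasDerivAt_integral] with x h1 h2 hx
    have hx' : x ∈ uIcc 1 ρ := uIoc_subset_uIcc hx
    have hx0 := hpos x hx'
    rw [show deriv (secondMoment fθ) x = x ^ 2 * fθ x from (h1 hx' 1 (by simp)).deriv,
      (h2 hx' 1 (by simp)).deriv, hprim x hx']
    field_simp
    ring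
  have hsm : IntervalIntegrable (fun t => secondMoment fθ t / t ^ 3) volume 1 ρ := by
    refine ContinuousOn.intervalIntegrable (ContinuousOn.div ?_ (by fun_prop)
      fun t ht => pow_ne_zero 3 (hpos t ht))
    rw [uIcc_of_le hρ.1]
    exact (continuousOn_secondMoment hf).mono (Icc_subset_Icc_right hρ.2)
  rw [e, intervalIntegral.integral_add ((hI.const_mul _).sub (hI0.const_mul _)) hsm,
    intervalIntegral.integral_sub (hI.const_mul _) (hI0.const_mul _),
    intervalIntegral.integral_const_mul, intervalIntegral.integral_const_mul,
    hprim ρ right_mem_uIcc] at key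
  rw [intervalIntegral.integral_same, mul_zero, sub_zero] at key
  have hs : ∫ x in (1 : ℝ)..ρ, x ^ 2 * fθ x = secondMoment fθ ρ := rfl
  rw [hs] at key
  have hρ0 : ρ ≠ 0 := by linarith [hρ.1]
  have e2 : 1 / (2 * ρ ^ 2) = 1 / 2 * (ρ ^ 2)⁻¹ := by field_simp
  rw [e2]
  linarith

/-- The angular speed `V / ρ` vanishes at `ρ = 1` and is continuously differentiable although `fθ` is
merely square integrable. -/
lemma vProfile_eq (hf : MemLp fθ 2 (volume.restrict (Ioo 1 R))) {ρ : ℝ} (hρ : ρ ∈ Icc 1 R) :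
    vProfile R ω fθ ρ = ρ * speed R ω fθ ρ := by
  have hρ0 : ρ ≠ 0 := by linarith [hρ.1]
  have hpos : ∀ t ∈ uIcc 1 ρ, t ≠ 0 := fun t ht => by
    rw [uIcc_of_le hρ.1] at ht
    linarith [ht.1]
  have hJ : IntervalIntegrable (fun t : ℝ => 1 / t ^ 3) volume 1 ρ :=
    (ContinuousOn.div continuousOn_const (by fun_prop)
      fun t ht => pow_ne_zero 3 (hpos t ht)).intervalIntegrable
  have hsm : IntervalIntegrable (fun t => secondMoment fθ t / t ^ 3) volume 1 ρ := by
    refine ContinuousOn.intervalIntegrable (ContinuousOn.div ?_ (by fun_prop)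
      fun t ht => pow_ne_zero 3 (hpos t ht))
    rw [uIcc_of_le hρ.1]
    exact (continuousOn_secondMoment hf).mono (Icc_subset_Icc_right hρ.2)
  have e : speed R ω fθ ρ = 2 * constA R ω fθ * (∫ t in (1 : ℝ)..ρ, 1 / t ^ 3) -
      ∫ t in (1 : ℝ)..ρ, secondMoment fθ t / t ^ 3 := by
    rw [speed, ← intervalIntegral.integral_const_mul, ← intervalIntegral.integral_sub
      (hJ.const_mul _) hsm]
    refine intervalIntegral.integral_congr fun t _ => ?_
    simp only [speedDeriv]
    ring
  have e2 : ∫ t in (1 : ℝ)..ρ, 1 / t ^ 3 = -(1 / 2) * (ρ ^ 2)⁻¹ + 1 / 2 := by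
    rw [intervalIntegral.integral_eq_sub_of_hasDerivAt
      (fun t ht => hasDerivAt_neg_half_inv_sq (hpos t ht)) hJ]
    norm_num
  rw [e, e2, integral_secondMoment_div hf hρ, vProfile, secondMoment]
  field_simp
  ring

lemma vProfile_R (hR : 1 < R) : vProfile R ω fθ R = ω := by
  have h1 : R ^ 2 - 1 ≠ 0 := by nlinarith
  have h0 : R ≠ 0 := by linarith
  rw [vProfile, constA]
  field_simp
  ring

/-! ### Weak derivatives of radial profiles -/

/-- The function `x ↦ H |x|` has the weak gradient `k |x| x` on the annulus. -/
def HasRadialGradient (R : ℝ) (H k : ℝ → ℝ) : Prop :=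
  ∀ j, HasWeakPartial (annulus R) j (fun x => H ‖x‖) fun x => k ‖x‖ * x j

lemma hasRadialGradient_primitive {k : ℝ → ℝ} (hk : IntegrableOn k (Ioo 1 R)) :
    HasRadialGradient R (fun ρ => ∫ t in (1 : ℝ)..ρ, k t) fun t => k t / t := fun j =>
  (hasWeakPartial_primitive_norm (i := j) hk).congr_right (ae_of_all _ fun x => by
    simp only
    ring)

lemma partialDeriv_apply (k : Fin 2) (x : Plane) :
    partialDeriv j (fun x : Plane => x k) x = if j = k then 1 else 0 := by
  have : (fun x : Plane => x k) = EuclideanSpace.proj (𝕜 := ℝ) k := rfl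
  rw [partialDeriv, this, ContinuousLinearMap.fderiv]
  simp [eq_comm]

lemma contDiff_apply_plane {n : WithTop ℕ∞} (k : Fin 2) : ContDiff ℝ n fun x : Plane => x k :=
  (EuclideanSpace.proj (𝕜 := ℝ) k).contDiff

/-- The coefficients of the linear field `x ↦ (-x₁, x₀)`. -/
def perpCoeff : Fin 2 → Fin 2 → ℝ := ![![0, -1], ![1, 0]]

/-- The components of the linear field `x ↦ (-x₁, x₀)`. -/
def perp (i : Fin 2) (x : Plane) : ℝ := perpCoeff i 0 * x 0 + perpCoeff i 1 * x 1

@[simp] lemma perp_zero (x : Plane) : perp 0 x = -x 1 := by simp [perp, perpCoeff]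
@[simp] lemma perp_one (x : Plane) : perp 1 x = x 0 := by simp [perp, perpCoeff]

lemma contDiff_perp {n : WithTop ℕ∞} : ContDiff ℝ n (perp i) :=
  (contDiff_const.mul (contDiff_apply_plane 0)).add (contDiff_const.mul (contDiff_apply_plane 1))

lemma partialDeriv_perp (x : Plane) : partialDeriv j (perp i) x = perpCoeff i j := by
  have h : ∀ k, DifferentiableAt ℝ (fun x : Plane => x k) x := fun k =>
    (contDiff_apply_plane (n := 1) k).differentiable one_ne_zero x
  have e : perp i = fun x => perpCoeff i 0 * x 0 + perpCoeff i 1 * x 1 := rfl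
  have p : ∀ k, fderiv ℝ (fun x : Plane => x k) x (EuclideanSpace.single j 1) =
      if j = k then 1 else 0 := fun k => partialDeriv_apply k x
  rw [partialDeriv, e, fderiv_fun_add ((h 0).const_mul _) ((h 1).const_mul _),
    fderiv_const_mul (h 0), fderiv_const_mul (h 1)]
  simp only [add_apply, smul_apply, p, smul_eq_mul]
  fin_cases j <;> simp

lemma thetaHat_apply (x : Plane) : thetaHat x i = perp i x / ‖x‖ := by
  fin_cases i <;> simp

/-- Multiplication with a continuous function of the plane preserves `L²` of the annulus. -/
lemma MemL2.mul_continuous {q P : Plane → ℝ} (hq : MemL2 (annulus R) q) (hP : Continuous P) :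
    MemL2 (annulus R) fun x => q x * P x := by
  obtain ⟨C, hC⟩ := (isCompact_closedBall (0 : Plane) R).exists_bound_of_continuousOn
    hP.continuousOn
  refine MemLp.mul_bdd hq hP.aestronglyMeasurable (C := C) ?_
  filter_upwards [ae_restrict_mem isOpen_annulus.measurableSet] with x hx
  exact hC x (mem_closedBall_zero_iff.2 (mem_annulus.1 hx).2.le)

lemma HasRadialGradient.mul_smooth {H k : ℝ → ℝ} (h : HasRadialGradient R H k) {P : Plane → ℝ}
    (hP : ContDiff ℝ (⊤ : ℕ∞) P) :
    HasWeakPartial (annulus R) j (fun x => H ‖x‖ * P x)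
      fun x => k ‖x‖ * x j * P x + H ‖x‖ * partialDeriv j P x :=
  (h j).mul_smooth isOpen_annulus hP.contDiffOn

/-- The coefficient `(V / ρ)' / ρ` in the gradient of the velocity. -/
def shearCoeff (R ω : ℝ) (fθ : ℝ → ℝ) (t : ℝ) : ℝ := speedDeriv R ω fθ t / t

/-- The radial derivative of `shearCoeff`, divided by the radius. It is merely square integrable. -/
def shearDeriv (R ω : ℝ) (fθ : ℝ → ℝ) (t : ℝ) : ℝ :=
  -(fθ t / t ^ 3) - 4 * shearCoeff R ω fθ t / t ^ 2

lemma continuousOn_shearCoeff (hf : MemLp fθ 2 (volume.restrict (Ioo 1 R))) :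
    ContinuousOn (shearCoeff R ω fθ) (Icc 1 R) :=
  (continuousOn_speedDeriv hf).div continuousOn_id fun t ht => by
    exact (zero_lt_one.trans_le ht.1).ne'

lemma hasRadialGradient_speed (hf : MemLp fθ 2 (volume.restrict (Ioo 1 R))) :
    HasRadialGradient R (speed R ω fθ) (shearCoeff R ω fθ) :=
  hasRadialGradient_primitive
    (integrableOn_of_memLp_two (memLp_of_continuousOn_Icc (continuousOn_speedDeriv hf)))

/-- This is where `fθ` itself enters the derivatives of the flow. The coefficient equals
`(2 A - ∫₁^ρ t² fθ) ρ⁻⁴`, the product of a primitive with a function smooth off the origin. -/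
lemma hasRadialGradient_shearCoeff (hf : MemLp fθ 2 (volume.restrict (Ioo 1 R))) :
    HasRadialGradient R (shearCoeff R ω fθ) (shearDeriv R ω fθ) := by
  intro j
  have hΩ := isOpen_annulus (R := R)
  have h1 := hasWeakPartial_primitive_norm (i := j)
    (integrableOn_of_memLp_two (memLp_sq_mul hf))
  have h2 : HasWeakPartial (annulus R) j (fun _ => 2 * constA R ω fθ) fun _ => 0 :=
    (hasWeakPartial_of_contDiffOn hΩ contDiffOn_const).congr_right (ae_of_all _ fun x => by
      simp [partialDeriv])
  have hz : ContDiffOn ℝ (⊤ : ℕ∞) (fun x : Plane => (‖x‖ ^ 4)⁻¹) (annulus R) := by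
    intro x hx
    have h0 := norm_ne_zero_of_mem_annulus hx
    exact (((contDiffAt_norm ℝ (norm_ne_zero_iff.1 h0)).pow 4).inv
      (pow_ne_zero 4 h0)).contDiffWithinAt
  have hm := (h2.sub h1).mul_smooth hΩ hz
  refine (hm.congr_left (ae_of_all _ fun x => ?_)).congr_right ?_
  · simp only [shearCoeff, speedDeriv, secondMoment]
    ring
  · filter_upwards [ae_restrict_mem hΩ.measurableSet] with x hx
    have h0 := norm_ne_zero_of_mem_annulus hx
    have hd : HasDerivAt (fun t : ℝ => (t ^ 4)⁻¹) (-(4 * ‖x‖ ^ 3) / (‖x‖ ^ 4) ^ 2) ‖x‖ := by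
      have := (hasDerivAt_pow 4 ‖x‖).inv (pow_ne_zero 4 h0)
      convert! this using 1
    rw [partialDeriv_comp_norm h0 hd]
    simp only [shearDeriv, shearCoeff, speedDeriv, secondMoment]
    field_simp
    ring

lemma memLp_shearDeriv (hf : MemLp fθ 2 (volume.restrict (Ioo 1 R))) :
    MemLp (shearDeriv R ω fθ) 2 (volume.restrict (Ioo 1 R)) := by
  have hne : ∀ t ∈ Icc 1 R, t ≠ 0 := fun t ht => by linarith [ht.1]
  have h1 := MemLp.mul_continuousOn_Icc (b := fun t => -(t ^ 3)⁻¹) hf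
    (ContinuousOn.neg (ContinuousOn.inv₀ (by fun_prop) fun t ht => pow_ne_zero 3 (hne t ht)))
  have h2 : MemLp (fun t => 4 * shearCoeff R ω fθ t / t ^ 2) 2 (volume.restrict (Ioo 1 R)) :=
    memLp_of_continuousOn_Icc ((continuousOn_const.mul (continuousOn_shearCoeff hf)).div
      (by fun_prop) fun t ht => pow_ne_zero 2 (hne t ht))
  have e : shearDeriv R ω fθ =
      fun t => fθ t * -(t ^ 3)⁻¹ - 4 * shearCoeff R ω fθ t / t ^ 2 := by
    ext t
    simp only [shearDeriv]
    ring
  rw [e]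
  exact MemLp.sub h1 h2

end

section

/-! ### The explicit flow solves the equations -/

variable {R ω : ℝ} {i j k : Fin 2} {fρ fθ : ℝ → ℝ}

lemma norm_mem_Icc_of_mem_annulus {x : Plane} (hx : x ∈ annulus R) : ‖x‖ ∈ Icc 1 R :=
  ⟨(mem_annulus.1 hx).1.le, (mem_annulus.1 hx).2.le⟩

lemma ae_annulus {P : Plane → Prop} (h : ∀ x ∈ annulus R, P x) :
    ∀ᵐ x ∂volume.restrict (annulus R), P x :=
  (ae_restrict_mem isOpen_annulus.measurableSet).mono h

/-- On the closed annulus `v_*` is the rotation field `x^⊥` times the angular speed. -/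
lemma comp_vStar_eq (hf : MemLp fθ 2 (volume.restrict (Ioo 1 R))) {x : Plane}
    (hx : ‖x‖ ∈ Icc 1 R) :
    comp (vStar R ω fθ) i x = speed R ω fθ ‖x‖ * perp i x := by
  have h0 : ‖x‖ ≠ 0 := (zero_lt_one.trans_le hx.1).ne'
  simp only [comp, vStar, PiLp.smul_apply, thetaHat_apply, vProfile_eq hf hx, smul_eq_mul]
  field_simp

/-- The entries of the velocity gradient of the explicit flow. -/
def gradVStar (R ω : ℝ) (fθ : ℝ → ℝ) (i j : Fin 2) (x : Plane) : ℝ :=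
  shearCoeff R ω fθ ‖x‖ * (x j * perp i x) + speed R ω fθ ‖x‖ * perpCoeff i j

lemma contDiff_apply_mul_perp : ContDiff ℝ (⊤ : ℕ∞) fun x : Plane => x j * perp i x :=
  (contDiff_apply_plane j).mul contDiff_perp

lemma partialDeriv_apply_mul_perp (x : Plane) :
    partialDeriv k (fun x : Plane => x j * perp i x) x =
      (if k = j then 1 else 0) * perp i x + x j * perpCoeff i k := by
  rw [partialDeriv_mul ((contDiff_apply_plane (n := 1) j).differentiable one_ne_zero x)
    ((contDiff_perp (n := 1)).differentiable one_ne_zero x), partialDeriv_apply, partialDeriv_perp]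

lemma hasWeakPartial_vStar (hf : MemLp fθ 2 (volume.restrict (Ioo 1 R))) :
    HasWeakPartial (annulus R) j (comp (vStar R ω fθ) i) (gradVStar R ω fθ i j) := by
  refine (((hasRadialGradient_speed (ω := ω) hf).mul_smooth (j := j)
    (contDiff_perp (i := i))).congr_left ?_).congr_right ?_
  · exact ae_annulus fun x hx => (comp_vStar_eq hf (norm_mem_Icc_of_mem_annulus hx)).symm
  · refine ae_of_all _ fun x => ?_
    simp only [gradVStar, partialDeriv_perp]
    ring

lemma continuousOn_speed (hf : MemLp fθ 2 (volume.restrict (Ioo 1 R))) :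
    ContinuousOn (speed R ω fθ) (Icc 1 R) :=
  continuousOn_primitive_of_integrableOn
    (integrableOn_of_memLp_two (memLp_of_continuousOn_Icc (continuousOn_speedDeriv hf)))

lemma memL2_gradVStar (hf : MemLp fθ 2 (volume.restrict (Ioo 1 R))) :
    MemL2 (annulus R) (gradVStar R ω fθ i j) :=
  MemLp.add (MemL2.mul_continuous (memL2_comp_norm_of_continuousOn (continuousOn_shearCoeff hf))
      contDiff_apply_mul_perp.continuous)
    (MemL2.mul_continuous (memL2_comp_norm_of_continuousOn (continuousOn_speed hf))
      continuous_const)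

/-- The second derivatives of the explicit flow. -/
def hessVStar (R ω : ℝ) (fθ : ℝ → ℝ) (i j k : Fin 2) (x : Plane) : ℝ :=
  shearDeriv R ω fθ ‖x‖ * (x k * (x j * perp i x)) +
    shearCoeff R ω fθ ‖x‖ * ((if k = j then 1 else 0) * perp i x + x j * perpCoeff i k) +
    shearCoeff R ω fθ ‖x‖ * (x k * perpCoeff i j)

lemma hasWeakPartial_gradVStar (hf : MemLp fθ 2 (volume.restrict (Ioo 1 R))) :
    HasWeakPartial (annulus R) k (gradVStar R ω fθ i j) (hessVStar R ω fθ i j k) := by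
  have h1 := (hasRadialGradient_shearCoeff (ω := ω) hf).mul_smooth (j := k)
    (contDiff_apply_mul_perp (i := i) (j := j))
  have h2 := (hasRadialGradient_speed (ω := ω) hf).mul_smooth (j := k)
    (contDiff_const (c := perpCoeff i j))
  refine (h1.add h2).congr_right (ae_of_all _ fun x => ?_)
  have h0 : partialDeriv k (fun _ => perpCoeff i j) x = 0 := by simp [partialDeriv]
  simp only [hessVStar, partialDeriv_apply_mul_perp, h0]
  ring

lemma memL2_hessVStar (hf : MemLp fθ 2 (volume.restrict (Ioo 1 R))) :
    MemL2 (annulus R) (hessVStar R ω fθ i j k) := by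
  have hp := contDiff_perp (n := 1) (i := i) |>.continuous
  have hj := contDiff_apply_plane (n := 1) j |>.continuous
  have hk := contDiff_apply_plane (n := 1) k |>.continuous
  have hs := memL2_comp_norm_of_continuousOn (continuousOn_shearCoeff (ω := ω) hf)
  exact MemLp.add (MemLp.add (MemL2.mul_continuous (MemLp.comp_norm (memLp_shearDeriv hf))
    (hk.mul (hj.mul hp))) (MemL2.mul_continuous hs ((continuous_const.mul hp).add
      (hj.mul continuous_const)))) (MemL2.mul_continuous hs (hk.mul continuous_const))

lemma memH1_vStar (hf : MemLp fθ 2 (volume.restrict (Ioo 1 R))) :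
    MemH1 (annulus R) (comp (vStar R ω fθ) i) := by
  refine ⟨?_, fun j => ⟨_, hasWeakPartial_vStar hf, memL2_gradVStar hf⟩⟩
  refine (memLp_congr_ae ?_).1 (MemL2.mul_continuous (memL2_comp_norm_of_continuousOn
    (continuousOn_speed (ω := ω) hf)) (contDiff_perp (n := 1) (i := i)).continuous)
  exact ae_annulus fun x hx => (comp_vStar_eq hf (norm_mem_Icc_of_mem_annulus hx)).symm

lemma weakPartial_vStar (hf : MemLp fθ 2 (volume.restrict (Ioo 1 R))) :
    weakPartial (annulus R) j (comp (vStar R ω fθ) i) =ᵐ[volume.restrict (annulus R)]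
      gradVStar R ω fθ i j :=
  (hasWeakPartial_vStar hf).weakPartial_ae_eq isOpen_annulus

lemma hasWeakPartial_weakPartial_vStar (hf : MemLp fθ 2 (volume.restrict (Ioo 1 R))) :
    HasWeakPartial (annulus R) k (weakPartial (annulus R) j (comp (vStar R ω fθ) i))
      (hessVStar R ω fθ i j k) :=
  (hasWeakPartial_gradVStar hf).congr_left (weakPartial_vStar hf).symm

lemma memH2_vStar (hf : MemLp fθ 2 (volume.restrict (Ioo 1 R))) :
    MemH2 (annulus R) (comp (vStar R ω fθ) i) :=
  ⟨memH1_vStar hf, fun _ => ⟨(memH1_vStar hf).memL2_weakPartial isOpen_annulus, fun _ =>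
    ⟨_, hasWeakPartial_weakPartial_vStar hf, memL2_hessVStar hf⟩⟩⟩

lemma continuousOn_vProfile (hf : MemLp fθ 2 (volume.restrict (Ioo 1 R))) :
    ContinuousOn (vProfile R ω fθ) (Icc 1 R) :=
  (continuousOn_id.mul (continuousOn_speed hf)).congr fun _ ht => vProfile_eq hf ht

lemma memLp_centrifugal (hf : MemLp fθ 2 (volume.restrict (Ioo 1 R))) :
    MemLp (fun t => 1 / t * vProfile R ω fθ t ^ 2) 2 (volume.restrict (Ioo 1 R)) :=
  memLp_of_continuousOn_Icc ((continuousOn_const.div continuousOn_id fun _ ht =>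
    (zero_lt_one.trans_le ht.1).ne').mul ((continuousOn_vProfile hf).pow 2))

lemma hasWeakPartial_qStar (hr : MemLp fρ 2 (volume.restrict (Ioo 1 R)))
    (hf : MemLp fθ 2 (volume.restrict (Ioo 1 R))) :
    HasWeakPartial (annulus R) i (qStar R ω fρ fθ) fun x =>
      1 / ‖x‖ * vProfile R ω fθ ‖x‖ ^ 2 * (x i / ‖x‖) + fρ ‖x‖ * (x i / ‖x‖) :=
  (hasWeakPartial_primitive_norm (integrableOn_of_memLp_two (memLp_centrifugal hf))).add
    (hasWeakPartial_primitive_norm (integrableOn_of_memLp_two hr))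

lemma memH1_qStar (hr : MemLp fρ 2 (volume.restrict (Ioo 1 R)))
    (hf : MemLp fθ 2 (volume.restrict (Ioo 1 R))) : MemH1 (annulus R) (qStar R ω fρ fθ) := by
  refine ⟨MemLp.add ?_ ?_, fun i => ⟨_, hasWeakPartial_qStar hr hf, MemLp.add ?_ ?_⟩⟩
  · exact memL2_comp_norm_of_continuousOn (continuousOn_primitive_of_integrableOn
      (integrableOn_of_memLp_two (memLp_centrifugal hf)))
  · exact memL2_comp_norm_of_continuousOn (continuousOn_primitive_of_integrableOn
      (integrableOn_of_memLp_two hr))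
  · exact memL2_mul_apply_div_norm (MemLp.comp_norm (memLp_centrifugal hf)) i
  · exact memL2_mul_apply_div_norm (MemLp.comp_norm hr) i

lemma rhoHat_apply (x : Plane) : rhoHat x i = x i / ‖x‖ := by
  fin_cases i <;> simp

/-- The viscous force is tangential and balances `fθ`, and the centripetal acceleration is balanced
by the pressure. -/
lemma momentum_vStar {f : Plane → Plane} (hf : IsPolarRep R f fρ fθ) :
    ∀ᵐ x ∂volume.restrict (annulus R), ∀ i,
      -weakLaplacian (annulus R) (vStar R ω fθ) i x + convection (annulus R) (vStar R ω fθ) i x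
        + weakPartial (annulus R) i (qStar R ω fρ fθ) x = f x i := by
  obtain ⟨hr, ht, hp⟩ := hf
  have hΩ := isOpen_annulus (R := R)
  have h2 : ∀ᵐ x ∂volume.restrict (annulus R), ∀ i j,
      weakPartial (annulus R) j (weakPartial (annulus R) j (comp (vStar R ω fθ) i)) x =
        hessVStar R ω fθ i j j x := by
    simp_rw [ae_all_iff]
    exact fun i j => (hasWeakPartial_weakPartial_vStar ht).weakPartial_ae_eq hΩ
  have h1 : ∀ᵐ x ∂volume.restrict (annulus R), ∀ i j,
      weakPartial (annulus R) j (comp (vStar R ω fθ) i) x = gradVStar R ω fθ i j x := by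
    simp_rw [ae_all_iff]
    exact fun i j => weakPartial_vStar ht
  have hq : ∀ᵐ x ∂volume.restrict (annulus R), ∀ i,
      weakPartial (annulus R) i (qStar R ω fρ fθ) x =
        1 / ‖x‖ * vProfile R ω fθ ‖x‖ ^ 2 * (x i / ‖x‖) + fρ ‖x‖ * (x i / ‖x‖) := by
    simp_rw [ae_all_iff]
    exact fun i => (hasWeakPartial_qStar hr ht).weakPartial_ae_eq hΩ
  filter_upwards [h1, h2, hq, hp, ae_restrict_mem hΩ.measurableSet] with x h1 h2 hq hp hx i
  have hn := norm_mem_Icc_of_mem_annulus hx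
  have h0 := norm_ne_zero_of_mem_annulus hx
  have hv : ∀ i, vStar R ω fθ x i = speed R ω fθ ‖x‖ * perp i x := fun i => comp_vStar_eq ht hn
  have hsq := sq_norm_plane x
  simp only [weakLaplacian, convection, h1, h2, hq, hp, hv, vProfile_eq ht hn, Fin.sum_univ_two,
    hessVStar, gradVStar, shearDeriv, PiLp.add_apply, PiLp.smul_apply, smul_eq_mul, rhoHat_apply,
    thetaHat_apply]
  generalize ‖x‖ = r at *
  generalize speed R ω fθ r = s at *
  generalize shearCoeff R ω fθ r = c at *
  have e0 : x 0 ^ 2 = r ^ 2 - x 1 ^ 2 := by linarith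
  have e1 : x 1 ^ 2 = r ^ 2 - x 0 ^ 2 := by linarith
  fin_cases i
  · simp [perpCoeff]
    field_simp
    ring_nf
    simp only [e0]
    ring
  · simp [perpCoeff]
    field_simp
    ring_nf
    simp only [e1]
    ring

/-- A divergence of the form `c x · x^⊥ + s tr(∇ x^⊥)`, in which both terms vanish. -/
lemma weakDiv_vStar (hf : MemLp fθ 2 (volume.restrict (Ioo 1 R))) :
    ∀ᵐ x ∂volume.restrict (annulus R), weakDiv (annulus R) (vStar R ω fθ) x = 0 := by
  filter_upwards [weakPartial_vStar (ω := ω) (i := 0) (j := 0) hf,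
    weakPartial_vStar (ω := ω) (i := 1) (j := 1) hf] with x h0 h1
  simp only [weakDiv, Fin.sum_univ_two, h0, h1, gradVStar, perp_zero, perp_one, perpCoeff]
  simp
  ring

/-! ### Traces of the explicit flow -/

/-- A continuous extension of `speedDeriv` that vanishes on `(-∞, 1/2]`. -/
lemma exists_continuous_extension_speedDeriv (hf : MemLp fθ 2 (volume.restrict (Ioo 1 R))) :
    ∃ κ : ℝ → ℝ, Continuous κ ∧ (∀ t ≤ 1 / 2, κ t = 0) ∧
      ∀ t ∈ Icc 1 R, κ t = speedDeriv R ω fθ t := by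
  set F : ℝ → ℝ := fun ρ => ∫ t in (1 : ℝ)..ρ, (Ioo 1 R).indicator (fun t => t ^ 2 * fθ t) t
  have hi : Integrable ((Ioo 1 R).indicator fun t => t ^ 2 * fθ t) :=
    (integrable_indicator_iff measurableSet_Ioo).2 (integrableOn_of_memLp_two (memLp_sq_mul hf))
  have hF : Continuous F := intervalIntegral.continuous_primitive (fun _ _ => hi.intervalIntegrable) 1
  have hFe : ∀ t ∈ Icc 1 R, F t = secondMoment fθ t := fun t ht => by
    simp only [F, secondMoment]
    rw [intervalIntegral.integral_of_le ht.1, intervalIntegral.integral_of_le ht.1,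
      integral_Ioc_eq_integral_Ioo, integral_Ioc_eq_integral_Ioo]
    exact setIntegral_congr_fun measurableSet_Ioo fun s hs =>
      indicator_of_mem (Ioo_subset_Ioo_right ht.2 hs) _
  -- the last factor is `t⁻³` for `t ≥ 1` and vanishes for `t ≤ 1 / 2`
  refine ⟨fun t => (2 * constA R ω fθ - F t) * (max 0 (min 1 (2 * t - 1)) / max t (1 / 2) ^ 3),
    ?_, fun t ht => ?_, fun t ht => ?_⟩
  · refine (continuous_const.sub hF).mul (Continuous.div (by fun_prop) (by fun_prop) fun t => ?_)
    exact pow_ne_zero 3 (lt_max_of_lt_right (by norm_num)).ne'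
  · have : max 0 (min 1 (2 * t - 1)) = 0 := max_eq_left ((min_le_right _ _).trans (by linarith))
    simp only [this, zero_div, mul_zero]
  · have h1 : min 1 (2 * t - 1) = 1 := min_eq_left (by linarith [ht.1])
    have h2 : max t (1 / 2) = t := max_eq_left (by linarith [ht.1])
    simp only [hFe t ht, h1, h2, speedDeriv]
    norm_num
    ring

/-- The components of the explicit flow are restrictions of `C¹` functions on the plane. -/
lemma exists_contDiff_extension_vStar (hf : MemLp fθ 2 (volume.restrict (Ioo 1 R))) (i : Fin 2) :
    ∃ z : Plane → ℝ, ContDiff ℝ 1 z ∧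
      ∀ x : Plane, ‖x‖ ∈ Icc 1 R → z x = comp (vStar R ω fθ) i x := by
  obtain ⟨κ, hκ, h0, he⟩ := exists_continuous_extension_speedDeriv (ω := ω) hf
  refine ⟨fun x => (∫ t in (1 : ℝ)..‖x‖, κ t) * perp i x,
    (contDiff_primitive_norm hκ h0).mul contDiff_perp, fun x hx => ?_⟩
  simp only [comp_vStar_eq hf hx, speed]
  congr 1
  refine intervalIntegral.integral_congr fun t ht => he t ?_
  rw [uIcc_of_le hx.1] at ht
  exact ⟨ht.1, ht.2.trans hx.2⟩

lemma partialDeriv_ae_eq_weakPartial {Ω : Set Plane} (hΩ : IsOpen Ω) {u w : Plane → ℝ}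
    (hw : ContDiff ℝ 1 w) (h : w =ᵐ[volume.restrict Ω] u) :
    partialDeriv i w =ᵐ[volume.restrict Ω] weakPartial Ω i u :=
  (((hasWeakPartial_of_contDiffOn hΩ hw.contDiffOn).congr_left h).weakPartial_ae_eq hΩ).symm

lemma hasTraceOnCircle_of_eqOn {u g w : Plane → ℝ} {r : ℝ} (hw : ContDiff ℝ 1 w)
    (hu : w =ᵐ[volume.restrict (annulus R)] u)
    (hg : ∀ θ, w (circlePoint r θ) = g (circlePoint r θ)) :
    HasTraceOnCircle (annulus R) r u g := by
  have h0 : ∀ {a b : Plane → ℝ}, a =ᵐ[volume.restrict (annulus R)] b →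
      Tendsto (fun _ : ℕ => eLpNorm (fun x => a x - b x) 2 (volume.restrict (annulus R)))
        atTop (𝓝 0) := fun hab => by
    have : (fun x => _) =ᵐ[volume.restrict (annulus R)] 0 :=
      hab.mono fun x hx => sub_eq_zero.2 hx
    rw [eLpNorm_congr_ae this, eLpNorm_zero]
    exact tendsto_const_nhds
  refine ⟨fun _ => w, fun _ => hw, ⟨h0 hu, fun i => h0 ?_⟩, ?_⟩
  · exact partialDeriv_ae_eq_weakPartial isOpen_annulus hw hu
  · simp [hg]

lemma comp_vStar_outer (hR : 1 < R) (θ : ℝ) :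
    comp (vStar R ω fθ) i (circlePoint R θ) =
      comp (fun x => ω • thetaHat x) i (circlePoint R θ) := by
  simp only [comp, vStar]
  rw [norm_circlePoint, abs_of_pos (by linarith), vProfile_R hR]

lemma comp_vStar_inner (θ : ℝ) : comp (vStar R ω fθ) i (circlePoint 1 θ) = 0 := by
  have h1 : vProfile R ω fθ 1 = 0 := by simp [vProfile]
  simp only [comp, vStar]
  rw [norm_circlePoint, abs_one, h1]
  simp

lemma norm_circlePoint_mem_Icc {r : ℝ} (hr : r ∈ Icc 1 R) (θ : ℝ) :
    ‖circlePoint r θ‖ ∈ Icc 1 R := by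
  rwa [norm_circlePoint, abs_of_nonneg (by linarith [hr.1])]

lemma hasTraceOnCircle_vStar (hf : MemLp fθ 2 (volume.restrict (Ioo 1 R))) {r : ℝ}
    (hr : r ∈ Icc 1 R) {g : Plane → ℝ}
    (hg : ∀ θ, comp (vStar R ω fθ) i (circlePoint r θ) = g (circlePoint r θ)) :
    HasTraceOnCircle (annulus R) r (comp (vStar R ω fθ) i) g := by
  obtain ⟨z, hz, he⟩ := exists_contDiff_extension_vStar (ω := ω) hf i
  refine hasTraceOnCircle_of_eqOn hz (ae_annulus fun x hx => he x (norm_mem_Icc_of_mem_annulus hx))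
    fun θ => ?_
  rw [he _ (norm_circlePoint_mem_Icc hr θ), hg]

lemma isStrongSolution_vStar (hR : 1 < R) {f : Plane → Plane} (hf : IsPolarRep R f fρ fθ) :
    IsStrongSolution R ω f (vStar R ω fθ) (qStar R ω fρ fθ) where
  velocity_memH2 _ := memH2_vStar hf.2.1
  pressure_memH1 := memH1_qStar hf.1 hf.2.1
  momentum := momentum_vStar hf
  div_free := weakDiv_vStar hf.2.1
  outer_boundary _ :=
    hasTraceOnCircle_vStar hf.2.1 (right_mem_Icc.2 hR.le) (comp_vStar_outer hR)
  inner_boundary _ :=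
    hasTraceOnCircle_vStar hf.2.1 (left_mem_Icc.2 hR.le) comp_vStar_inner

end

section

/-! ### The energy identity for the difference of two solutions -/

variable {R ω : ℝ} {Ω : Set Plane} {j : Fin 2} {u φ z : Plane → ℝ}

lemma integrable_mul_of_memLp_two {α : Type*} [MeasurableSpace α] {μ : Measure α} {a b : α → ℝ}
    (ha : MemLp a 2 μ) (hb : MemLp b 2 μ) : Integrable (fun x => a x * b x) μ :=
  ha.integrable_mul hb

/-- Leibniz rule for the product of an `H¹₀` function with a `C¹` function. -/
lemma MemH10.hasWeakPartial_mul (hΩ : IsOpen Ω) [IsFiniteMeasure (volume.restrict Ω)]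
    (hu : MemH10 Ω u) (hz : ContDiff ℝ 1 z) :
    HasWeakPartial Ω j (fun x => u x * z x)
      (fun x => weakPartial Ω j u x * z x + u x * partialDeriv j z x) := by
  have hw := hu.1.hasWeakPartial (i := j)
  have hzc := hz.continuous
  have hdz := continuous_partialDeriv (i := j) hz
  have M : ∀ {w k : Plane → ℝ}, LocallyIntegrableOn w Ω → Continuous k →
      LocallyIntegrableOn (fun x => w x * k x) Ω := fun hw hk =>
    hw.mul_continuousOn hk.continuousOn hΩ.isLocallyClosed
  refine ⟨M hw.1 hzc, (M hw.2.1 hzc).add (M hw.1 hdz), fun φ hφ => ?_⟩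
  obtain ⟨w, hwt, h0, h1⟩ := hu.2
  have L : ∀ {k ψ : Plane → ℝ}, Continuous k → IsTestFunction Ω ψ →
      MemLp (fun x => k x * ψ x) 2 (volume.restrict Ω) := fun hk hψ =>
    (hk.mul hψ.continuous).memLp_of_hasCompactSupport hψ.2.1.mul_left
  have hφ' := hφ.partialDeriv (i := j)
  have e : ∀ n, ∫ x in Ω, (z x * partialDeriv j φ x) * w n x =
      -((∫ x in Ω, (z x * φ x) * partialDeriv j (w n) x) +
        ∫ x in Ω, (partialDeriv j z x * φ x) * w n x) := by
    intro n
    have := (hasWeakPartial_of_contDiffOn (i := j) hΩ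
      (((hwt n).contDiff_one.mul hz).contDiffOn (s := Ω))).2.2 φ hφ
    rw [← integral_add (integrable_mul_of_memLp_two (L hzc hφ) ((hwt n).partialDeriv.memLp 2))
      (integrable_mul_of_memLp_two (L hdz hφ) ((hwt n).memLp 2))]
    convert! this using 2
    · ext x
      ring
    · congr 1
      ext x
      rw [partialDeriv_mul ((hwt n).contDiff_one.differentiable one_ne_zero x)
        (hz.differentiable one_ne_zero x)]
      ring
  have t0 := tendsto_integral_mul (L hzc hφ') (fun n => (hwt n).memLp 2) hu.1.1 h0
  have t1 := tendsto_integral_mul (L hzc hφ) (fun n => (hwt n).partialDeriv.memLp 2)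
    (hu.1.memL2_weakPartial hΩ) (h1 j)
  have t2 := tendsto_integral_mul (L hdz hφ) (fun n => (hwt n).memLp 2) hu.1.1 h0
  have := tendsto_nhds_unique t0 (((t1.add t2).neg).congr fun n => (e n).symm)
  rw [← integral_add (integrable_mul_of_memLp_two (L hzc hφ) (hu.1.memL2_weakPartial (i := j) hΩ))
      (integrable_mul_of_memLp_two (L hdz hφ) hu.1.1)] at this
  convert! this using 2
  · ext x
    ring
  · congr 1
    ext x
    ring

/-- Transport by a divergence-free field `a` does not contribute to the energy balance. For a test
function this is `∫ a · ∇(φ² / 2) = 0`. In two dimensions `a φ` is square integrable, as a product of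
two functions in `L⁴`, so that the identity passes to the limit. -/
lemma sum_integral_transport_self_eq_zero {a : Plane → Plane}
    (ha : ∀ j, MemH1 (annulus R) (comp a j))
    (ha4 : ∀ j, MemLp (comp a j) 4 (volume.restrict (annulus R)))
    (hdiv : ∀ᵐ x ∂volume.restrict (annulus R), weakDiv (annulus R) a x = 0)
    (hφ : MemH10 (annulus R) φ) :
    ∑ j, ∫ x in annulus R, (comp a j x * φ x) * weakPartial (annulus R) j φ x = 0 := by
  have hΩ := isOpen_annulus (R := R)
  obtain ⟨w, hw, ⟨h0, h1⟩, h4⟩ := hφ.exists_seq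
  have hn : ∀ n, ∑ j, ∫ x in annulus R, (comp a j x * w n x) * partialDeriv j (w n) x = 0 := by
    intro n
    have e : ∀ j, 2 * ∫ x in annulus R, (comp a j x * w n x) * partialDeriv j (w n) x =
        -∫ x in annulus R, weakPartial (annulus R) j (comp a j) x * (w n x * w n x) := by
      intro j
      rw [← (ha j).hasWeakPartial.2.2 _ ((hw n).mul (hw n)), ← integral_const_mul]
      congr 1
      ext x
      have := (hw n).contDiff_one.differentiable one_ne_zero x
      rw [partialDeriv_mul this this]
      ring
    have e2 : ∑ j, 2 * ∫ x in annulus R, (comp a j x * w n x) * partialDeriv j (w n) x = 0 := by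
      simp only [e, Finset.sum_neg_distrib]
      rw [← integral_fin_two fun j => integrable_mul_of_memLp_two ((ha j).memL2_weakPartial hΩ)
        (((hw n).mul (hw n)).memLp 2)]
      rw [neg_eq_zero]
      refine integral_eq_zero_of_ae ?_
      filter_upwards [hdiv] with x hx
      rw [← Finset.sum_mul]
      simp only [weakDiv] at hx
      rw [hx, zero_mul]
      rfl
    rw [← Finset.mul_sum] at e2
    linarith
  have ht : ∀ j, Tendsto (fun n => ∫ x in annulus R, (comp a j x * w n x) *
      partialDeriv j (w n) x) atTop
      (𝓝 (∫ x in annulus R, (comp a j x * φ x) * weakPartial (annulus R) j φ x)) := by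
    intro j
    have p1 : ∀ n, MemLp (fun x => comp a j x * w n x) 2 (volume.restrict (annulus R)) :=
      fun n => memLp_mul (ha4 j) ((hw n).memLp 4)
    have p2 : MemLp (fun x => comp a j x * φ x) 2 (volume.restrict (annulus R)) :=
      memLp_mul (ha4 j) hφ.memLp_four
    have t : Tendsto (fun n => eLpNorm (fun x => comp a j x * w n x - comp a j x * φ x) 2
        (volume.restrict (annulus R))) atTop (𝓝 0) :=
      tendsto_eLpNorm_mul_sub (p := 4) (q := 4) (a := fun _ => comp a j) (by norm_num)
        (by norm_num) (fun _ => (ha4 j).1) (fun n => ((hw n).memLp 4).1) (ha4 j) hφ.memLp_four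
        (by simp) h4
    have hd := hφ.1.memL2_weakPartial (i := j) hΩ
    exact tendsto_integral_of_eLpNorm_one
      (fun n => integrable_mul_of_memLp_two (p1 n) ((hw n).partialDeriv.memLp 2)) (integrable_mul_of_memLp_two p2 hd)
      (tendsto_eLpNorm_mul_sub (p := 2) (q := 2) le_rfl (by norm_num) (fun n => (p1 n).1)
        (fun n => ((hw n).partialDeriv.memLp 2).1) p2 hd t (h1 j))
  have := tendsto_finsetSum Finset.univ fun j _ => ht j
  exact tendsto_nhds_unique this (by simp only [hn]; exact tendsto_const_nhds)

/-- The weak form, with the sums taken out of the integrals. -/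
lemma IsWeakSolution.sum_integral_eq {f u φ : Plane → Plane} (hu : IsWeakSolution R ω f u)
    (hu4 : ∀ i, MemLp (comp u i) 4 (volume.restrict (annulus R)))
    (hφ : MemH10Sigma (annulus R) φ) :
    (∑ i, ∑ j, ∫ x in annulus R,
        weakPartial (annulus R) j (comp u i) x * weakPartial (annulus R) j (comp φ i) x)
      + (∑ i, ∑ j, ∫ x in annulus R,
        (comp u j x * comp φ i x) * weakPartial (annulus R) j (comp u i) x)
    = ∫ x in annulus R, ∑ i, f x i * φ x i := by
  have hΩ := isOpen_annulus (R := R)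
  have hD := fun i j => (hu.mem.1 i).memL2_weakPartial (i := j) hΩ
  have I1 : ∀ i j, IntegrableOn (fun x => weakPartial (annulus R) j (comp u i) x *
      weakPartial (annulus R) j (comp φ i) x) (annulus R) := fun i j =>
    integrable_mul_of_memLp_two (hD i j) ((hφ.1 i).1.memL2_weakPartial hΩ)
  have I2 : ∀ i j, IntegrableOn (fun x => (comp u j x * comp φ i x) *
      weakPartial (annulus R) j (comp u i) x) (annulus R) := fun i j =>
    integrable_mul_of_memLp_two (memLp_mul (r := 2) (hu4 j) (hφ.1 i).memLp_four) (hD i j)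
  rw [← hu.weak_form φ hφ, integral_fin_two fun i => integrable_finsetSum _ fun j _ => I1 i j]
  have e : (fun x => ∑ i, convection (annulus R) u i x * φ x i) = fun x =>
      ∑ i, ∑ j, (comp u j x * comp φ i x) * weakPartial (annulus R) j (comp u i) x := by
    ext x
    simp only [convection, Finset.sum_mul, comp]
    exact Finset.sum_congr rfl fun i _ => Finset.sum_congr rfl fun j _ => by ring
  rw [e, integral_fin_two fun i => integrable_finsetSum _ fun j _ => I2 i j]
  simp only [integral_fin_two (I1 _), integral_fin_two (I2 _)]

/-- The energy of the difference `v` of two weak solutions equals `-∫ (v · ∇) V · v`: test both weak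
forms with `v` and use `(u · ∇) u - (V · ∇) V = (u · ∇) v + (v · ∇) V`. -/
lemma IsWeakSolution.energy_identity {f u V v : Plane → Plane} (hu : IsWeakSolution R ω f u)
    (hV : IsWeakSolution R ω f V) (hV4 : ∀ i, MemLp (comp V i) 4 (volume.restrict (annulus R)))
    (huv : ∀ i, comp v i = fun x => comp u i x - comp V i x)
    (hv : MemH10Sigma (annulus R) v) :
    ∑ i, ∑ j, ∫ x in annulus R, weakPartial (annulus R) j (comp v i) x ^ 2 =
      -∑ i, ∑ j, ∫ x in annulus R,
        (comp v j x * comp v i x) * weakPartial (annulus R) j (comp V i) x := by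
  have hΩ := isOpen_annulus (R := R)
  have hv4 := fun i => (hv.1 i).memLp_four
  have hu4 : ∀ i, MemLp (comp u i) 4 (volume.restrict (annulus R)) := fun i => by
    have : comp u i = fun x => comp v i x + comp V i x := by
      ext x
      simp [huv]
    rw [this]
    exact (hv4 i).add (hV4 i)
  have e1 := hu.sum_integral_eq hu4 hv
  have e2 := hV.sum_integral_eq hV4 hv
  have hDu := fun i j => (hu.mem.1 i).memL2_weakPartial (i := j) hΩ
  have hDV := fun i j => (hV.mem.1 i).memL2_weakPartial (i := j) hΩ
  have hDv := fun i j => (hv.1 i).1.memL2_weakPartial (i := j) hΩ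
  have hd : ∀ i j, weakPartial (annulus R) j (comp v i) =ᵐ[volume.restrict (annulus R)]
      fun x => weakPartial (annulus R) j (comp u i) x - weakPartial (annulus R) j (comp V i) x :=
    fun i j => by
      rw [huv i]
      exact (hu.mem.1 i).weakPartial_sub hΩ (hV.mem.1 i)
  have s1 : ∀ i j, ∫ x in annulus R, weakPartial (annulus R) j (comp v i) x ^ 2 =
      (∫ x in annulus R,
        weakPartial (annulus R) j (comp u i) x * weakPartial (annulus R) j (comp v i) x) -
      ∫ x in annulus R,
        weakPartial (annulus R) j (comp V i) x * weakPartial (annulus R) j (comp v i) x := by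
    intro i j
    rw [← integral_sub (integrable_mul_of_memLp_two (hDu i j) (hDv i j))
      (integrable_mul_of_memLp_two (hDV i j) (hDv i j))]
    refine integral_congr_ae ?_
    filter_upwards [hd i j] with x hx
    rw [← sub_mul, ← hx, sq]
  have s2 : ∀ i j, (∫ x in annulus R,
        (comp u j x * comp v i x) * weakPartial (annulus R) j (comp u i) x) -
      (∫ x in annulus R, (comp V j x * comp v i x) * weakPartial (annulus R) j (comp V i) x) =
      (∫ x in annulus R, (comp u j x * comp v i x) * weakPartial (annulus R) j (comp v i) x) +
      ∫ x in annulus R, (comp v j x * comp v i x) * weakPartial (annulus R) j (comp V i) x := by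
    intro i j
    have p1 := memLp_mul (r := 2) (hu4 j) (hv4 i)
    have p2 := memLp_mul (r := 2) (hV4 j) (hv4 i)
    have p3 := memLp_mul (r := 2) (hv4 j) (hv4 i)
    rw [← integral_sub (integrable_mul_of_memLp_two p1 (hDu i j)) (integrable_mul_of_memLp_two p2 (hDV i j)),
      ← integral_add (integrable_mul_of_memLp_two p1 (hDv i j)) (integrable_mul_of_memLp_two p3 (hDV i j))]
    refine integral_congr_ae ?_
    filter_upwards [hd i j] with x hx
    simp only [hx, huv j]
    ring
  have s3 : ∀ i, ∑ j, ∫ x in annulus R,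
      (comp u j x * comp v i x) * weakPartial (annulus R) j (comp v i) x = 0 := fun i =>
    sum_integral_transport_self_eq_zero hu.mem.1 hu4 hu.mem.2.2 (hv.1 i)
  have s30 := s3 0
  have s31 := s3 1
  simp only [Fin.sum_univ_two] at e1 e2 s30 s31 ⊢
  linarith [s1 0 0, s1 0 1, s1 1 0, s1 1 1, s2 0 0, s2 0 1, s2 1 0, s2 1 1]

end

section

/-! ### The bound of the velocity profile -/

variable {R ω ρ : ℝ} {fθ : ℝ → ℝ}

lemma integrableOn_weight_mul_abs (hf : MemLp fθ 2 (volume.restrict (Ioo 1 R))) :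
    IntegrableOn (fun t => (R ^ 2 - t ^ 2) / (2 * R) * |fθ t|) (Ioo 1 R) := by
  have := integrableOn_of_memLp_two (MemLp.mul_continuousOn_Icc hf.abs
    (b := fun t => (R ^ 2 - t ^ 2) / (2 * R)) (by fun_prop))
  simpa [mul_comm] using this

/-- The left side is `∫₁^ρ (ρ² - t²) / (2 ρ) fθ(t) dt`, with a nonnegative kernel that is largest for
`ρ = R`. -/
lemma abs_moment_le (hf : MemLp fθ 2 (volume.restrict (Ioo 1 R))) (hρ : ρ ∈ Icc 1 R) :
    |ρ / 2 * (∫ t in (1 : ℝ)..ρ, fθ t) - 1 / (2 * ρ) * ∫ t in (1 : ℝ)..ρ, t ^ 2 * fθ t| ≤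
      ∫ t in Ioo 1 R, (R ^ 2 - t ^ 2) / (2 * R) * |fθ t| := by
  have h0 : 0 < ρ := by linarith [hρ.1]
  have hR : 0 < R := by linarith [hρ.2]
  have hI : IntervalIntegrable (fun t => t ^ 2 * fθ t) volume 1 ρ :=
    intervalIntegrable_of_mem (integrableOn_of_memLp_two (memLp_sq_mul hf)) hρ
  have hI0 : IntervalIntegrable fθ volume 1 ρ :=
    intervalIntegrable_of_mem (integrableOn_of_memLp_two hf) hρ
  have hsub : Ioo 1 ρ ⊆ Ioo 1 R := Ioo_subset_Ioo_right hρ.2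
  have hw := integrableOn_weight_mul_abs hf
  rw [← intervalIntegral.integral_const_mul, ← intervalIntegral.integral_const_mul,
    ← intervalIntegral.integral_sub (hI0.const_mul _) (hI.const_mul _),
    intervalIntegral.integral_of_le hρ.1, integral_Ioc_eq_integral_Ioo]
  refine abs_integral_le_integral_abs.trans ((setIntegral_mono_on ?_ (hw.mono_set hsub)
    measurableSet_Ioo fun t ht => ?_).trans (setIntegral_mono_set hw ?_ hsub.eventuallyLE))
  · have := ((hI0.const_mul (ρ / 2)).sub (hI.const_mul (1 / (2 * ρ)))).abs
    exact (intervalIntegrable_iff_integrableOn_Ioo_of_le hρ.1).1 this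
  · have e : ρ / 2 * fθ t - 1 / (2 * ρ) * (t ^ 2 * fθ t) = (ρ ^ 2 - t ^ 2) / (2 * ρ) * fθ t := by
      field_simp
    have hn : 0 ≤ (ρ ^ 2 - t ^ 2) / (2 * ρ) :=
      div_nonneg (by nlinarith [ht.1, ht.2]) (by linarith)
    rw [e, abs_mul, abs_of_nonneg hn]
    refine mul_le_mul_of_nonneg_right ?_ (abs_nonneg _)
    -- `ρ ↦ ρ - t² / ρ` is increasing
    rw [div_le_div_iff₀ (by linarith) (by linarith)]
    nlinarith [mul_nonneg (sub_nonneg.2 hρ.2) (by positivity : 0 ≤ ρ * R + t ^ 2)]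
  · filter_upwards [ae_restrict_mem measurableSet_Ioo] with t ht
    exact mul_nonneg (div_nonneg (by nlinarith [ht.1, ht.2]) (by linarith)) (abs_nonneg _)

/-- Both the multiple `A (ρ - 1 / ρ)` of the classical flow, apart from its part due to `ω`, and the
remaining part of the profile are bounded by the same integral. -/
lemma abs_vProfile_le_integral (hR : 1 < R) (hω : 0 ≤ ω)
    (hf : MemLp fθ 2 (volume.restrict (Ioo 1 R))) (hρ : ρ ∈ Icc 1 R) :
    |vProfile R ω fθ ρ| ≤ ω + 2 * ∫ t in Ioo 1 R, (R ^ 2 - t ^ 2) / (2 * R) * |fθ t| := by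
  have m1 := abs_moment_le hf hρ
  have m2 := abs_moment_le hf (right_mem_Icc.2 hR.le)
  set J := ∫ t in Ioo 1 R, (R ^ 2 - t ^ 2) / (2 * R) * |fθ t|
  set a := ρ / 2 * (∫ t in (1 : ℝ)..ρ, fθ t) - 1 / (2 * ρ) * ∫ t in (1 : ℝ)..ρ, t ^ 2 * fθ t
    with ha
  set b := R / 2 * (∫ t in (1 : ℝ)..R, fθ t) - 1 / (2 * R) * ∫ t in (1 : ℝ)..R, t ^ 2 * fθ t
    with hb
  have h0 : 0 < ρ := by linarith [hρ.1]
  have hd : 0 < R ^ 2 - 1 := by nlinarith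
  have hc0 : 0 ≤ R / (R ^ 2 - 1) * (ρ - 1 / ρ) := by
    refine mul_nonneg (by positivity) (sub_nonneg.2 ?_)
    rw [div_le_iff₀ h0]
    nlinarith [hρ.1]
  have hc1 : R / (R ^ 2 - 1) * (ρ - 1 / ρ) ≤ 1 := by
    rw [show R / (R ^ 2 - 1) * (ρ - 1 / ρ) = R * (ρ ^ 2 - 1) / ((R ^ 2 - 1) * ρ) by field_simp,
      div_le_one (by positivity)]
    nlinarith [mul_nonneg (sub_nonneg.2 hρ.2) (by positivity : 0 ≤ ρ * R + 1)]
  have e : vProfile R ω fθ ρ = R / (R ^ 2 - 1) * (ρ - 1 / ρ) * (ω + b) - a := by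
    rw [vProfile, constA, ha, hb]
    ring
  have h1 : |R / (R ^ 2 - 1) * (ρ - 1 / ρ) * (ω + b)| ≤ ω + J := by
    rw [abs_mul, abs_of_nonneg hc0]
    refine (mul_le_of_le_one_left (abs_nonneg _) hc1).trans ((abs_add_le _ _).trans ?_)
    rw [abs_of_nonneg hω]
    linarith
  rw [e]
  linarith [abs_sub (R / (R ^ 2 - 1) * (ρ - 1 / ρ) * (ω + b)) a]

lemma integral_sq_sub_sq (hR : 1 < R) :
    ∫ t in Ioo 1 R, (R ^ 2 - t ^ 2) ^ 2 =
      (R - 1) * (8 * R ^ 4 - 7 * R ^ 3 - 7 * R ^ 2 + 3 * R + 3) / 15 := by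
  rw [← integral_Ioc_eq_integral_Ioo, ← intervalIntegral.integral_of_le hR.le,
    intervalIntegral.integral_eq_sub_of_hasDerivAt
      (f := fun t => R ^ 4 * t - 2 * R ^ 2 * (t ^ 3 / 3) + t ^ 5 / 5) (fun t _ => ?_)
      (Continuous.intervalIntegrable (by fun_prop) _ _)]
  · ring
  · have h3 := (hasDerivAt_pow 3 t).div_const 3
    have h5 := (hasDerivAt_pow 5 t).div_const 5
    have h1 := (hasDerivAt_id t).const_mul (R ^ 4)
    convert! (h1.sub (h3.const_mul (2 * R ^ 2))).add h5 using 1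
    norm_num
    ring

/-- The Jacobian of polar coordinates is at least one in the annulus. -/
lemma integral_sq_le_integral_sq_comp_norm (hf : MemLp fθ 2 (volume.restrict (Ioo 1 R))) :
    ∫ t in Ioo 1 R, |fθ t| ^ 2 ≤ ∫ x in annulus R, fθ ‖x‖ ^ 2 := by
  have h2 : MemLp (fun x : Plane => fθ ‖x‖) 2 (volume.restrict (annulus R)) := MemLp.comp_norm hf
  simp only [sq_abs]
  rw [integral_eq_lintegral_of_nonneg_ae (ae_of_all _ fun _ => sq_nonneg _)
      hf.integrable_sq.1, integral_eq_lintegral_of_nonneg_ae (ae_of_all _ fun _ => sq_nonneg _)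
      h2.integrable_sq.1]
  refine ENNReal.toReal_mono ?_ (lintegral_Ioo_le_comp_norm
    (G := fun t => ENNReal.ofReal (fθ t ^ 2)) hf.integrable_sq.1.aemeasurable.ennreal_ofReal)
  have := h2.integrable_sq.2
  rw [hasFiniteIntegral_iff_ofReal (ae_of_all _ fun _ => sq_nonneg _)] at this
  exact this.ne

/-- The velocity of the explicit flow is bounded by `K_R(ω, f)`: the polynomial under the root in
`K_R` comes from the Cauchy–Schwarz inequality with the weight `R² - t²`. -/
lemma abs_vProfile_le (hR : 1 < R) (hω : 0 ≤ ω) (hf : MemLp fθ 2 (volume.restrict (Ioo 1 R)))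
    (hρ : ρ ∈ Icc 1 R) : |vProfile R ω fθ ρ| ≤ constK R ω fθ := by
  refine (abs_vProfile_le_integral hR hω hf hρ).trans ?_
  have hb : MemLp (fun t => R ^ 2 - t ^ 2) (ENNReal.ofReal 2) (volume.restrict (Ioo 1 R)) := by
    exact memLp_of_continuousOn_Icc (by fun_prop)
  have hfa : MemLp (fun t => |fθ t|) (ENNReal.ofReal 2) (volume.restrict (Ioo 1 R)) := by
    rw [ENNReal.ofReal_ofNat]
    exact hf.abs
  have cs := integral_mul_le_Lp_mul_Lq_of_nonneg Real.HolderConjugate.two_two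
    (ae_restrict_of_forall_mem measurableSet_Ioo fun t ht => by
      simp only [Pi.zero_apply]
      nlinarith [ht.1, ht.2]) (ae_of_all _ fun t => abs_nonneg (fθ t)) hb hfa
  simp only [Real.rpow_two, ← Real.sqrt_eq_rpow] at cs
  rw [integral_sq_sub_sq hR] at cs
  have e : 2 * ∫ t in Ioo 1 R, (R ^ 2 - t ^ 2) / (2 * R) * |fθ t| =
      1 / R * ∫ t in Ioo 1 R, (R ^ 2 - t ^ 2) * |fθ t| := by
    rw [← integral_const_mul, ← integral_const_mul]
    congr 1
    ext t
    field_simp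
  have hs := Real.sqrt_le_sqrt (integral_sq_le_integral_sq_comp_norm hf)
  rw [e, constK]
  set P := 8 * R ^ 4 - 7 * R ^ 3 - 7 * R ^ 2 + 3 * R + 3
  have e2 : √((R - 1) * P / 15) = √(R - 1) * √P / √15 := by
    rw [Real.sqrt_div' _ (by norm_num), Real.sqrt_mul (by linarith)]
  rw [e2] at cs
  have : 1 / R * ∫ t in Ioo 1 R, (R ^ 2 - t ^ 2) * |fθ t| ≤
      1 / R * (√(R - 1) * √P / √15 * √(∫ x in annulus R, fθ ‖x‖ ^ 2)) := by
    refine mul_le_mul_of_nonneg_left (cs.trans ?_) (by positivity)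
    exact mul_le_mul_of_nonneg_left hs (by positivity)
  have e3 : 1 / R * (√(R - 1) * √P / √15 * √(∫ x in annulus R, fθ ‖x‖ ^ 2)) =
      √(R - 1) / (√15 * R) * √P * √(∫ x in annulus R, fθ ‖x‖ ^ 2) := by
    field_simp
  linarith

end

section

/-! ### Uniqueness -/

variable {R ω : ℝ} {i : Fin 2} {fρ fθ : ℝ → ℝ} {f u v : Plane → Plane} {φ : Plane → ℝ}

/-- Subtracting a `C¹` function with the same boundary values leaves a function of zero trace. -/
lemma HasTraceOnCircle.sub_of_eqOn {w V g z : Plane → ℝ} {r : ℝ} (hw : MemH1 (annulus R) w)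
    (hV : MemH1 (annulus R) V) (h : HasTraceOnCircle (annulus R) r w g) (hz : ContDiff ℝ 1 z)
    (hzV : z =ᵐ[volume.restrict (annulus R)] V)
    (hg : ∀ θ, z (circlePoint r θ) = g (circlePoint r θ)) :
    HasTraceOnCircle (annulus R) r (fun x => w x - V x) 0 := by
  have hΩ := isOpen_annulus (R := R)
  obtain ⟨s, hs, ⟨h0, h1⟩, h2⟩ := h
  refine ⟨fun n x => s n x - z x, fun n => (hs n).sub hz, ⟨h0.congr fun n => ?_, fun i =>
    (h1 i).congr fun n => ?_⟩, h2.congr fun n => ?_⟩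
  · refine eLpNorm_congr_ae ?_
    filter_upwards [hzV] with x hx
    rw [hx]
    ring
  · refine eLpNorm_congr_ae ?_
    filter_upwards [partialDeriv_ae_eq_weakPartial (i := i) hΩ hz hzV,
      hw.weakPartial_sub (i := i) hΩ hV] with x hx hx2
    have : partialDeriv i (fun x => s n x - z x) x =
        partialDeriv i (s n) x - partialDeriv i z x := by
      rw [partialDeriv, fderiv_fun_sub ((hs n).differentiable one_ne_zero x)
        (hz.differentiable one_ne_zero x)]
      rfl
    rw [hx2, this, hx]
    ring
  · simp [hg]

lemma IsWeakSolution.memH10_sub_vStar (hR : 1 < R) (hu : IsWeakSolution R ω f u)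
    (hf : MemLp fθ 2 (volume.restrict (Ioo 1 R))) (i : Fin 2) :
    MemH10 (annulus R) fun x => comp u i x - comp (vStar R ω fθ) i x := by
  obtain ⟨z, hz, he⟩ := exists_contDiff_extension_vStar (ω := ω) hf i
  have hzV := ae_annulus fun x hx => he x (norm_mem_Icc_of_mem_annulus hx)
  refine memH10_of_hasTraceOnCircle hR ((hu.mem.1 i).sub (memH1_vStar hf)) ?_ ?_
  · refine (hu.mem.2.1 i).sub_of_eqOn (hu.mem.1 i) (memH1_vStar hf) hz hzV fun θ => ?_
    rw [he _ (norm_circlePoint_mem_Icc (left_mem_Icc.2 hR.le) θ), comp_vStar_inner]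
    rfl
  · refine (hu.outer_boundary i).sub_of_eqOn (hu.mem.1 i) (memH1_vStar hf) hz hzV fun θ => ?_
    rw [he _ (norm_circlePoint_mem_Icc (right_mem_Icc.2 hR.le) θ), comp_vStar_outer hR]

lemma IsWeakSolution.memH10Sigma_sub_vStar (hR : 1 < R) (hu : IsWeakSolution R ω f u)
    (hf : MemLp fθ 2 (volume.restrict (Ioo 1 R))) :
    MemH10Sigma (annulus R) fun x => u x - vStar R ω fθ x := by
  refine ⟨fun i => hu.memH10_sub_vStar hR hf i, ?_⟩
  have hd : ∀ i, weakPartial (annulus R) i (comp (fun x => u x - vStar R ω fθ x) i)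
      =ᵐ[volume.restrict (annulus R)] fun x => weakPartial (annulus R) i (comp u i) x -
        weakPartial (annulus R) i (comp (vStar R ω fθ) i) x := fun i =>
    (hu.mem.1 i).weakPartial_sub (i := i) isOpen_annulus (memH1_vStar (ω := ω) hf)
  filter_upwards [hd 0, hd 1, hu.mem.2.2, weakDiv_vStar (ω := ω) hf] with x h0 h1 h2 h3
  simp only [weakDiv, Fin.sum_univ_two] at h2 h3 ⊢
  rw [h0, h1]
  linarith

lemma memLp_four_vStar (hf : MemLp fθ 2 (volume.restrict (Ioo 1 R))) :
    MemLp (comp (vStar R ω fθ) i) 4 (volume.restrict (annulus R)) := by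
  obtain ⟨z, hz, he⟩ := exists_contDiff_extension_vStar (ω := ω) hf i
  have hzV := ae_annulus fun x hx => he x (norm_mem_Icc_of_mem_annulus hx)
  obtain ⟨C, hC⟩ := (isCompact_closedBall (0 : Plane) R).exists_bound_of_continuousOn
    hz.continuous.continuousOn
  refine (memLp_congr_ae hzV).1 (MemLp.of_bound hz.continuous.aestronglyMeasurable C ?_)
  exact ae_annulus fun x hx => hC x (mem_closedBall_zero_iff.2 (mem_annulus.1 hx).2.le)

/-- The energy of the difference between a weak solution and the explicit flow. -/
lemma IsWeakSolution.energy_identity_vStar (hR : 1 < R) (hf2 : MemL2 (annulus R) f)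
    (hu : IsWeakSolution R ω f u) (hf : IsPolarRep R f fρ fθ)
    (huv : v = fun x => u x - vStar R ω fθ x) :
    ∑ i, ∑ j, ∫ x in annulus R, weakPartial (annulus R) j (comp v i) x ^ 2 =
      -∑ i, ∑ j, ∫ x in annulus R,
        (comp v j x * comp v i x) * weakPartial (annulus R) j (comp (vStar R ω fθ) i) x := by
  subst huv
  exact hu.energy_identity ((isStrongSolution_vStar hR hf).isWeakSolution hf2)
    (fun i => memLp_four_vStar hf.2.1) (fun i => rfl) (hu.memH10Sigma_sub_vStar hR hf.2.1)

lemma ae_eq_zero_of_integral_sq_eq_zero {α : Type*} [MeasurableSpace α] {μ : Measure α}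
    {a : α → ℝ} (ha : MemLp a 2 μ) (h : ∫ x, a x ^ 2 ∂μ = 0) : a =ᵐ[μ] 0 := by
  have := (integral_eq_zero_iff_of_nonneg (fun x => sq_nonneg (a x)) ha.integrable_sq).1 h
  filter_upwards [this] with x hx
  simpa using hx

lemma MemH10Sigma.ae_eq_zero_of_energy (hv : MemH10Sigma (annulus R) v)
    (h : ∑ i, ∑ j, ∫ x in annulus R, weakPartial (annulus R) j (comp v i) x ^ 2 = 0) :
    v =ᵐ[volume.restrict (annulus R)] 0 := by
  have hn : ∀ i j, 0 ≤ ∫ x in annulus R, weakPartial (annulus R) j (comp v i) x ^ 2 := fun i j =>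
    integral_nonneg fun x => sq_nonneg _
  have hz : ∀ i, comp v i =ᵐ[volume.restrict (annulus R)] 0 := fun i => by
    refine (hv.1 i).ae_eq_zero fun j => ae_eq_zero_of_integral_sq_eq_zero
      ((hv.1 i).1.memL2_weakPartial isOpen_annulus) ?_
    have h1 := (Finset.sum_eq_zero_iff_of_nonneg fun i _ =>
      Finset.sum_nonneg fun j _ => hn i j).1 h i (Finset.mem_univ i)
    exact (Finset.sum_eq_zero_iff_of_nonneg fun j _ => hn i j).1 h1 j (Finset.mem_univ j)
  filter_upwards [hz 0, hz 1] with x h0 h1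
  exact plane_ext h0 h1

/-- The radial component of a rotationally invariant divergence-free field without normal flux
through the boundary vanishes: test the divergence with a primitive of this component. -/
lemma MemH10Sigma.radial_ae_eq_zero {g h : ℝ → ℝ} (hv : MemH10Sigma (annulus R) v)
    (hp : IsPolarRep R v g h) : (fun x : Plane => g ‖x‖) =ᵐ[volume.restrict (annulus R)] 0 := by
  have hΩ := isOpen_annulus (R := R)
  obtain ⟨hg, -, hp⟩ := hp
  have hgL : MemL2 (annulus R) fun x => g ‖x‖ := MemLp.comp_norm hg
  set ψ : Plane → ℝ := fun x => ∫ t in (1 : ℝ)..‖x‖, g t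
  have hψ : MemL2 (annulus R) ψ := memL2_comp_norm_of_continuousOn
    (continuousOn_primitive_of_integrableOn (integrableOn_of_memLp_two hg))
  have hD := fun j => (hv.1 j).1.memL2_weakPartial (i := j) hΩ
  have e : ∀ j, ∫ x in annulus R, ψ x * weakPartial (annulus R) j (comp v j) x =
      -∫ x in annulus R, g ‖x‖ * (x j / ‖x‖) * comp v j x := fun j =>
    integral_mul_weakPartial hΩ hψ (hasWeakPartial_primitive_norm (integrableOn_of_memLp_two hg))
      (memL2_mul_apply_div_norm hgL j) (hv.1 j)
  have e1 : ∑ j, ∫ x in annulus R, ψ x * weakPartial (annulus R) j (comp v j) x = 0 := by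
    rw [← integral_fin_two fun j => integrable_mul_of_memLp_two hψ (hD j)]
    refine integral_eq_zero_of_ae ?_
    filter_upwards [hv.2] with x hx
    simp only [weakDiv] at hx
    rw [← Finset.mul_sum, hx, mul_zero]
    rfl
  simp only [e, Finset.sum_neg_distrib, neg_eq_zero] at e1
  rw [← integral_fin_two fun j => integrable_mul_of_memLp_two (memL2_mul_apply_div_norm hgL j)
    (hv.1 j).1.1] at e1
  refine ae_eq_zero_of_integral_sq_eq_zero hgL ?_
  rw [← e1]
  refine integral_congr_ae ?_
  filter_upwards [hp, ae_restrict_mem hΩ.measurableSet] with x hx hxΩ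
  have h0 := norm_ne_zero_of_mem_annulus hxΩ
  have hsq := sq_norm_plane x
  simp only [Fin.sum_univ_two, comp, hx, PiLp.add_apply, PiLp.smul_apply, smul_eq_mul,
    rhoHat_apply, thetaHat_apply, perp_zero, perp_one]
  generalize ‖x‖ = r at *
  field_simp
  rw [hsq]
  ring

lemma RotInvField.sub {Ω : Set Plane} {w : Plane → Plane} (hu : RotInvField Ω u)
    (hw : RotInvField Ω w) : RotInvField Ω fun x => u x - w x := fun φ => by
  filter_upwards [hu φ, hw φ] with x h1 h2
  rw [h1, h2]
  simp only [act, WithLp.ofLp_sub, Matrix.mulVec_sub, WithLp.toLp_sub]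

lemma ae_eq_of_ae_sub_eq_zero {Ω : Set Plane} {w : Plane → Plane}
    (h : (fun x => u x - w x) =ᵐ[volume.restrict Ω] 0) : u =ᵐ[volume.restrict Ω] w :=
  h.mono fun _ hx => sub_eq_zero.1 hx

/-- The difference `v` of two rotationally invariant solutions has no radial component, and for purely
angular `v` the production term `(v · ∇) v_* · v` vanishes pointwise: the symmetric part of `∇ v_*` is
a multiple of the symmetrization of `ρ̂ ⊗ θ̂`. -/
theorem IsWeakSolution.ae_eq_vStar_of_rotInv (hR : 1 < R) (hf2 : MemL2 (annulus R) f)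
    (hf : IsPolarRep R f fρ fθ) (hu : IsWeakSolution R ω f u) (hrot : RotInvField (annulus R) u) :
    u =ᵐ[volume.restrict (annulus R)] vStar R ω fθ := by
  have hΩ := isOpen_annulus (R := R)
  refine ae_eq_of_ae_sub_eq_zero ?_
  set v : Plane → Plane := fun x => u x - vStar R ω fθ x with hvdef
  have hv := hu.memH10Sigma_sub_vStar hR hf.2.1
  obtain ⟨g, h, hp⟩ := exists_isPolarRep (u := v) (fun i => (hv.1 i).1.1)
    (hrot.sub (rotInvField_smul_thetaHat (vProfile R ω fθ)))
  refine hv.ae_eq_zero_of_energy ?_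
  rw [hu.energy_identity_vStar hR hf2 hf hvdef, neg_eq_zero]
  have I : ∀ i j, IntegrableOn (fun x => (comp v j x * comp v i x) *
      weakPartial (annulus R) j (comp (vStar R ω fθ) i) x) (annulus R) := fun i j =>
    integrable_mul_of_memLp_two (memLp_mul (r := 2) (hv.1 j).memLp_four (hv.1 i).memLp_four)
      ((memH1_vStar hf.2.1).memL2_weakPartial hΩ)
  simp_rw [← integral_fin_two (I _)]
  rw [← integral_fin_two fun i => integrable_finsetSum _ fun j _ => I i j]
  refine integral_eq_zero_of_ae ?_
  have hd : ∀ᵐ x ∂volume.restrict (annulus R), ∀ i j,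
      weakPartial (annulus R) j (comp (vStar R ω fθ) i) x = gradVStar R ω fθ i j x := by
    simp_rw [ae_all_iff]
    exact fun i j => weakPartial_vStar hf.2.1
  filter_upwards [hd, hv.radial_ae_eq_zero hp, hp.2.2] with x hx hg hvx
  have hg0 : g ‖x‖ = 0 := hg
  simp only [hx, gradVStar, Fin.sum_univ_two, comp, hvx, hg0, PiLp.add_apply, PiLp.smul_apply,
    smul_eq_mul, thetaHat_apply, perp_zero, perp_one, perpCoeff, Pi.zero_apply]
  simp
  ring

/-- The Poincaré inequality with the constant defined as an infimum, which is bounded below by `0`. -/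
lemma dirichletEigenvalue_mul_le {Ω : Set Plane} (hφ : MemH10 Ω φ) :
    dirichletEigenvalue Ω * ∫ x in Ω, φ x ^ 2 ≤ ∑ j, ∫ x in Ω, weakPartial Ω j φ x ^ 2 := by
  have hnn : ∀ ψ : Plane → ℝ, 0 ≤ ∑ j, ∫ x in Ω, weakPartial Ω j ψ x ^ 2 := fun ψ =>
    Finset.sum_nonneg fun j _ => integral_nonneg fun x => sq_nonneg _
  have hnn2 : ∀ ψ : Plane → ℝ, 0 ≤ ∫ x in Ω, ψ x ^ 2 := fun ψ =>
    integral_nonneg fun x => sq_nonneg _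
  by_cases h0 : ∫ x in Ω, φ x ^ 2 = 0
  · rw [h0, mul_zero]
    exact hnn φ
  · have hpos : 0 < ∫ x in Ω, φ x ^ 2 := lt_of_le_of_ne (hnn2 φ) (Ne.symm h0)
    rw [← le_div_iff₀ hpos]
    refine csInf_le ⟨0, ?_⟩ ⟨φ, hφ, fun hz => h0 (integral_eq_zero_of_ae ?_), rfl⟩
    · rintro c ⟨ψ, -, -, rfl⟩
      exact div_nonneg (hnn ψ) (hnn2 ψ)
    · filter_upwards [hz] with x hx
      simp [hx]

/-- Integration by parts in the production term moves the derivative from the explicit flow to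
the perturbation. -/
lemma MemH10Sigma.sum_integral_production (hv : MemH10Sigma (annulus R) v)
    (hf : MemLp fθ 2 (volume.restrict (Ioo 1 R))) (i : Fin 2) :
    -∑ j, ∫ x in annulus R,
        (comp v j x * comp v i x) * weakPartial (annulus R) j (comp (vStar R ω fθ) i) x =
      ∑ j, ∫ x in annulus R, (comp v j x * comp (vStar R ω fθ) i x) *
        weakPartial (annulus R) j (comp v i) x := by
  have hΩ := isOpen_annulus (R := R)
  obtain ⟨z, hz, he⟩ := exists_contDiff_extension_vStar (ω := ω) hf i
  have hzV := ae_annulus fun x hx => he x (norm_mem_Icc_of_mem_annulus hx)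
  have hdz := fun j => partialDeriv_ae_eq_weakPartial (i := j) hΩ hz hzV
  have hv0 := fun j => (hv.1 j).1.1
  have hD := fun j k => (hv.1 k).1.memL2_weakPartial (i := j) hΩ
  have p1 := fun j => MemL2.mul_continuous (hv0 j) hz.continuous
  have p2 := fun j k => MemL2.mul_continuous (hD j k) hz.continuous
  have p3 := fun j => MemL2.mul_continuous (hv0 j) (continuous_partialDeriv (i := j) hz)
  have e : ∀ j, ∫ x in annulus R, (comp v j x * comp (vStar R ω fθ) i x) *
        weakPartial (annulus R) j (comp v i) x =
      -((∫ x in annulus R, (weakPartial (annulus R) j (comp v j) x * z x) * comp v i x) +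
        ∫ x in annulus R, (comp v j x * comp v i x) *
          weakPartial (annulus R) j (comp (vStar R ω fθ) i) x) := by
    intro j
    have h1 := integral_mul_weakPartial hΩ (p1 j) ((hv.1 j).hasWeakPartial_mul (j := j) hΩ hz)
      ((p2 j j).add (p3 j)) (hv.1 i)
    have h2 : ∫ x in annulus R, (comp v j x * comp v i x) *
        weakPartial (annulus R) j (comp (vStar R ω fθ) i) x =
        ∫ x in annulus R, (comp v j x * partialDeriv j z x) * comp v i x := by
      refine integral_congr_ae ?_
      filter_upwards [hdz j] with x hx
      rw [← hx]
      ring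
    have h3 : ∫ x in annulus R, (comp v j x * comp (vStar R ω fθ) i x) *
        weakPartial (annulus R) j (comp v i) x =
        ∫ x in annulus R, (comp v j x * z x) * weakPartial (annulus R) j (comp v i) x := by
      refine integral_congr_ae ?_
      filter_upwards [hzV] with x hx
      rw [← hx]
    rw [h2, h3, h1, ← integral_add (integrable_mul_of_memLp_two (p2 j j) (hv0 i))
      (integrable_mul_of_memLp_two (p3 j) (hv0 i))]
    simp only [add_mul]
  have e0 : ∑ j, ∫ x in annulus R, (weakPartial (annulus R) j (comp v j) x * z x) * comp v i x =
      0 := by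
    rw [← integral_fin_two fun j => integrable_mul_of_memLp_two (p2 j j) (hv0 i)]
    refine integral_eq_zero_of_ae ?_
    filter_upwards [hv.2] with x hx
    simp only [weakDiv] at hx
    rw [← Finset.sum_mul, ← Finset.sum_mul, hx, zero_mul, zero_mul]
    rfl
  simp only [e, Finset.sum_neg_distrib, Finset.sum_add_distrib, e0, zero_add]

lemma constK_nonneg (hω : 0 ≤ ω) : 0 ≤ constK R ω fθ :=
  add_nonneg hω (by
    rcases le_or_gt 1 R with h | h
    · positivity
    · simp [Real.sqrt_eq_zero_of_nonpos (by linarith : R - 1 ≤ 0)])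

/-- The energy of the difference is at most `K_R(ω, f)²` times its squared `L²` norm, while the
Dirichlet eigenvalue gives the opposite inequality. -/
theorem IsWeakSolution.ae_eq_vStar_of_small (hR : 1 < R) (hω : 0 ≤ ω) (hf2 : MemL2 (annulus R) f)
    (hf : IsPolarRep R f fρ fθ)
    (hsmall : constK R ω fθ < Real.sqrt (dirichletEigenvalue (annulus R)))
    (hu : IsWeakSolution R ω f u) : u =ᵐ[volume.restrict (annulus R)] vStar R ω fθ := by
  have hΩ := isOpen_annulus (R := R)
  refine ae_eq_of_ae_sub_eq_zero ?_
  set v : Plane → Plane := fun x => u x - vStar R ω fθ x with hvdef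
  have hv : MemH10Sigma (annulus R) v := hu.memH10Sigma_sub_vStar hR hf.2.1
  set K := constK R ω fθ with hK
  set E := ∑ i, ∑ j, ∫ x in annulus R, weakPartial (annulus R) j (comp v i) x ^ 2 with hE
  set N := ∑ i, ∫ x in annulus R, comp v i x ^ 2 with hN
  have hKl : K ^ 2 < dirichletEigenvalue (annulus R) :=
    (Real.lt_sqrt (constK_nonneg hω)).1 hsmall
  have hlow : dirichletEigenvalue (annulus R) * N ≤ E := by
    rw [hN, Finset.mul_sum]
    exact Finset.sum_le_sum fun i _ => dirichletEigenvalue_mul_le (hv.1 i)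
  have hv0 := fun j => (hv.1 j).1.1
  have hD := fun i j => (hv.1 i).1.memL2_weakPartial (i := j) hΩ
  have p : ∀ i j, MemL2 (annulus R) fun x => comp v j x * comp (vStar R ω fθ) i x := fun i j =>
    memLp_mul (hv.1 j).memLp_four (memLp_four_vStar hf.2.1)
  have I1 := fun i j => integrable_mul_of_memLp_two (p i j) (hD i j)
  have I2 := fun i j => (hD i j).integrable_sq
  have I3 := fun i => (hv0 i).integrable_sq
  have hN' : N = ∫ x in annulus R, ∑ i, comp v i x ^ 2 := (integral_fin_two I3).symm
  have hE' : E = ∫ x in annulus R, ∑ i, ∑ j, weakPartial (annulus R) j (comp v i) x ^ 2 := by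
    rw [integral_fin_two fun i => integrable_finsetSum _ fun j _ => I2 i j]
    simp_rw [integral_fin_two (I2 _)]
    rfl
  have hup : E ≤ 1 / 2 * (K ^ 2 * N + E) := by
    have h1 : E = ∫ x in annulus R, ∑ i, ∑ j, (comp v j x * comp (vStar R ω fθ) i x) *
        weakPartial (annulus R) j (comp v i) x := by
      rw [integral_fin_two fun i => integrable_finsetSum _ fun j _ => I1 i j]
      simp_rw [integral_fin_two (I1 _)]
      rw [hE, hu.energy_identity_vStar hR hf2 hf hvdef, ← Finset.sum_neg_distrib]
      exact Finset.sum_congr rfl fun i _ => hv.sum_integral_production hf.2.1 i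
    have J3 : IntegrableOn (fun x => ∑ i, comp v i x ^ 2) (annulus R) :=
      integrable_finsetSum _ fun i _ => I3 i
    have J2 : IntegrableOn (fun x => ∑ i, ∑ j, weakPartial (annulus R) j (comp v i) x ^ 2)
        (annulus R) := integrable_finsetSum _ fun i _ => integrable_finsetSum _ fun j _ => I2 i j
    rw [hN', hE', ← integral_const_mul, ← integral_add (J3.const_mul _) J2, ← integral_const_mul,
      ← hE', h1]
    refine integral_mono_ae (integrable_finsetSum _ fun i _ => integrable_finsetSum _ fun j _ =>
      I1 i j) (((J3.const_mul _).add J2).const_mul _) ?_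
    refine ae_annulus fun x hx => ?_
    have hV : (∑ i, comp (vStar R ω fθ) i x ^ 2) ≤ K ^ 2 := by
      have hn := norm_mem_Icc_of_mem_annulus hx
      have h0 := norm_ne_zero_of_mem_annulus hx
      have hb := sq_le_sq.2 ((abs_vProfile_le hR hω hf.2.1 hn).trans (le_abs_self _))
      refine le_of_eq_of_le ?_ hb
      have hsq := sq_norm_plane x
      simp only [Fin.sum_univ_two, comp, vStar, PiLp.smul_apply, smul_eq_mul, thetaHat_zero,
        thetaHat_one]
      generalize ‖x‖ = r at *
      field_simp
      rw [hsq]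
      ring
    simp only [Fin.sum_univ_two] at hV ⊢
    -- apply `2 p q ≤ p² + q²` to each product `(v_j V_i) (∂_j v_i)`
    generalize comp (vStar R ω fθ) 0 x = a at *
    generalize comp (vStar R ω fθ) 1 x = b at *
    generalize comp v 0 x = c
    generalize comp v 1 x = d
    generalize weakPartial (annulus R) 0 (comp v 0) x = g₁
    generalize weakPartial (annulus R) 0 (comp v 1) x = g₂
    generalize weakPartial (annulus R) 1 (comp v 0) x = g₃
    generalize weakPartial (annulus R) 1 (comp v 1) x = g₄
    nlinarith [mul_le_mul_of_nonneg_right hV (by positivity : 0 ≤ c ^ 2 + d ^ 2),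
      sq_nonneg (c * a - g₁), sq_nonneg (d * a - g₃), sq_nonneg (c * b - g₂),
      sq_nonneg (d * b - g₄)]
  have hN0 : N = 0 := by
    have : 0 ≤ N := Finset.sum_nonneg fun i _ => integral_nonneg fun x => sq_nonneg _
    nlinarith
  have hE0 : E = 0 := by
    have : 0 ≤ E := Finset.sum_nonneg fun i _ => Finset.sum_nonneg fun j _ =>
      integral_nonneg fun x => sq_nonneg _
    rw [hN0] at hup
    linarith
  exact hv.ae_eq_zero_of_energy hE0

/-- The velocity determines the pressure gradient through the momentum equation, hence the pressure
up to a constant. -/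
lemma IsStrongSolution.pressure_ae_eq_add_const {w : Plane → Plane} {p q : Plane → ℝ}
    (hu : IsStrongSolution R ω f u p) (hw : IsStrongSolution R ω f w q)
    (h : u =ᵐ[volume.restrict (annulus R)] w) :
    ∃ c : ℝ, p =ᵐ[volume.restrict (annulus R)] fun x => q x + c := by
  refine hu.pressure_memH1.exists_ae_eq_add_const hw.pressure_memH1 fun i => ?_
  have hd : ∀ i j, weakPartial (annulus R) j (comp u i) = weakPartial (annulus R) j (comp w i) :=
    fun i j => weakPartial_congr (h.mono fun x hx => by simp only [comp, hx])
  filter_upwards [hu.momentum, hw.momentum, h] with x h1 h2 hx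
  have h1 := h1 i
  have h2 := h2 i
  simp only [weakLaplacian, convection, hd, hx] at h1 h2
  linarith

end

end TaylorCouette

end

theorem theorem2p1 (R ω : ℝ) (hR : 1 < R) (hω : 0 ≤ ω)
    (f : Plane → Plane) (hf : MemL2 (annulus R) f) (hrot : RotInvField (annulus R) f) :
    -- `f` has radial and angular components, and the claims below hold for them
    (∃ fρ fθ : ℝ → ℝ, IsPolarRep R f fρ fθ) ∧
    ∀ fρ fθ : ℝ → ℝ, IsPolarRep R f fρ fθ →
      -- the explicit flow is a rotationally invariant strong and weak solution
      IsStrongSolution R ω f (vStar R ω fθ) (qStar R ω fρ fθ) ∧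
      IsWeakSolution R ω f (vStar R ω fθ) ∧
      RotInvField (annulus R) (vStar R ω fθ) ∧
      RotInvScalar (annulus R) (qStar R ω fρ fθ) ∧
      -- it is unique among rotationally invariant strong solutions, and weak ones
      (∀ (u : Plane → Plane) (p : Plane → ℝ), IsStrongSolution R ω f u p →
        RotInvField (annulus R) u → RotInvScalar (annulus R) p →
        u =ᵐ[volume.restrict (annulus R)] vStar R ω fθ ∧
        ∃ c : ℝ, p =ᵐ[volume.restrict (annulus R)] fun x => qStar R ω fρ fθ x + c) ∧
      (∀ u : Plane → Plane, IsWeakSolution R ω f u → RotInvField (annulus R) u →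
        u =ᵐ[volume.restrict (annulus R)] vStar R ω fθ) ∧
      -- under the smallness condition it is unique among all strong solutions, and weak ones
      (constK R ω fθ < Real.sqrt (dirichletEigenvalue (annulus R)) →
        (∀ (u : Plane → Plane) (p : Plane → ℝ), IsStrongSolution R ω f u p →
          u =ᵐ[volume.restrict (annulus R)] vStar R ω fθ ∧
          ∃ c : ℝ, p =ᵐ[volume.restrict (annulus R)] fun x => qStar R ω fρ fθ x + c) ∧
        (∀ u : Plane → Plane, IsWeakSolution R ω f u →
          u =ᵐ[volume.restrict (annulus R)] vStar R ω fθ)) := by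
  refine ⟨exists_isPolarRep (fun i => MemL2.comp hf i) hrot, fun fρ fθ hp => ?_⟩
  have hs := isStrongSolution_vStar (ω := ω) hR hp
  have hrw : ∀ u : Plane → Plane, IsWeakSolution R ω f u → RotInvField (annulus R) u →
      u =ᵐ[volume.restrict (annulus R)] vStar R ω fθ := fun u hu hur =>
    hu.ae_eq_vStar_of_rotInv hR hf hp hur
  refine ⟨hs, hs.isWeakSolution hf, rotInvField_smul_thetaHat _,
    rotInvScalar_comp_norm fun ρ => (∫ t in (1 : ℝ)..ρ, 1 / t * vProfile R ω fθ t ^ 2) +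
      ∫ t in (1 : ℝ)..ρ, fρ t, fun u p hu hur _ => ?_, hrw, fun hK => ⟨fun u p hu => ?_,
    fun u hu => hu.ae_eq_vStar_of_small hR hω hf hp hK⟩⟩
  · have h := hrw u (hu.isWeakSolution hf) hur
    exact ⟨h, hu.pressure_ae_eq_add_const hs h⟩
  · have h := (hu.isWeakSolution hf).ae_eq_vStar_of_small hR hω hf hp hK
    exact ⟨h, hu.pressure_ae_eq_add_const hs h⟩
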